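/- **Setting.** Let $A\in\mathbb R^{k\times n}$ have rows $a_1,\dots,a_k$, let $S_1,\dots,S_m$ be a partition of $[k]$ into nonempty groups, let $p_1,\dots,p_m\in(0,\infty)$ and $p\in(0,\infty)$; $\log$ is to base $2$. For $r>0$ and $y\in\mathbb R^k$ put $\|y\|_{\mathcal G,r}=\big(\sum_{i=1}^m\|y_{S_i}\|_{p_i}^r\big)^{1/r}$ and $B_p=\{x\in\mathbb R^n:\|Ax\|_{\mathcal G,p}\le 1\}$. The covering number $\mathcal N(X,Y)$ is the least number of translates of $Y$ that cover $X$. The leverage score of the $j$-th row $m_j$ of a matrix $M$ is $\tau_j(M)=m_j^\top(M^\top M)^{-1}m_j$, with the pseudoinverse. For a probability measure $\lambda$ on $[m]$ (with $\lambda_i>0$ unless $A_{S_i}=0$; where $\lambda_i=0$ the corresponding terms below are read as $0$) let $\Lambda$ be the diagonal $k\times k$ matrix with $\Lambda_{jj}=\lambda_i$ for $j\in S_i$. A positive diagonal matrix $W=\operatorname{diag}(w)$ is a rounding matrix for $\lambda$ if $\|W^{1/2}\Lambda^{1/2-1/p}Ax\|_2\le\|\Lambda^{1/2-1/p}Ax\|_{\mathcal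 G,2}$ for all $x\in\mathbb R^n$. For $F^\star>0$, such a pair $(\lambda,W)$ is an $F^\star$-block Lewis overestimate if for all $i\in[m]$ $$\frac1{\lambda_i}\Big(\sum_{j\in S_i}\Big(\frac{\tau_j(W^{1/2}\Lambda^{1/2-1/p}A)}{w_j}\Big)^{p_i/2}\Big)^{2/p_i}\le F^\star .$$ Its importances are $$\alpha_i^p=\lambda_i^{1-p/2}\Big(\sum_{j\in S_i}\Big(\frac{\tau_j(W^{1/2}\Lambda^{1/2-1/p}A)}{w_j}\Big)^{p_i/2}\Big)^{p/p_i}.$$ Suppose that at least one of the following holds: 1. $p>1/\log n$ and $|S_1|=\dots=|S_m|=1$ (with $n\ge2$); 2. $p=p_1=\dots=p_m<2$; 3. $p\ge1$ and $p_1,\dots,p_m\ge2$; 4. $p_1=\dots=p_m=2$ and $1/\log n\le p<\infty$ (with $n\ge 2$). In cases 1, 3 and 4 let $(\lambda,W)$ be an $F^\star$-block Lewis overestimate and $\alpha$ its importances. In case 2 let $(\widehat\lambda,W)$, with $\widehat\lambda$ a probability measure on the row set $[k]$, be an $F^\star$-block Lewis overestimate for the partition of $[k]$ into singletons, let $\widehat\alpha$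 be its importances, and put $\alpha_i^p=\sum_{j\in S_i}\widehat\alpha_j^p$. **Theorem.** There is a constant $C(p)>0$ depending only on $p$ such that the following holds. Let $S\subseteq[m]$ have size $\widetilde m$, let $\rho$ be a probability distribution on $[m]$, let $H\ge1$ satisfy $H\rho_i\ge\alpha_i^p/\sum_{l}\alpha_l^p$ for all $i\in[m]$ (the right-hand side is read as $0$ if $\alpha=0$), let $K=\{x\in\mathbb R^n:\max_{i\in S}\rho_i^{-1/p}\|A_{S_i}x\|_{p_i}\le1\}$ be the sampling body (terms with $A_{S_i}=0$ are read as $0$), and let $p^\star=\max\{1,\max_i\min\{p_i,\log|S_i|\}\}$. Then for every $\eta>0$ the covering number $\mathcal N(B_p,\eta K)$ is finite and $$\log\mathcal N(B_p,\eta K)\le C(p)\,\eta^{-\min(2,p)}\,H^{2/\max(p,2)}\,p^\star\,F^\star\,\log\max\{2,\widetilde m,F^\star\}.$$ **Corollary.** If $n,m\ge1$, then in each of the four cases an $F^\star$-block Lewis overestimate of the kind considered above exists with $F^\star=n$; hence for it, with the same $S,\rho,H,\eta$ as in the theorem, $$\log\mathcal N(B_p,\eta K)\le C(p)\,\eta^{-\min(2,p)}\,H^{2/\max(p,2)}\,p^\star\,n\,\log\max\{2,\widetilde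 m,n\}.$$ -/

import Mathlib

open scoped Matrix Pointwise

noncomputable section

/-- The inverse of a real symmetric matrix in the spectral (Moore-Penrose) sense
`∑ μ_i⁻¹ u_i u_iᵀ`, the sum over the nonzero eigenvalues `μ_i` (recall `0⁻¹ = 0`). -/
def symPinv {n : ℕ} (M : Matrix (Fin n) (Fin n) ℝ) (hM : M.IsHermitian) :
    Matrix (Fin n) (Fin n) ℝ :=
  (hM.eigenvectorUnitary : Matrix (Fin n) (Fin n) ℝ) *
    Matrix.diagonal (fun i => (hM.eigenvalues i)⁻¹) *
    (hM.eigenvectorUnitary : Matrix (Fin n) (Fin n) ℝ)ᵀ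

/-- The leverage score `τ_j(M) = m_jᵀ (Mᵀ M)⁻¹ m_j` of the `j`-th row `m_j` of `M`. -/
def leverageScore {k n : ℕ} (M : Matrix (Fin k) (Fin n) ℝ) (j : Fin k) : ℝ :=
  M j ⬝ᵥ (symPinv (Mᵀ * M) (Matrix.isHermitian_conjTranspose_mul_self M) *ᵥ M j)

/-- The `ℓ_q` (quasi-)norm of the coordinates of `y` with index in `s`. -/
def lqNorm {k : ℕ} (s : Finset (Fin k)) (q : ℝ) (y : Fin k → ℝ) : ℝ :=
  (∑ j ∈ s, |y j| ^ q) ^ (1 / q)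

/-- The covering number: the least number of translates of `Y` whose union contains `X`
(`⊤` if finitely many never suffice). -/
def coveringNumber {n : ℕ} (X Y : Set (Fin n → ℝ)) : ℕ∞ :=
  ⨅ (t : Finset (Fin n → ℝ)) (_ : X ⊆ ⋃ c ∈ t, (fun y => c + y) '' Y), (t.card : ℕ∞)

/-- A probability vector. -/
def IsProbVec {m : ℕ} (v : Fin m → ℝ) : Prop :=
  (∀ i, 0 ≤ v i) ∧ ∑ i, v i = 1

/-- A matrix `A ∈ ℝ^{k × n}`, a partition of its rows into `m` nonempty groups
`S_i = {j | grp j = i}`, and an inner exponent `q i > 0` for every group. -/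
structure BlockData (k n m : ℕ) where
  A : Matrix (Fin k) (Fin n) ℝ
  grp : Fin k → Fin m
  grp_surjective : Function.Surjective grp
  q : Fin m → ℝ
  q_pos : ∀ i, 0 < q i

namespace BlockData

variable {k n m : ℕ} (G : BlockData k n m)

/-- The group `S_i`. -/
def block (i : Fin m) : Finset (Fin k) := Finset.univ.filter (fun j => G.grp j = i)

/-- `‖y‖_{𝒢,r} = (∑_i ‖y_{S_i}‖_{q_i}^r)^{1/r}`. -/
def gnorm (r : ℝ) (y : Fin k → ℝ) : ℝ :=
  (∑ i, lqNorm (G.block i) (G.q i) y ^ r) ^ (1 / r)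

/-- `B_p = {x | ‖A x‖_{𝒢,p} ≤ 1}`. -/
def unitBall (p : ℝ) : Set (Fin n → ℝ) := {x | G.gnorm p (G.A *ᵥ x) ≤ 1}

/-- `max_{i ∈ S} ρ_i^{-1/p} ‖A_{S_i} x‖_{q_i}` (zero for empty `S`). -/
def samplingNorm (p : ℝ) (S : Finset (Fin m)) (ρ : Fin m → ℝ) (x : Fin n → ℝ) : ℝ :=
  ⨆ i : S, ρ i ^ (-(1 / p)) * lqNorm (G.block i) (G.q i) (G.A *ᵥ x)

/-- The sampling body, the unit ball of `samplingNorm`. -/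
def samplingBody (p : ℝ) (S : Finset (Fin m)) (ρ : Fin m → ℝ) : Set (Fin n → ℝ) :=
  {x | G.samplingNorm p S ρ x ≤ 1}

/-- A probability measure over the groups. A group may have mass zero only if all its rows
vanish; with the conventions of real division and powers such a group contributes `0` to
every quantity below. -/
def IsGroupMeasure (lam : Fin m → ℝ) : Prop :=
  IsProbVec lam ∧ ∀ j, G.A j ≠ 0 → 0 < lam (G.grp j)

/-- `Λ^{1/2-1/p} A`. -/
def scaled (p : ℝ) (lam : Fin m → ℝ) : Matrix (Fin k) (Fin n) ℝ :=
  Matrix.diagonal (fun j => lam (G.grp j) ^ (1 / 2 - 1 / p)) * G.A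

/-- `W^{1/2} Λ^{1/2-1/p} A`, with `W = diag(w)`. -/
def rounded (p : ℝ) (lam : Fin m → ℝ) (w : Fin k → ℝ) : Matrix (Fin k) (Fin n) ℝ :=
  Matrix.diagonal (fun j => w j ^ (1 / 2 : ℝ)) * G.scaled p lam

/-- `W = diag(w)` is a rounding matrix for `lam`: it is a positive diagonal matrix and
`‖W^{1/2} Λ^{1/2-1/p} A x‖_2 ≤ ‖Λ^{1/2-1/p} A x‖_{𝒢,2}` for all `x`. -/
def IsRounding (p : ℝ) (lam : Fin m → ℝ) (w : Fin k → ℝ) : Prop :=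
  (∀ j, 0 < w j) ∧
    ∀ x : Fin n → ℝ,
      ‖WithLp.toLp 2 (G.rounded p lam w *ᵥ x)‖ ≤ G.gnorm 2 (G.scaled p lam *ᵥ x)

/-- `(∑_{j ∈ S_i} (τ_j(W^{1/2} Λ^{1/2-1/p} A) / w_j)^{q_i/2})`. -/
def levSum (p : ℝ) (lam : Fin m → ℝ) (w : Fin k → ℝ) (i : Fin m) : ℝ :=
  ∑ j ∈ G.block i, (leverageScore (G.rounded p lam w) j / w j) ^ (G.q i / 2)

/-- The probability measure `lam` and the rounding matrix `diag(w)` form an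
`F`-block Lewis overestimate. -/
structure IsBlockLewisOverestimate (p F : ℝ) (lam : Fin m → ℝ) (w : Fin k → ℝ) : Prop where
  measure : G.IsGroupMeasure lam
  rounding : G.IsRounding p lam w
  pos : 0 < F
  bound : ∀ i, 1 / lam i * G.levSum p lam w i ^ (2 / G.q i) ≤ F

/-- The group importances `α_i^p = λ_i^{1-p/2} (∑_{j ∈ S_i} (τ_j / w_j)^{q_i/2})^{p/q_i}`. -/
def alphaPow (p : ℝ) (lam : Fin m → ℝ) (w : Fin k → ℝ) (i : Fin m) : ℝ :=
  lam i ^ (1 - p / 2) * G.levSum p lam w i ^ (p / G.q i)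

/-- The same matrix with every row as a group of its own (and all inner exponents `p`). -/
def rowwise (p : ℝ) (hp : 0 < p) : BlockData k n k where
  A := G.A
  grp := id
  grp_surjective := Function.surjective_id
  q := fun _ => p
  q_pos := fun _ => hp

/-- The group importances built from a measure `lamHat` over the single rows:
`α_i^p = ∑_{j ∈ S_i} α̂_j^p`. -/
def alphaPowHat (p : ℝ) (hp : 0 < p) (lamHat : Fin k → ℝ) (w : Fin k → ℝ) (i : Fin m) : ℝ :=
  ∑ j ∈ G.block i, (G.rowwise p hp).alphaPow p lamHat w j

/-- `p⋆ = max {1, max_i min {q_i, log₂ |S_i|}}`. -/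
def pStar : ℝ := max 1 (⨆ i, min (G.q i) (Real.logb 2 (G.block i).card))

/-- The regimes in which the measure lives on the groups: singleton groups and
`p > 1 / log₂ n`; or `p ≥ 1` and all `q_i ≥ 2`; or all `q_i = 2` and `p ≥ 1 / log₂ n`.
(The conditions on `1 / log₂ n` are multiplied out, so that they fail for `n ≤ 1`.) -/
def GroupRegime (p : ℝ) : Prop :=
  (1 < p * Real.logb 2 n ∧ ∀ i, (G.block i).card = 1) ∨
  (1 ≤ p ∧ ∀ i, 2 ≤ G.q i) ∨
  (1 ≤ p * Real.logb 2 n ∧ ∀ i, G.q i = 2)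

/-- The regime in which the measure lives on the single rows: `q_1 = ⋯ = q_m = p < 2`. -/
def RowRegime (p : ℝ) : Prop := p < 2 ∧ ∀ i, G.q i = p

/-- For all `S ⊆ [m]`, all sampling probabilities `ρ` and all `H ≥ 1` with
`H ρ_i ≥ α_i^p / ‖α‖_p^p` (where `aPow i = α_i^p`), and all `η > 0`:
`log₂ N(B_p, η K) ≤ C η^{-min(2,p)} H^{2/max(p,2)} p⋆ F log₂ max{2, |S|, F}`,
with `K` the sampling body; in particular the covering number is finite. -/
def CoveringBound (C p F : ℝ) (aPow : Fin m → ℝ) : Prop :=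
  ∀ (S : Finset (Fin m)) (ρ : Fin m → ℝ) (H η : ℝ),
    IsProbVec ρ → 1 ≤ H → (∀ i, aPow i / ∑ l, aPow l ≤ H * ρ i) → 0 < η →
    ∃ N : ℕ, coveringNumber (G.unitBall p) (η • G.samplingBody p S ρ) = N ∧
      Real.logb 2 N ≤
        C * η ^ (-(min 2 p)) * H ^ (2 / max p 2) * G.pStar * F *
          Real.logb 2 (max 2 (max (S.card : ℝ) F))

end BlockData

end

/-! A Lewis overestimate supplies a Euclidean structure
(`IsBlockLewisOverestimate.exists_embedding`): vectors `u_j` and a linear map `Z` with `(A x)_j =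
⟨u_j, Z x⟩`. The block norms of the lengths `‖u_j‖` are the importances `α_i`, they satisfy
`λ_i^{-1/p} α_i ≤ √F`, and `‖Z x‖²` is at most the `λ`-average of `f_i²`, where `f_i = λ_i^{-1/p}
‖A_{S_i} x‖`. Covering numbers are bounded by packing numbers, and these are counted in Euclidean
space.

The tool is a dual Sudakov inequality (`card_le_of_separated`): disjoint translates of a symmetric
set of at least half the Gaussian measure cannot be many. It is applied to weighted sums of `r`-th
powers of block norms, with `r = p⋆ + log₂ max {2, |S|, F}`. For such `r` the Gaussian `r`-th moment
of a block norm is at most `(4 √r α_i)^r`, and the maximum over `S` is within a factor `2` of an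
`ℓ_r` sum. So a Euclidean ball has few points separated by the sampling body
(`log_card_le_of_sampling`).

For `p ≥ 2` the body `B_p` lies in a Euclidean ball of radius `√2`. For `p < 2` it is first split
into small Euclidean clusters (`log_card_le_of_unitBall`). Scale `2σ` is refined to scale `σ` by
truncating `f_i` at height `σ`, which turns Euclidean separation into `ℓ_r` separation and brings
dual Sudakov back. The costs of the dyadic scales form a geometric series.

Existence with `F = n` is Lewis' change of position: maximize the determinant under a constraint on
the block norms. The first-order condition is the identity that gives the measure, the rounding
matrix and the leverage scores (`exists_lewis_position`, `exists_isBlockLewisOverestimate`). -/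

noncomputable section

/-! ### Leverage scores as squared lengths. -/

theorem transpose_mul_eigenvectorUnitary_diag {k n : ℕ} (M : Matrix (Fin k) (Fin n) ℝ)
    (hM : (Mᵀ * M).IsHermitian) :
    (M * (hM.eigenvectorUnitary : Matrix (Fin n) (Fin n) ℝ))ᵀ *
      (M * (hM.eigenvectorUnitary : Matrix (Fin n) (Fin n) ℝ)) =
      Matrix.diagonal hM.eigenvalues := by
  have h := hM.conjStarAlgAut_star_eigenvectorUnitary
  rw [Unitary.conjStarAlgAut_star_apply] at h
  have e : (RCLike.ofReal ∘ hM.eigenvalues : Fin n → ℝ) = hM.eigenvalues := by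
    ext i; simp
  rw [e, Matrix.star_eq_conjTranspose, Matrix.conjTranspose_eq_transpose_of_trivial] at h
  rw [Matrix.transpose_mul, ← h]
  simp only [Matrix.mul_assoc]

/-- Coordinates in which the leverage scores of `M` are squared lengths of vectors and `M x` is
given by inner products with these vectors. -/
theorem exists_leverage_embedding {k n : ℕ} (M : Matrix (Fin k) (Fin n) ℝ) :
    ∃ (Z : (Fin n → ℝ) →ₗ[ℝ] EuclideanSpace ℝ (Fin n)) (v : Fin k → EuclideanSpace ℝ (Fin n)),
      (∀ x, ‖Z x‖ = ‖WithLp.toLp 2 (M *ᵥ x)‖) ∧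
      (∀ j x, (M *ᵥ x) j = inner ℝ (v j) (Z x)) ∧
      (∀ j, ‖v j‖ ^ 2 = leverageScore M j) ∧ ∀ j, ∃ x, Z x = v j := by
  have hM : (Mᵀ * M).IsHermitian := Matrix.isHermitian_conjTranspose_mul_self M
  set U := (hM.eigenvectorUnitary : Matrix (Fin n) (Fin n) ℝ)
  set μ := hM.eigenvalues
  have key : (M * U)ᵀ * (M * U) = Matrix.diagonal μ :=
    transpose_mul_eigenvectorUnitary_diag M hM
  have hUU : U * Uᵀ = 1 := by
    have := Unitary.coe_mul_star_self hM.eigenvectorUnitary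
    rwa [Unitary.coe_star, Matrix.star_eq_conjTranspose, Matrix.conjTranspose_eq_transpose_of_trivial] at this
  have hUU' : Uᵀ * U = 1 := mul_eq_one_comm.1 hUU
  have hdiag : ∀ l, ∑ j, (M * U) j l ^ 2 = μ l := by
    intro l
    have := congrFun (congrFun key l) l
    rw [Matrix.mul_apply, Matrix.diagonal_apply_eq] at this
    rw [← this]
    exact Finset.sum_congr rfl fun j _ => by rw [Matrix.transpose_apply, sq]
  have hμ0 : ∀ l, 0 ≤ μ l := fun l => by
    rw [← hdiag l]; exact Finset.sum_nonneg fun j _ => sq_nonneg _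
  have hMU : ∀ j l, (Uᵀ *ᵥ M j) l = (M * U) j l := by
    intro j l
    simp [Matrix.mulVec, dotProduct, Matrix.mul_apply, mul_comm]
  -- A column of `M * U` over a zero eigenvalue vanishes, so nothing is lost where `(√(μ l))⁻¹` is
  -- read as `0`.
  have hzero : ∀ j l, μ l = 0 → (M * U) j l = 0 := by
    intro j l h
    have := (Finset.sum_eq_zero_iff_of_nonneg (fun j _ => sq_nonneg ((M * U) j l))).1
      ((hdiag l).trans h) j (Finset.mem_univ j)
    exact pow_eq_zero_iff (two_ne_zero) |>.1 this
  have hsq : ∀ l, √(μ l) * √(μ l) = μ l := fun l => Real.mul_self_sqrt (hμ0 l)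
  have hne : ∀ l, μ l ≠ 0 → √(μ l) ≠ 0 := fun l h h' => h ((Real.sqrt_eq_zero (hμ0 l)).1 h')
  have hMx : ∀ x, M *ᵥ x = (M * U) *ᵥ (Uᵀ *ᵥ x) := by
    intro x
    rw [Matrix.mulVec_mulVec, Matrix.mul_assoc, hUU, Matrix.mul_one]
  let Z : (Fin n → ℝ) →ₗ[ℝ] EuclideanSpace ℝ (Fin n) :=
    (WithLp.linearEquiv 2 ℝ (Fin n → ℝ)).symm.toLinearMap ∘ₗ
      (Matrix.diagonal (fun l => √(μ l)) * Uᵀ).mulVecLin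
  have hZ : ∀ x l, Z x l = √(μ l) * (Uᵀ *ᵥ x) l := by
    intro x l
    change ((Matrix.diagonal (fun l => √(μ l)) * Uᵀ) *ᵥ x) l = _
    rw [← Matrix.mulVec_mulVec, Matrix.mulVec_diagonal]
  let v : Fin k → EuclideanSpace ℝ (Fin n) := fun j =>
    WithLp.toLp 2 (fun l => (√(μ l))⁻¹ * (M * U) j l)
  refine ⟨Z, v, fun x => ?_, fun j x => ?_, fun j => ?_, fun j => ?_⟩
  · have : ‖Z x‖ ^ 2 = ‖WithLp.toLp 2 (M *ᵥ x)‖ ^ 2 := by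
      rw [EuclideanSpace.real_norm_sq_eq, EuclideanSpace.real_norm_sq_eq]
      have h1 : ∑ i, (WithLp.toLp 2 (M *ᵥ x)) i ^ 2 = (M *ᵥ x) ⬝ᵥ (M *ᵥ x) :=
        Finset.sum_congr rfl fun i _ => by rw [sq]
      rw [h1, hMx, Matrix.dotProduct_mulVec, ← Matrix.mulVec_transpose, Matrix.mulVec_mulVec, key]
      refine Finset.sum_congr rfl fun l _ => ?_
      rw [Matrix.mulVec_diagonal, hZ, mul_pow, sq √(μ l), hsq]; ring
    exact (sq_eq_sq₀ (norm_nonneg _) (norm_nonneg _)).1 this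
  · rw [hMx, PiLp.inner_apply]
    change ∑ l, (M * U) j l * (Uᵀ *ᵥ x) l = _
    refine Finset.sum_congr rfl fun l _ => ?_
    rw [hZ]
    simp only [v, RCLike.inner_apply, conj_trivial]
    by_cases h : μ l = 0
    · simp [hzero j l h]
    · have := hne l h
      field_simp
  · rw [EuclideanSpace.real_norm_sq_eq, leverageScore]
    change _ = M j ⬝ᵥ (U * Matrix.diagonal (fun i => (μ i)⁻¹) * Uᵀ) *ᵥ M j
    rw [← Matrix.mulVec_mulVec, ← Matrix.mulVec_mulVec, Matrix.dotProduct_mulVec,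
      ← Matrix.mulVec_transpose]
    refine Finset.sum_congr rfl fun l _ => ?_
    rw [Matrix.mulVec_diagonal, hMU]
    simp only [v]
    rw [mul_pow, inv_pow, sq √(μ l), hsq]; ring
  · refine ⟨U *ᵥ (fun l => (μ l)⁻¹ * (M * U) j l), ?_⟩
    ext l
    rw [hZ, Matrix.mulVec_mulVec, hUU', Matrix.one_mulVec]
    simp only [v]
    by_cases h : μ l = 0
    · simp [h]
    · have := hne l h
      rw [← mul_assoc]
      congr 1
      have h2 := hsq l
      field_simp
      linarith

theorem leverageScore_nonneg {k n : ℕ} (M : Matrix (Fin k) (Fin n) ℝ) (j : Fin k) :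
    0 ≤ leverageScore M j := by
  obtain ⟨Z, v, -, -, h, -⟩ := exists_leverage_embedding M
  rw [← h]; positivity

/-- Testing the hypothesis at an `x` with `Z x = v j` turns it into `τ² ≤ t τ`; this is why the
embedding records that `v j` lies in the range of `Z`. -/
theorem leverageScore_le {k n : ℕ} (M : Matrix (Fin k) (Fin n) ℝ) (j : Fin k) (t : ℝ)
    (h : ∀ x, (M *ᵥ x) j ^ 2 ≤ t * ‖WithLp.toLp 2 (M *ᵥ x)‖ ^ 2) (ht : 0 ≤ t) :
    leverageScore M j ≤ t := by
  obtain ⟨Z, v, h1, h2, h3, h4⟩ := exists_leverage_embedding M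
  obtain ⟨x, hx⟩ := h4 j
  have := h x
  rw [← h1, h2, hx, real_inner_self_eq_norm_sq, h3] at this
  have h0 := leverageScore_nonneg M j
  by_contra! hc
  nlinarith

end

/-! ### Gaussian measure and the dual Sudakov inequality. -/

noncomputable section

open MeasureTheory ENNReal

section Gaussian

/-- The unnormalised Gaussian density. -/
def gaussDensity {E : Type*} [NormedAddCommGroup E] (x : E) : ℝ≥0∞ :=
  ENNReal.ofReal (Real.exp (-‖x‖ ^ 2 / 2))

theorem measurable_gaussDensity {E : Type*} [NormedAddCommGroup E] [MeasurableSpace E]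
    [BorelSpace E] : Measurable (gaussDensity : E → ℝ≥0∞) := by
  unfold gaussDensity
  fun_prop

variable {E : Type*} [NormedAddCommGroup E] [InnerProductSpace ℝ E] [FiniteDimensional ℝ E]
  [MeasurableSpace E] [BorelSpace E]

variable (E) in
/-- The unnormalised standard Gaussian measure. -/
def gaussMeasure : Measure E := volume.withDensity gaussDensity

theorem lintegral_gaussMeasure {f : E → ℝ≥0∞} (hf : Measurable f) :
    ∫⁻ x, f x ∂(gaussMeasure E) = ∫⁻ x, gaussDensity x * f x := by
  rw [gaussMeasure, lintegral_withDensity_eq_lintegral_mul _ measurable_gaussDensity hf]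
  rfl

theorem gaussMeasure_apply {D : Set E} (hD : MeasurableSet D) :
    gaussMeasure E D = ∫⁻ x, D.indicator gaussDensity x := by
  rw [gaussMeasure, withDensity_apply _ hD, lintegral_indicator hD]

theorem gaussMeasure_univ : gaussMeasure E Set.univ = ∫⁻ x : E, gaussDensity x := by
  rw [gaussMeasure_apply MeasurableSet.univ, Set.indicator_univ]

theorem gaussMeasure_univ_ne_top : gaussMeasure E Set.univ ≠ ∞ := by
  rw [gaussMeasure_univ]
  have h := (GaussianFourier.integrable_cexp_neg_mul_sq_norm_add (V := E) (b := 1 / 2)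
    (by norm_num) 0 0).norm
  have h2 : Integrable (fun x : E => Real.exp (-‖x‖ ^ 2 / 2)) := by
    refine h.congr (Filter.Eventually.of_forall fun x => ?_)
    simp only [Complex.norm_exp]
    congr 1
    have : -(1 / 2 : ℂ) * (‖x‖ : ℂ) ^ 2 + 0 * (inner ℝ (0 : E) x : ℂ) =
      ((-‖x‖ ^ 2 / 2 : ℝ) : ℂ) := by push_cast; ring
    rw [this, Complex.ofReal_re]
  exact h2.lintegral_lt_top.ne

theorem gaussMeasure_univ_ne_zero : gaussMeasure E Set.univ ≠ 0 := by
  rw [gaussMeasure_univ]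
  intro h
  rw [lintegral_eq_zero_iff measurable_gaussDensity] at h
  have h2 : ∀ᵐ x : E, False := h.mono fun x hx => by
    have : 0 < gaussDensity x := ENNReal.ofReal_pos.2 (Real.exp_pos _)
    exact this.ne' hx
  rw [Filter.eventually_false_iff_eq_bot, ae_eq_bot] at h2
  exact NeZero.ne (volume : Measure E) h2

/-- Moment generating function of a Gaussian linear form. -/
theorem lintegral_exp_inner (b : E) :
    ∫⁻ z, ENNReal.ofReal (Real.exp (inner ℝ b z)) ∂(gaussMeasure E) =
      ENNReal.ofReal (Real.exp (‖b‖ ^ 2 / 2)) * gaussMeasure E Set.univ := by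
  rw [lintegral_gaussMeasure (by fun_prop), gaussMeasure_univ,
    ← lintegral_sub_right_eq_self (fun x : E => gaussDensity x) b,
    ← lintegral_const_mul _ (by exact measurable_gaussDensity.comp (measurable_sub_const b))]
  refine lintegral_congr fun z => ?_
  simp only [gaussDensity]
  rw [← ENNReal.ofReal_mul (by positivity), ← ENNReal.ofReal_mul (by positivity),
    ← Real.exp_add, ← Real.exp_add, norm_sub_sq_real, real_inner_comm]
  congr 2
  ring

/-- This is `t/√r ≤ exp (t/√r - 1)` raised to the power `r`. With slope `√r`, the Gaussian cost
`e^{r/2}` of the exponential is absorbed by the factor `e^{-r}`. -/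
theorem rpow_le_exp_mul {t r : ℝ} (ht : 0 ≤ t) (hr : 0 < r) :
    t ^ r ≤ (√r) ^ r * Real.exp (-r) * Real.exp (√r * t) := by
  have hs : 0 < √r := Real.sqrt_pos.2 hr
  have h1 : t / √r ≤ Real.exp (t / √r - 1) := by
    have := Real.add_one_le_exp (t / √r - 1); linarith
  have h2 := Real.rpow_le_rpow (by positivity) h1 hr.le
  rw [← Real.exp_mul, Real.div_rpow ht hs.le, div_le_iff₀ (by positivity)] at h2
  refine h2.trans_eq ?_
  rw [mul_comm, mul_assoc, ← Real.exp_add]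
  congr 2
  have : r = √r * √r := (Real.mul_self_sqrt hr.le).symm
  have h3 : t / √r * r = √r * t := by
    nth_rewrite 2 [this]; field_simp
  rw [sub_mul, h3]; ring

/-- Moments of a Gaussian linear form. -/
theorem lintegral_abs_inner_rpow_le (v : E) {r : ℝ} (hr : 0 < r) :
    ∫⁻ z, ENNReal.ofReal (|inner ℝ v z| ^ r) ∂(gaussMeasure E) ≤
      ENNReal.ofReal (2 * (√r * ‖v‖) ^ r) * gaussMeasure E Set.univ := by
  by_cases hv : v = 0
  · subst hv
    simp [Real.zero_rpow hr.ne']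
  have hv' : 0 < ‖v‖ := norm_pos_iff.2 hv
  set b : E := (√r / ‖v‖) • v with hb
  have hbn : ‖b‖ ^ 2 / 2 = r / 2 := by
    rw [hb, norm_smul, Real.norm_of_nonneg (by positivity), div_mul_cancel₀ _ hv'.ne',
      Real.sq_sqrt hr.le]
  set c : ℝ := (√r * ‖v‖) ^ r * Real.exp (-r) with hc
  have hpt : ∀ z : E, ENNReal.ofReal (|inner ℝ v z| ^ r) ≤
      ENNReal.ofReal c * (ENNReal.ofReal (Real.exp (inner ℝ b z)) +
        ENNReal.ofReal (Real.exp (inner ℝ (-b) z))) := by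
    intro z
    rw [← ENNReal.ofReal_add (by positivity) (by positivity),
      ← ENNReal.ofReal_mul (by positivity)]
    apply ENNReal.ofReal_le_ofReal
    have h1 := rpow_le_exp_mul (t := |inner ℝ v z| / ‖v‖) (by positivity) hr
    rw [Real.div_rpow (by positivity) hv'.le, div_le_iff₀ (by positivity)] at h1
    refine h1.trans ?_
    have h2 : √r * (|inner ℝ v z| / ‖v‖) = |inner ℝ b z| := by
      rw [hb, real_inner_smul_left, abs_mul, abs_of_nonneg (show 0 ≤ √r / ‖v‖ by positivity)]; ring
    have h3 : Real.exp |inner ℝ b z| ≤ Real.exp (inner ℝ b z) + Real.exp (inner ℝ (-b) z) := by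
      rw [inner_neg_left]
      exact Real.exp_abs_le _
    rw [h2, hc, Real.mul_rpow (by positivity) hv'.le]
    calc _ = √r ^ r * ‖v‖ ^ r * Real.exp (-r) * Real.exp |inner ℝ b z| := by ring
      _ ≤ _ := by gcongr
  refine (lintegral_mono hpt).trans ?_
  rw [lintegral_const_mul _ (by fun_prop), lintegral_add_left (by fun_prop),
    lintegral_exp_inner, lintegral_exp_inner, norm_neg, hbn, ← add_mul,
    ← ENNReal.ofReal_add (by positivity) (by positivity), ← mul_assoc,
    ← ENNReal.ofReal_mul (by positivity)]
  gcongr ENNReal.ofReal ?_ * _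
  rw [hc]
  have : Real.exp (-r) * Real.exp (r / 2) ≤ 1 := by
    rw [← Real.exp_add, Real.exp_le_one_iff]; linarith
  calc _ = 2 * (√r * ‖v‖) ^ r * (Real.exp (-r) * Real.exp (r / 2)) := by ring
    _ ≤ 2 * (√r * ‖v‖) ^ r * 1 := by gcongr
    _ = _ := by ring

/-- A shift by `w` decreases the Gaussian measure of a symmetric set by at most `exp (-‖w‖²/2)`. -/
theorem gaussMeasure_shift_ge {D : Set E} (hD : MeasurableSet D) (hsymm : ∀ z, -z ∈ D ↔ z ∈ D)
    (w : E) :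
    ENNReal.ofReal (Real.exp (-‖w‖ ^ 2 / 2)) * gaussMeasure E D ≤
      gaussMeasure E {z | z - w ∈ D} := by
  have hD' : MeasurableSet {z | z - w ∈ D} := measurable_sub_const w hD
  have hm : ∀ w : E, Measurable fun z : E => D.indicator (fun z => gaussDensity (z + w)) z :=
    fun w => (measurable_gaussDensity.comp (measurable_add_const w)).indicator hD
  have h1 : gaussMeasure E {z | z - w ∈ D} =
      ∫⁻ z, D.indicator (fun z => gaussDensity (z + w)) z := by
    rw [gaussMeasure_apply hD', ← lintegral_add_right_eq_self _ w]
    refine lintegral_congr fun z => ?_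
    by_cases hz : z ∈ D
    · rw [Set.indicator_of_mem (by simpa using hz), Set.indicator_of_mem hz]
    · rw [Set.indicator_of_notMem (by simpa using hz), Set.indicator_of_notMem hz]
  -- Reflection in the symmetric set gives the same measure with shift `-w`. In the sum of the two
  -- forms, `e^u + e^v ≥ 2 e^{(u+v)/2}` and the parallelogram law leave the factor `exp (-‖w‖²/2)`.
  have h2 : gaussMeasure E {z | z - w ∈ D} =
      ∫⁻ z, D.indicator (fun z => gaussDensity (z + -w)) z := by
    rw [h1, ← lintegral_neg_eq_self]
    refine lintegral_congr fun z => ?_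
    have : gaussDensity (-z + w) = gaussDensity (z + -w) := by
      simp only [gaussDensity]; rw [← norm_neg (-z + w)]; rw [neg_add, neg_neg]
    by_cases hz : z ∈ D
    · rw [Set.indicator_of_mem ((hsymm z).2 hz), Set.indicator_of_mem hz, this]
    · rw [Set.indicator_of_notMem (mt (hsymm z).1 hz), Set.indicator_of_notMem hz]
  have h3 : 2 * (ENNReal.ofReal (Real.exp (-‖w‖ ^ 2 / 2)) * gaussMeasure E D) ≤
      2 * gaussMeasure E {z | z - w ∈ D} := by
    rw [two_mul (gaussMeasure E {z | z - w ∈ D})]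
    nth_rewrite 1 [h1]
    rw [h2, ← lintegral_add_left (hm w), gaussMeasure_apply hD,
      ← lintegral_const_mul _ (measurable_gaussDensity.indicator hD),
      ← lintegral_const_mul _ ((measurable_gaussDensity.indicator hD).const_mul _)]
    refine lintegral_mono fun z => ?_
    by_cases hz : z ∈ D
    · simp only [Set.indicator_of_mem hz, gaussDensity]
      rw [← ENNReal.ofReal_mul (by positivity), ← ENNReal.ofReal_add (by positivity)
        (by positivity), show (2 : ℝ≥0∞) = ENNReal.ofReal 2 by simp,
        ← ENNReal.ofReal_mul (by positivity)]
      apply ENNReal.ofReal_le_ofReal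
      rw [← Real.exp_add]
      set u := -‖z + w‖ ^ 2 / 2
      set v := -‖z + -w‖ ^ 2 / 2
      have huv : -‖w‖ ^ 2 / 2 + -‖z‖ ^ 2 / 2 = u / 2 + v / 2 := by
        have := parallelogram_law_with_norm ℝ z w
        rw [sub_eq_add_neg] at this
        simp only [u, v]; nlinarith
      rw [huv, Real.exp_add]
      have e1 : Real.exp u = Real.exp (u / 2) ^ 2 := by rw [← Real.exp_nat_mul]; congr 1; push_cast; ring
      have e2 : Real.exp v = Real.exp (v / 2) ^ 2 := by rw [← Real.exp_nat_mul]; congr 1; push_cast; ring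
      rw [e1, e2]
      nlinarith [sq_nonneg (Real.exp (u / 2) - Real.exp (v / 2))]
    · simp [Set.indicator_of_notMem hz]
  exact (ENNReal.mul_le_mul_iff_right (by norm_num) (by norm_num)).1 h3

/-- Dual Sudakov inequality for an even functional `Ψ` of degree `r` with a weak triangle
inequality. -/
theorem card_le_of_separated {ι : Type*} (T : Finset ι) (f : ι → E) (Ψ : E → ℝ)
    (hΨ : Measurable Ψ) {r κ B η : ℝ} (hr : 1 ≤ r) (hκ : 0 < κ) (hB : 0 < B) (hη : 0 < η)
    (hsymm : ∀ z, Ψ (-z) = Ψ z) (hsmul : ∀ a : ℝ, 0 < a → ∀ z, Ψ (a • z) = a ^ r * Ψ z)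
    (hadd : ∀ x y, Ψ (x + y) ≤ κ ^ r * (Ψ x + Ψ y))
    (hint : ∫⁻ z, ENNReal.ofReal (Ψ z) ∂(gaussMeasure E) ≤
      ENNReal.ofReal (B ^ r) * gaussMeasure E Set.univ)
    (hT : ∀ x ∈ T, ‖f x‖ ≤ 1)
    (hsep : ∀ x ∈ T, ∀ y ∈ T, x ≠ y → η ^ r < Ψ (f x - f y)) :
    (T.card : ℝ) ≤ 2 * Real.exp (8 * (κ * B / η) ^ 2) := by
  have hr0 : 0 < r := by linarith
  set D : Set E := {z | Ψ z ≤ (2 * B) ^ r} with hDdef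
  have hD : MeasurableSet D := measurableSet_le hΨ measurable_const
  have hDs : ∀ z, -z ∈ D ↔ z ∈ D := fun z => by simp only [hDdef, Set.mem_ofPred_eq, hsymm]
  set Zt := gaussMeasure E Set.univ with hZt
  have hZ0 : Zt ≠ 0 := gaussMeasure_univ_ne_zero
  have hZ1 : Zt ≠ ∞ := gaussMeasure_univ_ne_top
  -- Markov's inequality: at least half of the mass lies in `D`, because `2^r ≥ 2`.
  have hmark : Zt ≤ 2 * gaussMeasure E D := by
    have h1 : ENNReal.ofReal ((2 * B) ^ r) * gaussMeasure E Dᶜ ≤ ENNReal.ofReal (B ^ r) * Zt := by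
      refine le_trans ?_ hint
      refine le_trans ?_ (mul_meas_ge_le_lintegral (hΨ.ennreal_ofReal) (ENNReal.ofReal ((2 * B) ^ r)))
      gcongr
      intro z hz
      simp only [hDdef, Set.mem_compl_iff, Set.mem_ofPred_eq, not_le] at hz
      exact ENNReal.ofReal_le_ofReal hz.le
    have h2 : ENNReal.ofReal ((2 * B) ^ r) = ENNReal.ofReal (B ^ r) * ENNReal.ofReal (2 ^ r) := by
      rw [Real.mul_rpow (by norm_num) hB.le, mul_comm, ENNReal.ofReal_mul (by positivity)]
    rw [h2, mul_assoc, ENNReal.mul_le_mul_iff_right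
      (ENNReal.ofReal_pos.2 (by positivity)).ne' ENNReal.ofReal_ne_top] at h1
    have h3 : 2 * gaussMeasure E Dᶜ ≤ Zt := by
      refine le_trans ?_ h1
      gcongr
      rw [show (2 : ℝ≥0∞) = ENNReal.ofReal 2 by simp]
      apply ENNReal.ofReal_le_ofReal
      calc (2 : ℝ) = 2 ^ (1 : ℝ) := by simp
        _ ≤ _ := Real.rpow_le_rpow_of_exponent_le (by norm_num) hr
    have h4 : Zt = gaussMeasure E D + gaussMeasure E Dᶜ := (measure_add_measure_compl hD).symm
    have h5 : gaussMeasure E Dᶜ ≠ ∞ := ((measure_mono (Set.subset_univ _)).trans_lt hZ1.lt_top).ne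
    have h6 : gaussMeasure E Dᶜ ≤ gaussMeasure E D := by
      rw [two_mul, h4] at h3
      exact (ENNReal.add_le_add_iff_right h5).1 h3
    calc Zt = gaussMeasure E D + gaussMeasure E Dᶜ := h4
      _ ≤ gaussMeasure E D + gaussMeasure E D := by gcongr
      _ = _ := (two_mul _).symm
  -- The dilation has `a η = 4 κ B`: if two translates `a f(x) + D` met, then `Ψ (f x - f y) ≤ η^r`.
  -- Each of the disjoint translates carries at least `e^{-a²/2}/2` of the mass, and `a²/2 = 8
  -- (κB/η)²`.
  set a : ℝ := 4 * κ * B / η with ha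
  have ha0 : 0 < a := by positivity
  have hdisj : (T : Set ι).PairwiseDisjoint fun x => {z | z - a • f x ∈ D} := by
    intro x hx y hy hxy
    rw [Function.onFun, Set.disjoint_left]
    intro z hz1 hz2
    simp only [Set.mem_ofPred_eq, hDdef] at hz1 hz2
    have h1 := hsep x hx y hy hxy
    have h2 : a ^ r * Ψ (f x - f y) ≤ κ ^ r * ((2 * B) ^ r + (2 * B) ^ r) := by
      rw [← hsmul a ha0]
      have : a • (f x - f y) = -(z - a • f x) + (z - a • f y) := by rw [smul_sub]; abel
      rw [this]
      refine (hadd _ _).trans ?_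
      rw [hsymm]
      gcongr
    have h3 : a ^ r * η ^ r < a ^ r * Ψ (f x - f y) := by gcongr
    have h4 : a ^ r * η ^ r = κ ^ r * (2 ^ r * (2 * B) ^ r) := by
      rw [← Real.mul_rpow ha0.le hη.le, ← Real.mul_rpow (by positivity) (by positivity),
        ← Real.mul_rpow (by positivity) (by positivity)]
      congr 1
      rw [ha]; field_simp; norm_num
    have h5 : (2 : ℝ) ≤ 2 ^ r := by
      calc (2 : ℝ) = 2 ^ (1 : ℝ) := by simp
        _ ≤ _ := Real.rpow_le_rpow_of_exponent_le (by norm_num) hr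
    have h6 : κ ^ r * ((2 * B) ^ r + (2 * B) ^ r) ≤ κ ^ r * (2 ^ r * (2 * B) ^ r) := by
      rw [← two_mul]; gcongr
    linarith
  have hmeas : ∀ x ∈ T, MeasurableSet {z | z - a • f x ∈ D} :=
    fun x _ => measurable_sub_const (a • f x) hD
  have hsum : (T.card : ℝ≥0∞) * (ENNReal.ofReal (Real.exp (-a ^ 2 / 2)) * gaussMeasure E D) ≤ Zt := by
    calc _ = ∑ x ∈ T, ENNReal.ofReal (Real.exp (-a ^ 2 / 2)) * gaussMeasure E D := by
          rw [Finset.sum_const, nsmul_eq_mul]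
      _ ≤ ∑ x ∈ T, gaussMeasure E {z | z - a • f x ∈ D} := by
          refine Finset.sum_le_sum fun x hx => le_trans ?_ (gaussMeasure_shift_ge hD hDs (a • f x))
          gcongr
          rw [norm_smul, Real.norm_of_nonneg ha0.le]
          calc a * ‖f x‖ ≤ a * 1 := by gcongr; exact hT x hx
            _ = a := mul_one a
      _ = gaussMeasure E (⋃ x ∈ T, {z | z - a • f x ∈ D}) :=
          (measure_biUnion_finset hdisj hmeas).symm
      _ ≤ Zt := measure_mono (Set.subset_univ _)
  have hfin : (T.card : ℝ≥0∞) * ENNReal.ofReal (Real.exp (-a ^ 2 / 2)) ≤ 2 := by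
    have h1 : (T.card : ℝ≥0∞) * ENNReal.ofReal (Real.exp (-a ^ 2 / 2)) * Zt ≤ 2 * Zt := by
      calc _ ≤ (T.card : ℝ≥0∞) * ENNReal.ofReal (Real.exp (-a ^ 2 / 2)) * (2 * gaussMeasure E D) := by
            gcongr
        _ = 2 * ((T.card : ℝ≥0∞) * (ENNReal.ofReal (Real.exp (-a ^ 2 / 2)) * gaussMeasure E D)) := by
            ring
        _ ≤ 2 * Zt := by gcongr
    exact (ENNReal.mul_le_mul_iff_left hZ0 hZ1).1 h1
  have hreal : (T.card : ℝ) * Real.exp (-a ^ 2 / 2) ≤ 2 := by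
    have := ENNReal.toReal_mono (by norm_num) hfin
    rwa [ENNReal.toReal_mul, ENNReal.toReal_natCast, ENNReal.toReal_ofReal (by positivity),
      ENNReal.toReal_ofNat] at this
  have he : -a ^ 2 / 2 = -(8 * (κ * B / η) ^ 2) := by rw [ha]; ring
  rwa [he, Real.exp_neg, ← div_eq_mul_inv, div_le_iff₀ (Real.exp_pos _)] at hreal

end Gaussian

end

/-! ### Block norms and their Gaussian moments. -/

noncomputable section

open MeasureTheory ENNReal

section lqNorm

variable {k : ℕ} {s : Finset (Fin k)} {q : ℝ}

theorem lqNorm_nonneg (y : Fin k → ℝ) : 0 ≤ lqNorm s q y := by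
  unfold lqNorm; positivity

theorem lqNorm_rpow (r : ℝ) (y : Fin k → ℝ) :
    lqNorm s q y ^ r = (∑ j ∈ s, |y j| ^ q) ^ (r / q) := by
  rw [lqNorm, ← Real.rpow_mul (by positivity)]
  congr 1; ring

theorem lqNorm_rpow_self (hq : 0 < q) (y : Fin k → ℝ) :
    lqNorm s q y ^ q = ∑ j ∈ s, |y j| ^ q := by
  rw [lqNorm_rpow, div_self hq.ne', Real.rpow_one]

theorem lqNorm_neg (y : Fin k → ℝ) : lqNorm s q (-y) = lqNorm s q y := by
  simp [lqNorm]

theorem lqNorm_smul (hq : 0 < q) (c : ℝ) (y : Fin k → ℝ) :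
    lqNorm s q (c • y) = |c| * lqNorm s q y := by
  simp only [lqNorm, Pi.smul_apply, smul_eq_mul, abs_mul]
  simp_rw [Real.mul_rpow (abs_nonneg c) (abs_nonneg _)]
  rw [← Finset.mul_sum, Real.mul_rpow (by positivity) (by positivity),
    ← Real.rpow_mul (abs_nonneg c), mul_one_div_cancel hq.ne', Real.rpow_one]

theorem lqNorm_mono (hq : 0 < q) {y z : Fin k → ℝ} (h : ∀ j ∈ s, |y j| ≤ |z j|) :
    lqNorm s q y ≤ lqNorm s q z := by
  unfold lqNorm
  exact Real.rpow_le_rpow (by positivity) (Finset.sum_le_sum fun j hj =>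
    Real.rpow_le_rpow (abs_nonneg _) (h j hj) hq.le) (by positivity)

theorem lqNorm_eq_zero_of_forall (hq : 0 < q) {y : Fin k → ℝ} (h : ∀ j ∈ s, y j = 0) :
    lqNorm s q y = 0 := by
  rw [lqNorm, Finset.sum_eq_zero, Real.zero_rpow (by positivity)]
  intro j hj
  rw [h j hj, abs_zero, Real.zero_rpow hq.ne']

theorem lqNorm_congr {y z : Fin k → ℝ} (h : ∀ j ∈ s, y j = z j) :
    lqNorm s q y = lqNorm s q z := by
  unfold lqNorm
  rw [Finset.sum_congr rfl fun j hj => by rw [h j hj]]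

/-- Only `|y + z| ≤ 2 max (|y|, |z|)` is used, entry by entry, so that `q < 1` is covered too. -/
theorem lqNorm_add_le (hq : 0 < q) (y z : Fin k → ℝ) :
    lqNorm s q (y + z) ≤ 2 * 2 ^ (1 / q) * max (lqNorm s q y) (lqNorm s q z) := by
  set M := max (lqNorm s q y) (lqNorm s q z)
  have hM : 0 ≤ M := (lqNorm_nonneg y).trans (le_max_left _ _)
  have h1 : ∑ j ∈ s, |(y + z) j| ^ q ≤ (2 * 2 ^ (1 / q) * M) ^ q := by
    have hy : ∑ j ∈ s, |y j| ^ q ≤ M ^ q := by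
      rw [← lqNorm_rpow_self hq]
      exact Real.rpow_le_rpow (lqNorm_nonneg y) (le_max_left _ _) hq.le
    have hz : ∑ j ∈ s, |z j| ^ q ≤ M ^ q := by
      rw [← lqNorm_rpow_self hq]
      exact Real.rpow_le_rpow (lqNorm_nonneg z) (le_max_right _ _) hq.le
    have e : (2 * 2 ^ (1 / q) * M) ^ q = 2 ^ q * (M ^ q + M ^ q) := by
      rw [Real.mul_rpow (by positivity) hM, Real.mul_rpow (by positivity) (by positivity),
        ← Real.rpow_mul (by norm_num), one_div_mul_cancel hq.ne', Real.rpow_one]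
      ring
    rw [e]
    refine le_trans ?_ (mul_le_mul_of_nonneg_left (add_le_add hy hz) (by positivity))
    rw [← Finset.sum_add_distrib, Finset.mul_sum]
    refine Finset.sum_le_sum fun j _ => ?_
    have : |(y + z) j| ≤ 2 * max |y j| |z j| := by
      refine (abs_add_le _ _).trans ?_
      have := le_max_left |y j| |z j|
      have := le_max_right |y j| |z j|
      linarith
    refine (Real.rpow_le_rpow (abs_nonneg _) this hq.le).trans ?_
    rw [Real.mul_rpow (by norm_num) (by positivity)]
    gcongr
    have h1 : 0 ≤ |y j| ^ q := by positivity
    have h2 : 0 ≤ |z j| ^ q := by positivity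
    rcases max_choice |y j| |z j| with h | h <;> rw [h] <;> linarith
  have h2 := Real.rpow_le_rpow (z := 1 / q) (by positivity) h1 (by positivity)
  rwa [← Real.rpow_mul (by positivity), mul_one_div_cancel hq.ne', Real.rpow_one] at h2

theorem lqNorm_singleton (hq : 0 < q) (j : Fin k) (y : Fin k → ℝ) :
    lqNorm {j} q y = |y j| := by
  rw [lqNorm, Finset.sum_singleton, ← Real.rpow_mul (abs_nonneg _), mul_one_div_cancel hq.ne',
    Real.rpow_one]

theorem lqNorm_add_le_of_card_eq_one (hq : 0 < q) (hs : s.card = 1) (y z : Fin k → ℝ) :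
    lqNorm s q (y + z) ≤ 2 * max (lqNorm s q y) (lqNorm s q z) := by
  obtain ⟨j, rfl⟩ := Finset.card_eq_one.1 hs
  rw [lqNorm_singleton hq, lqNorm_singleton hq, lqNorm_singleton hq]
  refine (abs_add_le _ _).trans ?_
  have := le_max_left |y j| |z j|
  have := le_max_right |y j| |z j|
  linarith

/-- Comparison of an `ℓ_q` sum with weighted `r`-th powers, for `q ≤ r` or `card ≤ 2 ^ r`. -/
theorem exists_weights_rpow_le (hq : 0 < q) {r : ℝ} (hr : 1 ≤ r)
    (h : q ≤ r ∨ Real.logb 2 s.card ≤ r) (σ : Fin k → ℝ) (hσ : ∀ j, 0 ≤ σ j) :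
    ∃ w : Fin k → ℝ, (∀ j, 0 ≤ w j) ∧ ∑ j ∈ s, w j ≤ 2 ^ r ∧
      ∀ y : Fin k → ℝ, (∀ j, 0 ≤ y j) → (∑ j ∈ s, (σ j * y j) ^ q) ^ (r / q) ≤
        (∑ j ∈ s, σ j ^ q) ^ (r / q) * ∑ j ∈ s, w j * y j ^ r := by
  have hr0 : 0 < r := by linarith
  set S := ∑ j ∈ s, σ j ^ q with hS
  have hS0 : 0 ≤ S := Finset.sum_nonneg fun j _ => Real.rpow_nonneg (hσ j) q
  rcases h with h | h
  -- For `q ≤ r`: Jensen for the power `r/q` with the probability weights `σ_j^q / S`.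
  · have h2r : (1 : ℝ) ≤ 2 ^ r := Real.one_le_rpow (by norm_num) hr0.le
    rcases hS0.eq_or_lt with h0 | h0
    · refine ⟨0, fun _ => le_rfl, by simpa using by linarith, fun y hy => ?_⟩
      have hz := (Finset.sum_eq_zero_iff_of_nonneg
        (fun j _ => Real.rpow_nonneg (hσ j) q)).1 h0.symm
      rw [Finset.sum_eq_zero, Real.zero_rpow (by positivity)]
      · simp
      · intro j hj
        rw [Real.mul_rpow (hσ j) (hy j), hz j hj, zero_mul]
    · refine ⟨fun j => σ j ^ q / S, fun j => div_nonneg (Real.rpow_nonneg (hσ j) q) hS0, ?_,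
        fun y hy => ?_⟩
      · rw [← Finset.sum_div, ← hS, div_self h0.ne']; exact h2r
      · have hJ := Real.rpow_arith_mean_le_arith_mean_rpow s (fun j => σ j ^ q / S)
          (fun j => y j ^ q) (fun j _ => div_nonneg (Real.rpow_nonneg (hσ j) q) hS0)
          (by rw [← Finset.sum_div, ← hS, div_self h0.ne'])
          (fun j _ => Real.rpow_nonneg (hy j) q) (p := r / q) ((one_le_div hq).2 h)
        have e1 : ∑ j ∈ s, (σ j * y j) ^ q = S * ∑ j ∈ s, σ j ^ q / S * y j ^ q := by
          rw [Finset.mul_sum]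
          refine Finset.sum_congr rfl fun j _ => ?_
          rw [Real.mul_rpow (hσ j) (hy j)]
          field_simp
        have e2 : ∀ j, (y j ^ q) ^ (r / q) = y j ^ r := fun j => by
          rw [← Real.rpow_mul (hy j), mul_div_cancel₀ _ hq.ne']
        simp only [e2] at hJ
        rw [e1, Real.mul_rpow hS0 (Finset.sum_nonneg fun j _ => mul_nonneg
          (div_nonneg (Real.rpow_nonneg (hσ j) q) hS0) (Real.rpow_nonneg (hy j) q))]
        gcongr
  -- For few indices: each `y_j` is at most the `ℓ_r` norm of `y`, and unit weights have total `|s|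
  -- ≤ 2^r`.
  · refine ⟨fun _ => 1, fun _ => zero_le_one, ?_, fun y hy => ?_⟩
    · rw [Finset.sum_const, nsmul_eq_mul, mul_one]
      rcases Nat.eq_zero_or_pos s.card with hc | hc
      · rw [hc]; simpa using by positivity
      · have hc' : (0 : ℝ) < s.card := by exact_mod_cast hc
        exact (Real.logb_le_iff_le_rpow (by norm_num) hc').1 h
    · simp only [one_mul]
      set Y := ∑ j ∈ s, y j ^ r
      have hY : 0 ≤ Y := Finset.sum_nonneg fun j _ => Real.rpow_nonneg (hy j) r
      have h1 : ∑ j ∈ s, (σ j * y j) ^ q ≤ S * Y ^ (q / r) := by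
        rw [hS, Finset.sum_mul]
        refine Finset.sum_le_sum fun j hj => ?_
        rw [Real.mul_rpow (hσ j) (hy j)]
        refine mul_le_mul_of_nonneg_left ?_ (Real.rpow_nonneg (hσ j) q)
        have : y j ^ r ≤ Y :=
          Finset.single_le_sum (f := fun j => y j ^ r) (fun j _ => Real.rpow_nonneg (hy j) r) hj
        calc y j ^ q = (y j ^ r) ^ (q / r) := by
              rw [← Real.rpow_mul (hy j), mul_div_cancel₀ _ hr0.ne']
          _ ≤ Y ^ (q / r) :=
              Real.rpow_le_rpow (Real.rpow_nonneg (hy j) r) this (by positivity)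
      have h2 := Real.rpow_le_rpow (z := r / q) (Finset.sum_nonneg fun j _ =>
        Real.rpow_nonneg (mul_nonneg (hσ j) (hy j)) q) h1 (by positivity)
      rwa [Real.mul_rpow hS0 (by positivity), ← Real.rpow_mul hY,
        show q / r * (r / q) = 1 by field_simp, Real.rpow_one] at h2

end lqNorm

section Packing

variable {E : Type*} [NormedAddCommGroup E] [InnerProductSpace ℝ E]

theorem lqNorm_inner_le {k : ℕ} {s : Finset (Fin k)} {q : ℝ} (hq : 0 < q) (u : Fin k → E) (z : E) :
    lqNorm s q (fun j => inner ℝ (u j) z) ≤ lqNorm s q (fun j => ‖u j‖) * ‖z‖ := by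
  have : ‖z‖ = |‖z‖| := (abs_of_nonneg (norm_nonneg z)).symm
  rw [this, mul_comm, ← lqNorm_smul hq]
  refine lqNorm_mono hq fun j _ => ?_
  rw [Pi.smul_apply, smul_eq_mul, abs_mul, abs_norm, abs_norm, mul_comm]
  exact abs_real_inner_le_norm _ _

variable [FiniteDimensional ℝ E] [MeasurableSpace E] [BorelSpace E]

theorem measurable_lqNorm_inner {k : ℕ} (s : Finset (Fin k)) (q : ℝ) (u : Fin k → E) :
    Measurable fun z : E => lqNorm s q (fun j => inner ℝ (u j) z) := by
  unfold lqNorm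
  fun_prop

/-- Gaussian moments of a block norm. -/
theorem lintegral_lqNorm_rpow_le {k : ℕ} (s : Finset (Fin k)) {q : ℝ} (hq : 0 < q) {r : ℝ}
    (hr : 1 ≤ r) (h : q ≤ r ∨ Real.logb 2 s.card ≤ r) (u : Fin k → E) :
    ∫⁻ z, ENNReal.ofReal (lqNorm s q (fun j => inner ℝ (u j) z) ^ r) ∂(gaussMeasure E) ≤
      ENNReal.ofReal ((4 * √r * lqNorm s q (fun j => ‖u j‖)) ^ r) *
        gaussMeasure E Set.univ := by
  have hr0 : 0 < r := by linarith
  obtain ⟨w, hw0, hw1, hw⟩ := exists_weights_rpow_le (s := s) hq hr h (fun j => ‖u j‖)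
    (fun j => norm_nonneg _)
  set α := lqNorm s q (fun j => ‖u j‖) with hα
  have hα0 : 0 ≤ α := lqNorm_nonneg _
  let v : Fin k → E := fun j => ‖u j‖⁻¹ • u j
  have hv : ∀ j, ‖v j‖ ≤ 1 := fun j => by
    simp only [v, norm_smul, norm_inv, norm_norm]
    exact inv_mul_le_one
  have hαr : (∑ j ∈ s, ‖u j‖ ^ q) ^ (r / q) = α ^ r := by
    rw [hα, lqNorm_rpow]; simp
  have hpt : ∀ z, lqNorm s q (fun j => inner ℝ (u j) z) ^ r ≤
      α ^ r * ∑ j ∈ s, w j * |inner ℝ (v j) z| ^ r := by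
    intro z
    rw [lqNorm_rpow, ← hαr]
    refine le_trans (le_of_eq ?_) (hw (fun j => |inner ℝ (v j) z|) fun j => abs_nonneg _)
    congr 1
    refine Finset.sum_congr rfl fun j _ => ?_
    congr 1
    simp only [v, real_inner_smul_left, abs_mul, abs_inv, abs_norm]
    by_cases h0 : u j = 0
    · simp [h0]
    · have := norm_ne_zero_iff.2 h0
      field_simp
  calc _ ≤ ∫⁻ z, ENNReal.ofReal (α ^ r) * ∑ j ∈ s, ENNReal.ofReal (w j) *
        ENNReal.ofReal (|inner ℝ (v j) z| ^ r) ∂(gaussMeasure E) := by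
        refine lintegral_mono fun z => ?_
        refine (ENNReal.ofReal_le_ofReal (hpt z)).trans_eq ?_
        rw [ENNReal.ofReal_mul (by positivity), ENNReal.ofReal_sum_of_nonneg]
        · simp_rw [ENNReal.ofReal_mul (hw0 _)]
        · intro j _
          exact mul_nonneg (hw0 j) (by positivity)
    _ = ENNReal.ofReal (α ^ r) * ∑ j ∈ s, ENNReal.ofReal (w j) *
        ∫⁻ z, ENNReal.ofReal (|inner ℝ (v j) z| ^ r) ∂(gaussMeasure E) := by
        rw [lintegral_const_mul _ (by fun_prop), lintegral_finsetSum _ (by fun_prop)]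
        congr 1
        refine Finset.sum_congr rfl fun j _ => ?_
        rw [lintegral_const_mul _ (by fun_prop)]
    _ ≤ ENNReal.ofReal (α ^ r) * ∑ j ∈ s, ENNReal.ofReal (w j) *
        (ENNReal.ofReal (2 * √r ^ r) * gaussMeasure E Set.univ) := by
        gcongr with j
        refine (lintegral_abs_inner_rpow_le (v j) hr0).trans ?_
        gcongr
        exact mul_le_of_le_one_right (by positivity) (hv j)
    _ = ENNReal.ofReal (α ^ r * (∑ j ∈ s, w j) * (2 * √r ^ r)) * gaussMeasure E Set.univ := by
        rw [← Finset.sum_mul, ← ENNReal.ofReal_sum_of_nonneg fun j _ => hw0 j,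
          ENNReal.ofReal_mul (mul_nonneg (by positivity) (Finset.sum_nonneg fun j _ => hw0 j)),
          ENNReal.ofReal_mul (p := α ^ r) (by positivity)]
        ring
    _ ≤ _ := by
        -- The weights contribute `2^r` and the scalar moment a factor `2 ≤ 2^r`; together they give
        -- the `4`.
        gcongr ENNReal.ofReal ?_ * _
        have h2 : (2 : ℝ) ≤ 2 ^ r := by
          calc (2 : ℝ) = 2 ^ (1 : ℝ) := by simp
            _ ≤ _ := Real.rpow_le_rpow_of_exponent_le (by norm_num) hr
        rw [Real.mul_rpow (by positivity) hα0, Real.mul_rpow (by norm_num) (by positivity),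
          show (4 : ℝ) = 2 * 2 by norm_num, Real.mul_rpow (by norm_num) (by norm_num)]
        calc _ ≤ α ^ r * 2 ^ r * (2 ^ r * √r ^ r) := by gcongr
          _ = _ := by ring

end Packing

/-! ### Dual Sudakov for power sums of block norms. -/

namespace BlockData

variable {k n m : ℕ} (G : BlockData k n m)
variable {E : Type*} [NormedAddCommGroup E] [InnerProductSpace ℝ E]

/-- The functional `∑ c_i N_i(z)^r`, with `N_i(z)` the norm of the `i`-th block of `(⟨u_j, z⟩)_j`. -/
def powSum (u : Fin k → E) (c : Fin m → ℝ) (r : ℝ) (z : E) : ℝ :=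
  ∑ i, c i * lqNorm (G.block i) (G.q i) (fun j => inner ℝ (u j) z) ^ r

/-- The block norms satisfy a weak triangle inequality with constant `κ`. -/
def QuasiTriangle (κ : ℝ) : Prop :=
  ∀ i (y z : Fin k → ℝ), lqNorm (G.block i) (G.q i) (y + z) ≤
    κ * max (lqNorm (G.block i) (G.q i) y) (lqNorm (G.block i) (G.q i) z)

variable {G}

theorem QuasiTriangle.rpow_add_le {κ : ℝ} (h : G.QuasiTriangle κ) (hκ : 0 ≤ κ) {r : ℝ} (hr : 0 < r)
    (i : Fin m) (y z : Fin k → ℝ) : lqNorm (G.block i) (G.q i) (y + z) ^ r ≤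
      κ ^ r * (lqNorm (G.block i) (G.q i) y ^ r + lqNorm (G.block i) (G.q i) z ^ r) := by
  have hy := lqNorm_nonneg (s := G.block i) (q := G.q i) y
  have hz := lqNorm_nonneg (s := G.block i) (q := G.q i) z
  refine (Real.rpow_le_rpow (lqNorm_nonneg _) (h i y z) hr.le).trans ?_
  rw [Real.mul_rpow hκ (le_max_of_le_left hy)]
  gcongr
  have h1 := Real.rpow_nonneg hy r
  have h2 := Real.rpow_nonneg hz r
  rcases max_choice (lqNorm (G.block i) (G.q i) y) (lqNorm (G.block i) (G.q i) z) with h | h <;>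
    rw [h] <;> linarith

variable (G)

theorem powSum_smul (u : Fin k → E) (c : Fin m → ℝ) {r a : ℝ} (ha : 0 < a) (z : E) :
    G.powSum u c r (a • z) = a ^ r * G.powSum u c r z := by
  rw [powSum, powSum, Finset.mul_sum]
  refine Finset.sum_congr rfl fun i _ => ?_
  have : (fun j => inner ℝ (u j) (a • z)) = a • fun j => (inner ℝ (u j) z : ℝ) := by
    ext j; simp [real_inner_smul_right]
  rw [this, lqNorm_smul (G.q_pos i), abs_of_pos ha, Real.mul_rpow ha.le (lqNorm_nonneg _)]
  ring

theorem powSum_neg (u : Fin k → E) (c : Fin m → ℝ) (r : ℝ) (z : E) :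
    G.powSum u c r (-z) = G.powSum u c r z := by
  rw [powSum, powSum]
  refine Finset.sum_congr rfl fun i _ => ?_
  have : (fun j => inner ℝ (u j) (-z)) = -fun j => (inner ℝ (u j) z : ℝ) := by
    ext j; simp
  rw [this, lqNorm_neg]

theorem powSum_add_le {κ : ℝ} (h : G.QuasiTriangle κ) (hκ : 0 ≤ κ) (u : Fin k → E)
    {c : Fin m → ℝ} (hc : ∀ i, 0 ≤ c i) {r : ℝ} (hr : 0 < r) (x y : E) :
    G.powSum u c r (x + y) ≤ κ ^ r * (G.powSum u c r x + G.powSum u c r y) := by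
  simp only [powSum]
  rw [← Finset.sum_add_distrib, Finset.mul_sum]
  refine Finset.sum_le_sum fun i _ => ?_
  have : (fun j => inner ℝ (u j) (x + y)) =
      (fun j => (inner ℝ (u j) x : ℝ)) + fun j => (inner ℝ (u j) y : ℝ) := by
    ext j; simp [inner_add_right]
  rw [this]
  have := mul_le_mul_of_nonneg_left (h.rpow_add_le hκ hr i (fun j => (inner ℝ (u j) x : ℝ))
    fun j => (inner ℝ (u j) y : ℝ)) (hc i)
  linarith

theorem powSum_le (u : Fin k → E) {c : Fin m → ℝ} (hc : ∀ i, 0 ≤ c i) {r B : ℝ} (hr : 0 < r)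
    (hB : ∑ i, c i * lqNorm (G.block i) (G.q i) (fun j => ‖u j‖) ^ r ≤ B ^ r) (z : E) :
    G.powSum u c r z ≤ B ^ r * ‖z‖ ^ r := by
  refine le_trans ?_ (mul_le_mul_of_nonneg_right hB (by positivity))
  rw [Finset.sum_mul]
  refine Finset.sum_le_sum fun i _ => ?_
  rw [mul_assoc, ← Real.mul_rpow (lqNorm_nonneg _) (norm_nonneg z)]
  exact mul_le_mul_of_nonneg_left (Real.rpow_le_rpow (lqNorm_nonneg _)
    (lqNorm_inner_le (G.q_pos i) u z) hr.le) (hc i)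

variable [FiniteDimensional ℝ E] [MeasurableSpace E] [BorelSpace E]

theorem measurable_powSum (u : Fin k → E) (c : Fin m → ℝ) (r : ℝ) :
    Measurable (G.powSum u c r) := by
  have := fun i => measurable_lqNorm_inner (G.block i) (G.q i) u
  unfold powSum
  fun_prop

theorem lintegral_powSum_le (u : Fin k → E) {c : Fin m → ℝ} (hc : ∀ i, 0 ≤ c i) {r B : ℝ}
    (hr : 1 ≤ r) (hrq : ∀ i, G.q i ≤ r ∨ Real.logb 2 (G.block i).card ≤ r) (hB0 : 0 ≤ B)
    (hB : ∑ i, c i * lqNorm (G.block i) (G.q i) (fun j => ‖u j‖) ^ r ≤ B ^ r) :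
    ∫⁻ z, ENNReal.ofReal (G.powSum u c r z) ∂(gaussMeasure E) ≤
      ENNReal.ofReal ((4 * √r * B) ^ r) * gaussMeasure E Set.univ := by
  have hm := fun i => measurable_lqNorm_inner (G.block i) (G.q i) u
  have hn := fun i (z : E) => Real.rpow_nonneg (lqNorm_nonneg (s := G.block i) (q := G.q i)
    fun j => (inner ℝ (u j) z : ℝ)) r
  calc _ = ∑ i, ENNReal.ofReal (c i) * ∫⁻ z, ENNReal.ofReal
        (lqNorm (G.block i) (G.q i) (fun j => inner ℝ (u j) z) ^ r) ∂(gaussMeasure E) := by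
        simp only [powSum]
        simp_rw [ENNReal.ofReal_sum_of_nonneg fun i _ => mul_nonneg (hc i) (hn i _),
          ENNReal.ofReal_mul (hc _)]
        rw [lintegral_finsetSum _ (by fun_prop)]
        refine Finset.sum_congr rfl fun i _ => ?_
        rw [lintegral_const_mul _ (by fun_prop)]
    _ ≤ ∑ i, ENNReal.ofReal (c i) * (ENNReal.ofReal ((4 * √r *
        lqNorm (G.block i) (G.q i) (fun j => ‖u j‖)) ^ r) * gaussMeasure E Set.univ) := by
        gcongr with i
        exact lintegral_lqNorm_rpow_le _ (G.q_pos i) hr (hrq i) u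
    _ = ENNReal.ofReal ((4 * √r) ^ r * ∑ i, c i * lqNorm (G.block i) (G.q i)
        (fun j => ‖u j‖) ^ r) * gaussMeasure E Set.univ := by
        rw [Finset.mul_sum, ENNReal.ofReal_sum_of_nonneg, Finset.sum_mul]
        · refine Finset.sum_congr rfl fun i _ => ?_
          rw [Real.mul_rpow (by positivity) (lqNorm_nonneg _), ← mul_assoc,
            ← ENNReal.ofReal_mul (hc i), mul_left_comm]
        · intro i _
          exact mul_nonneg (by positivity)
            (mul_nonneg (hc i) (Real.rpow_nonneg (lqNorm_nonneg _) r))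
    _ ≤ _ := by
        rw [Real.mul_rpow (x := 4 * √r) (by positivity) hB0]
        gcongr

/-- Dual Sudakov inequality for power sums of block norms. -/
theorem log_card_le_of_separated {κ : ℝ} (hG : G.QuasiTriangle κ) (hκ : 1 ≤ κ) (u : Fin k → E)
    {c : Fin m → ℝ} (hc : ∀ i, 0 ≤ c i) {r B R η : ℝ} (hr : 1 ≤ r)
    (hrq : ∀ i, G.q i ≤ r ∨ Real.logb 2 (G.block i).card ≤ r) (hB0 : 0 < B)
    (hB : ∑ i, c i * lqNorm (G.block i) (G.q i) (fun j => ‖u j‖) ^ r ≤ B ^ r)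
    (hR : 0 < R) (hη : 0 < η) {ι : Type*} (T : Finset ι) (f : ι → E) (x₀ : E)
    (hT : ∀ x ∈ T, ‖f x - x₀‖ ≤ R)
    (hsep : ∀ x ∈ T, ∀ y ∈ T, x ≠ y → η ^ r < G.powSum u c r (f x - f y)) :
    Real.log T.card ≤ 200 * κ ^ 2 * r * (B * R / η) ^ 2 := by
  have hr0 : 0 < r := by linarith
  have hrhs : 0 ≤ 200 * κ ^ 2 * r * (B * R / η) ^ 2 := by positivity
  -- If `η ≥ 2BR`, the ball is too small for two separated points. Otherwise `(BR/η)² > 1/4`, so the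
  -- prefactor `2` of dual Sudakov is absorbed by raising the constant from `128` to `200`.
  by_cases hlarge : 2 * (B * R) ≤ η
  · have hcard : T.card ≤ 1 := by
      refine Finset.card_le_one.2 fun x hx y hy => ?_
      by_contra hxy
      have h1 := hsep x hx y hy hxy
      have h2 := G.powSum_le u hc hr0 hB (f x - f y)
      have h3 : ‖f x - f y‖ ≤ 2 * R := by
        have e : f x - f y = (f x - x₀) - (f y - x₀) := by abel
        rw [e]
        refine (norm_sub_le _ _).trans ?_
        have := hT x hx
        have := hT y hy
        linarith
      have h4 : B ^ r * ‖f x - f y‖ ^ r ≤ η ^ r := by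
        rw [← Real.mul_rpow hB0.le (norm_nonneg _)]
        refine Real.rpow_le_rpow (by positivity) ?_ hr0.le
        calc B * ‖f x - f y‖ ≤ B * (2 * R) := by gcongr
          _ ≤ η := by linarith
      linarith
    refine le_trans (Real.log_nonpos (by positivity) (by exact_mod_cast hcard)) hrhs
  · push Not at hlarge
    have hcard := card_le_of_separated T (fun x => R⁻¹ • (f x - x₀)) (G.powSum u c r)
      (G.measurable_powSum u c r) (r := r) (κ := κ) (B := 4 * √r * B) (η := η / R) hr
      (by linarith) (by positivity) (by positivity) (G.powSum_neg u c r)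
      (fun a ha z => G.powSum_smul u c ha z)
      (G.powSum_add_le hG (by linarith) u hc hr0)
      (G.lintegral_powSum_le u hc hr hrq hB0.le hB)
      (fun x hx => by
        rw [norm_smul, norm_inv, Real.norm_of_nonneg hR.le, inv_mul_le_iff₀ hR, mul_one]
        exact hT x hx)
      (fun x hx y hy hxy => by
        rw [← smul_sub, sub_sub_sub_cancel_right, G.powSum_smul u c (inv_pos.2 hR),
          div_eq_mul_inv, Real.mul_rpow hη.le (by positivity), mul_comm]
        exact mul_lt_mul_of_pos_left (hsep x hx y hy hxy) (by positivity))
    set t := B * R / η with ht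
    have ht2 : 1 / 2 < t := by
      rw [ht, lt_div_iff₀ hη]; linarith
    have e : 8 * (κ * (4 * √r * B) / (η / R)) ^ 2 = 128 * κ ^ 2 * r * t ^ 2 := by
      have : κ * (4 * √r * B) / (η / R) = 4 * κ * √r * t := by rw [ht]; field_simp
      rw [this, mul_pow, mul_pow, Real.sq_sqrt hr0.le]; ring
    rw [e] at hcard
    rcases Nat.eq_zero_or_pos T.card with h0 | h0
    · rw [h0]; simpa using hrhs
    have h0' : (0 : ℝ) < T.card := by exact_mod_cast h0
    have h1 := Real.log_le_log h0' hcard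
    rw [Real.log_mul (by norm_num) (Real.exp_pos _).ne', Real.log_exp] at h1
    have h2 : Real.log 2 ≤ 1 := by have := Real.log_two_lt_d9; linarith
    have h3 : 1 ≤ κ ^ 2 * r := one_le_mul_of_one_le_of_one_le (one_le_pow₀ hκ) hr
    have h4 : 1 / 4 ≤ t ^ 2 := by nlinarith
    have h5 : 1 / 4 ≤ κ ^ 2 * r * t ^ 2 := by nlinarith
    nlinarith

end BlockData

end

/-! ### The Euclidean structure of a block Lewis overestimate. -/

noncomputable section

namespace BlockData

variable {k n m : ℕ} (G : BlockData k n m)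

theorem mem_block {i : Fin m} {j : Fin k} : j ∈ G.block i ↔ G.grp j = i := by
  simp [block]

theorem scaled_mulVec (p : ℝ) (lam : Fin m → ℝ) (x : Fin n → ℝ) (j : Fin k) :
    (G.scaled p lam *ᵥ x) j = lam (G.grp j) ^ (1 / 2 - 1 / p) * (G.A *ᵥ x) j := by
  rw [scaled, ← Matrix.mulVec_mulVec, Matrix.mulVec_diagonal]

theorem rounded_mulVec (p : ℝ) (lam : Fin m → ℝ) (w : Fin k → ℝ) (x : Fin n → ℝ) (j : Fin k) :
    (G.rounded p lam w *ᵥ x) j =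
      w j ^ (1 / 2 : ℝ) * (lam (G.grp j) ^ (1 / 2 - 1 / p) * (G.A *ᵥ x) j) := by
  rw [rounded, ← Matrix.mulVec_mulVec, Matrix.mulVec_diagonal, scaled_mulVec]

theorem gnorm_nonneg (r : ℝ) (y : Fin k → ℝ) : 0 ≤ G.gnorm r y :=
  Real.rpow_nonneg (Finset.sum_nonneg fun _ _ => Real.rpow_nonneg (lqNorm_nonneg _) r) _

theorem gnorm_rpow {r : ℝ} (hr : 0 < r) (y : Fin k → ℝ) :
    G.gnorm r y ^ r = ∑ i, lqNorm (G.block i) (G.q i) y ^ r := by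
  rw [gnorm, ← Real.rpow_mul (Finset.sum_nonneg fun _ _ => Real.rpow_nonneg (lqNorm_nonneg _) r),
    one_div_mul_cancel hr.ne', Real.rpow_one]

variable {G}

theorem leverageScore_eq_zero {M : Matrix (Fin k) (Fin n) ℝ} {j : Fin k} (h : M j = 0) :
    leverageScore M j = 0 := by
  simp [leverageScore, h]

theorem rounded_row_eq_zero {j : Fin k} (h : G.A j = 0) (p : ℝ) (lam : Fin m → ℝ)
    (w : Fin k → ℝ) : G.rounded p lam w j = 0 := by
  ext l
  simp [rounded, scaled, Matrix.diagonal_mul, h]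

theorem IsGroupMeasure.row_eq_zero {lam : Fin m → ℝ} (h : G.IsGroupMeasure lam) {j : Fin k}
    (hj : lam (G.grp j) = 0) : G.A j = 0 := by
  by_contra hc
  exact (h.2 j hc).ne' hj

variable (G) in
-- The powers of `λ_i` agree because `λ^{1-2/p} = λ (λ^{-1/p})²`; groups of mass zero have zero
-- rows. This form shows the right side of the rounding inequality as a `λ`-average.
theorem gnorm_two_scaled_sq {p : ℝ} {lam : Fin m → ℝ} (h : G.IsGroupMeasure lam)
    (x : Fin n → ℝ) : G.gnorm 2 (G.scaled p lam *ᵥ x) ^ 2 =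
      ∑ i, lam i * (lam i ^ (-(1 / p)) * lqNorm (G.block i) (G.q i) (G.A *ᵥ x)) ^ 2 := by
  rw [← Real.rpow_two, gnorm_rpow _ two_pos]
  refine Finset.sum_congr rfl fun i _ => ?_
  have e : lqNorm (G.block i) (G.q i) (G.scaled p lam *ᵥ x) =
      lqNorm (G.block i) (G.q i) (lam i ^ (1 / 2 - 1 / p) • (G.A *ᵥ x)) := by
    refine lqNorm_congr fun j hj => ?_
    rw [scaled_mulVec, G.mem_block.1 hj, Pi.smul_apply, smul_eq_mul]
  rw [e, lqNorm_smul (G.q_pos i), abs_of_nonneg (Real.rpow_nonneg (h.1.1 i) _), Real.rpow_two]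
  rcases (h.1.1 i).eq_or_lt with h0 | h0
  · have : lqNorm (G.block i) (G.q i) (G.A *ᵥ x) = 0 := by
      refine lqNorm_eq_zero_of_forall (G.q_pos i) fun j hj => ?_
      have : G.A j = 0 := h.row_eq_zero (by rw [G.mem_block.1 hj, ← h0])
      simp [Matrix.mulVec, this]
    simp [this]
  · rw [mul_pow, mul_pow, ← mul_assoc]
    congr 1
    rw [← Real.rpow_two, ← Real.rpow_two, ← Real.rpow_mul h0.le, ← Real.rpow_mul h0.le]
    nth_rewrite 2 [← Real.rpow_one (lam i)]
    rw [← Real.rpow_add h0]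
    congr 1; ring

/-- The geometry of a block Lewis overestimate: the rows of `A` are represented by vectors `u_j`
of a Euclidean space. -/
theorem IsBlockLewisOverestimate.exists_embedding {p F : ℝ} (hp : 0 < p) {lam : Fin m → ℝ}
    {w : Fin k → ℝ} (h : G.IsBlockLewisOverestimate p F lam w) :
    ∃ (Z : (Fin n → ℝ) →ₗ[ℝ] EuclideanSpace ℝ (Fin n)) (u : Fin k → EuclideanSpace ℝ (Fin n)),
      (∀ x j, (G.A *ᵥ x) j = inner ℝ (u j) (Z x)) ∧
      (∀ x, ‖Z x‖ ^ 2 ≤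
        ∑ i, lam i * (lam i ^ (-(1 / p)) * lqNorm (G.block i) (G.q i) (G.A *ᵥ x)) ^ 2) ∧
      (∀ i, lqNorm (G.block i) (G.q i) (fun j => ‖u j‖) ^ p = G.alphaPow p lam w i) ∧
      (∀ i, lam i ^ (-(1 / p)) * lqNorm (G.block i) (G.q i) (fun j => ‖u j‖) ≤ √F) ∧
      (∀ j, lam (G.grp j) = 0 → u j = 0) := by
  obtain ⟨Z, v, hZ, hv, hτ, -⟩ := exists_leverage_embedding (G.rounded p lam w)
  obtain ⟨hm, hround, hF, hb⟩ := h
  have hw := hround.1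
  have hlam := hm.1.1
  have hv0 : ∀ j, lam (G.grp j) = 0 → v j = 0 := fun j hj => by
    have := hτ j
    rw [leverageScore_eq_zero (rounded_row_eq_zero (hm.row_eq_zero hj) p lam w)] at this
    exact norm_eq_zero.1 (pow_eq_zero_iff two_ne_zero |>.1 this)
  -- Undoing the factor `W^{1/2} Λ^{1/2-1/p}` makes the vectors represent the rows of `A` itself.
  -- Where the mass is zero, `v j = 0` and the powers of `0` do not matter.
  let u : Fin k → EuclideanSpace ℝ (Fin n) := fun j =>
    (lam (G.grp j) ^ (1 / p - 1 / 2) * (w j ^ (1 / 2 : ℝ))⁻¹) • v j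
  have hα : ∀ i, lqNorm (G.block i) (G.q i) (fun j => ‖u j‖) =
      lam i ^ (1 / p - 1 / 2) * G.levSum p lam w i ^ (1 / G.q i) := by
    intro i
    have hq := G.q_pos i
    have e : lqNorm (G.block i) (G.q i) (fun j => ‖u j‖) = lqNorm (G.block i) (G.q i)
        (lam i ^ (1 / p - 1 / 2) • fun j => (w j ^ (1 / 2 : ℝ))⁻¹ * ‖v j‖) := by
      refine lqNorm_congr fun j hj => ?_
      simp only [u, norm_smul, Pi.smul_apply, smul_eq_mul]
      rw [Real.norm_of_nonneg (mul_nonneg (Real.rpow_nonneg (hlam _) _)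
        (inv_nonneg.2 (Real.rpow_nonneg (hw j).le _))), G.mem_block.1 hj, mul_assoc]
    rw [e, lqNorm_smul hq, abs_of_nonneg (Real.rpow_nonneg (hlam i) _), lqNorm, levSum]
    congr 2
    refine Finset.sum_congr rfl fun j _ => ?_
    have hwj := hw j
    rw [abs_of_nonneg (by positivity), ← hτ]
    have : ‖v j‖ ^ 2 / w j = ((w j ^ (1 / 2 : ℝ))⁻¹ * ‖v j‖) ^ (2 : ℝ) := by
      rw [Real.rpow_two, mul_pow, inv_pow, ← Real.rpow_two (w j ^ (1 / 2 : ℝ)),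
        ← Real.rpow_mul hwj.le]
      norm_num
      ring
    rw [this, ← Real.rpow_mul (by positivity)]
    congr 1; ring
  have hlev0 : ∀ i, 0 ≤ G.levSum p lam w i := fun i =>
    Finset.sum_nonneg fun j _ => Real.rpow_nonneg
      (div_nonneg (leverageScore_nonneg _ j) (hw j).le) _
  have hlevz : ∀ i, lam i = 0 → G.levSum p lam w i = 0 := fun i hi =>
    Finset.sum_eq_zero fun j hj => by
      rw [leverageScore_eq_zero (rounded_row_eq_zero
        (hm.row_eq_zero (by rw [G.mem_block.1 hj, hi])) p lam w), zero_div,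
        Real.zero_rpow (half_pos (G.q_pos i)).ne']
  refine ⟨Z, u, fun x j => ?_, fun x => ?_, fun i => ?_, fun i => ?_, fun j hj => ?_⟩
  · simp only [u, real_inner_smul_left]
    rw [← hv, rounded_mulVec]
    rcases (hlam (G.grp j)).eq_or_lt with h0 | h0
    · have := hm.row_eq_zero h0.symm
      simp [Matrix.mulVec, this]
    · have h1 : lam (G.grp j) ^ (1 / p - 1 / 2) * lam (G.grp j) ^ (1 / 2 - 1 / p) = 1 := by
        rw [← Real.rpow_add h0]; norm_num
      have h2 : (w j ^ (1 / 2 : ℝ)) ≠ 0 := (Real.rpow_pos_of_pos (hw j) _).ne'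
      calc (G.A *ᵥ x) j = (lam (G.grp j) ^ (1 / p - 1 / 2) * lam (G.grp j) ^ (1 / 2 - 1 / p)) *
            ((w j ^ (1 / 2 : ℝ))⁻¹ * w j ^ (1 / 2 : ℝ)) * (G.A *ᵥ x) j := by
            rw [h1, inv_mul_cancel₀ h2]; ring
        _ = _ := by ring
  · rw [hZ, ← gnorm_two_scaled_sq G hm]
    exact pow_le_pow_left₀ (norm_nonneg _) (hround.2 x) 2
  · rw [hα, alphaPow]
    rcases (hlam i).eq_or_lt with h0 | h0
    · rw [hlevz i h0.symm, Real.zero_rpow (one_div_pos.2 (G.q_pos i)).ne', mul_zero,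
        Real.zero_rpow hp.ne', Real.zero_rpow (div_pos hp (G.q_pos i)).ne', mul_zero]
    · rw [Real.mul_rpow (by positivity) (Real.rpow_nonneg (hlev0 i) _), ← Real.rpow_mul h0.le,
        ← Real.rpow_mul (hlev0 i)]
      congr 2
      · field_simp
      · ring
  · rw [hα]
    rcases (hlam i).eq_or_lt with h0 | h0
    · rw [hlevz i h0.symm, Real.zero_rpow (one_div_pos.2 (G.q_pos i)).ne', mul_zero, mul_zero]
      positivity
    · apply Real.le_sqrt_of_sq_le
      refine le_trans (le_of_eq ?_) (hb i)
      rw [← mul_assoc, ← Real.rpow_add h0, mul_pow, ← Real.rpow_two, ← Real.rpow_two,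
        ← Real.rpow_mul h0.le, ← Real.rpow_mul (hlev0 i)]
      congr 1
      · rw [show (-(1 / p) + (1 / p - 1 / 2)) * 2 = (-1 : ℝ) by ring, Real.rpow_neg_one, one_div]
      · congr 1; ring
  · simp only [u, hv0 j hj, smul_zero]

end BlockData

end

/-! ### Packings, covering numbers and the sampling body. -/

noncomputable section

/-- By maximality, every point of `T` is close to some member of a largest far-separated subset.
That subset has at most `e^X` points, and at most `e^Y` points of `T` are close to each. This splits
a packing count into two scales. -/
theorem log_card_le_of_clusters {ι : Type*} (T : Finset ι) (far : ι → ι → Prop)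
    (hirr : ∀ x, ¬ far x x) (hsymm : ∀ x y, far x y → far y x) {X Y : ℝ} (hX0 : 0 ≤ X)
    (hY0 : 0 ≤ Y)
    (hX : ∀ T' ⊆ T, (∀ x ∈ T', ∀ y ∈ T', x ≠ y → far x y) → Real.log T'.card ≤ X)
    (hY : ∀ T' ⊆ T, ∀ y ∈ T, (∀ x ∈ T', ¬ far x y) → Real.log T'.card ≤ Y) :
    Real.log T.card ≤ X + Y := by
  classical
  have hexp : ∀ (a : ℕ) (L : ℝ), Real.log a ≤ L → 0 ≤ L → (a : ℝ) ≤ Real.exp L := by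
    intro a L h hL
    rcases Nat.eq_zero_or_pos a with h0 | h0
    · rw [h0]; simpa using (Real.exp_pos L).le
    · exact (Real.log_le_iff_le_exp (by exact_mod_cast h0)).1 h
  let P : Finset ι → Prop := fun T' => ∀ x ∈ T', ∀ y ∈ T', x ≠ y → far x y
  obtain ⟨T', hT', hmax⟩ := Finset.exists_max_image (T.powerset.filter P) Finset.card
    ⟨∅, by simp [P]⟩
  rw [Finset.mem_filter, Finset.mem_powerset] at hT'
  obtain ⟨hsub, hfar⟩ := hT'
  have hcov : T ⊆ T'.biUnion fun y => T.filter fun x => ¬ far x y := by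
    intro x hx
    rw [Finset.mem_biUnion]
    by_contra! hc
    have hx' : ∀ y ∈ T', far x y := fun y hy => by
      by_contra h
      exact hc y hy (Finset.mem_filter.2 ⟨hx, h⟩)
    have hxT' : x ∉ T' := fun h => hirr x (hx' x h)
    have := hmax (insert x T') (by
      rw [Finset.mem_filter, Finset.mem_powerset]
      refine ⟨Finset.insert_subset hx hsub, ?_⟩
      intro a ha b hb hab
      rcases Finset.mem_insert.1 ha with rfl | ha'
      · rcases Finset.mem_insert.1 hb with rfl | hb
        · exact absurd rfl hab
        · exact hx' b hb
      · rcases Finset.mem_insert.1 hb with rfl | hb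
        · exact hsymm _ _ (hx' a ha')
        · exact hfar a ha' b hb hab)
    rw [Finset.card_insert_of_notMem hxT'] at this
    omega
  have h1 : (T.card : ℝ) ≤ Real.exp X * Real.exp Y := by
    calc (T.card : ℝ) ≤ ∑ y ∈ T', ((T.filter fun x => ¬ far x y).card : ℝ) := by
          exact_mod_cast (Finset.card_le_card hcov).trans Finset.card_biUnion_le
      _ ≤ ∑ y ∈ T', Real.exp Y := Finset.sum_le_sum fun y hy =>
          hexp _ _ (hY _ (Finset.filter_subset _ _) y (hsub hy) fun x hx =>
            (Finset.mem_filter.1 hx).2) hY0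
      _ = T'.card * Real.exp Y := by rw [Finset.sum_const, nsmul_eq_mul]
      _ ≤ _ := by
          gcongr
          exact hexp _ _ (hX _ hsub hfar) hX0
  rcases Nat.eq_zero_or_pos T.card with h0 | h0
  · rw [h0]; simpa using by linarith
  · rw [← Real.exp_add] at h1
    exact (Real.log_le_iff_le_exp (by exact_mod_cast h0)).2 h1

/-- A bound for packings is a bound for the covering number. -/
theorem exists_coveringNumber_eq {n : ℕ} {X Y : Set (Fin n → ℝ)} (hY0 : 0 ∈ Y)
    (hYs : ∀ y ∈ Y, -y ∈ Y) {L : ℝ} (hL : 0 ≤ L)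
    (h : ∀ T : Finset (Fin n → ℝ), (∀ x ∈ T, x ∈ X) →
      (∀ x ∈ T, ∀ y ∈ T, x ≠ y → x - y ∉ Y) → Real.log T.card ≤ L) :
    ∃ N : ℕ, coveringNumber X Y = N ∧ Real.log N ≤ L := by
  classical
  set P : Set ℕ := {a | ∃ T : Finset (Fin n → ℝ), (∀ x ∈ T, x ∈ X) ∧
      (∀ x ∈ T, ∀ y ∈ T, x ≠ y → x - y ∉ Y) ∧ T.card = a} with hP
  have hne : P.Nonempty := ⟨0, ∅, by simp⟩
  have hbdd : BddAbove P := by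
    refine ⟨⌈Real.exp L⌉₊, ?_⟩
    rintro a ⟨T, h1, h2, rfl⟩
    have h3 := h T h1 h2
    rcases Nat.eq_zero_or_pos T.card with h0 | h0
    · rw [h0]; exact Nat.zero_le _
    · have := (Real.log_le_iff_le_exp (by exact_mod_cast h0)).1 h3
      exact_mod_cast this.trans (Nat.le_ceil _)
  -- A packing of largest cardinality is a net, since an uncovered point could be added to it.
  obtain ⟨T, h1, h2, h3⟩ := Nat.sSup_mem hne hbdd
  have hcov : X ⊆ ⋃ c ∈ T, (fun y => c + y) '' Y := by
    intro x hx
    simp only [Set.mem_iUnion, Set.mem_image]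
    by_contra! hc
    have hx' : ∀ c ∈ T, x - c ∉ Y := fun c hcT hY => hc c hcT (x - c) hY (by abel)
    have hx'' : ∀ c ∈ T, c - x ∉ Y := fun c hcT hY => hx' c hcT (by
      have := hYs _ hY; rwa [neg_sub] at this)
    have hxT : x ∉ T := fun hxT => hx' x hxT (by rwa [sub_self])
    have := le_csSup hbdd (show T.card + 1 ∈ P from ⟨insert x T, by
      intro a ha
      rcases Finset.mem_insert.1 ha with rfl | ha'
      · exact hx
      · exact h1 a ha', by
      intro a ha b hb hab
      rcases Finset.mem_insert.1 ha with rfl | ha'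
      · rcases Finset.mem_insert.1 hb with rfl | hb
        · exact absurd rfl hab
        · exact hx' b hb
      · rcases Finset.mem_insert.1 hb with rfl | hb
        · exact hx'' a ha'
        · exact h2 a ha' b hb hab, Finset.card_insert_of_notMem hxT⟩)
    omega
  have hle : coveringNumber X Y ≤ T.card := iInf₂_le T hcov
  have hfin : coveringNumber X Y ≠ ⊤ := fun htop => by
    rw [htop] at hle
    exact ENat.natCast_ne_top _ (top_le_iff.1 hle)
  obtain ⟨N, hN⟩ := ENat.ne_top_iff_exists.1 hfin
  refine ⟨N, hN.symm, ?_⟩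
  rw [← hN] at hle
  have hle' : N ≤ T.card := by exact_mod_cast hle
  rcases Nat.eq_zero_or_pos N with h0 | h0
  · rw [h0]; simpa using hL
  · exact (Real.log_le_log (by exact_mod_cast h0) (by exact_mod_cast hle')).trans (h T h1 h2)

namespace BlockData

variable {k n m : ℕ} (G : BlockData k n m)

theorem samplingNorm_smul (p : ℝ) (S : Finset (Fin m)) (ρ : Fin m → ℝ) {a : ℝ} (ha : 0 ≤ a)
    (x : Fin n → ℝ) : G.samplingNorm p S ρ (a • x) = a * G.samplingNorm p S ρ x := by
  rw [samplingNorm, samplingNorm, Real.mul_iSup_of_nonneg ha]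
  congr 1
  ext i
  rw [Matrix.mulVec_smul, lqNorm_smul (G.q_pos i), abs_of_nonneg ha]; ring

theorem samplingNorm_neg (p : ℝ) (S : Finset (Fin m)) (ρ : Fin m → ℝ) (x : Fin n → ℝ) :
    G.samplingNorm p S ρ (-x) = G.samplingNorm p S ρ x := by
  simp only [samplingNorm, Matrix.mulVec_neg, lqNorm_neg]

theorem mem_smul_samplingBody {p η : ℝ} (hη : 0 < η) (S : Finset (Fin m)) (ρ : Fin m → ℝ)
    (x : Fin n → ℝ) : x ∈ η • G.samplingBody p S ρ ↔ G.samplingNorm p S ρ x ≤ η := by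
  rw [Set.mem_smul_set_iff_inv_smul_mem₀ hη.ne']
  change G.samplingNorm p S ρ (η⁻¹ • x) ≤ 1 ↔ _
  rw [samplingNorm_smul _ _ _ _ (inv_nonneg.2 hη.le), inv_mul_le_iff₀ hη, mul_one]

theorem exists_lt_of_notMem {p η : ℝ} (hη : 0 < η) {S : Finset (Fin m)} {ρ : Fin m → ℝ}
    {x : Fin n → ℝ} (h : x ∉ η • G.samplingBody p S ρ) :
    ∃ i ∈ S, η < ρ i ^ (-(1 / p)) * lqNorm (G.block i) (G.q i) (G.A *ᵥ x) := by
  rw [mem_smul_samplingBody _ hη] at h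
  by_contra! hc
  exact h (Real.iSup_le (fun i => hc i i.2) hη.le)

variable {E : Type*} [NormedAddCommGroup E] [InnerProductSpace ℝ E] [FiniteDimensional ℝ E]
  [MeasurableSpace E] [BorelSpace E]

/-- Packings of a Euclidean ball by the sampling body. -/
theorem log_card_le_of_sampling {κ : ℝ} (hG : G.QuasiTriangle κ) (hκ : 1 ≤ κ) {p : ℝ} (hp : 0 < p)
    (Z : (Fin n → ℝ) →ₗ[ℝ] E) (u : Fin k → E) (hA : ∀ x j, (G.A *ᵥ x) j = inner ℝ (u j) (Z x))
    {S : Finset (Fin m)} {ρ : Fin m → ℝ} {H F η r R : ℝ} (hρ0 : ∀ i, 0 ≤ ρ i) (hH : 0 < H)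
    (hF : 0 < F) (hη : 0 < η) (hR : 0 < R)
    (hρ : ∀ i, lqNorm (G.block i) (G.q i) (fun j => ‖u j‖) ^ p /
      ∑ l, lqNorm (G.block l) (G.q l) (fun j => ‖u j‖) ^ p ≤ H * ρ i)
    (hα : ∑ l, lqNorm (G.block l) (G.q l) (fun j => ‖u j‖) ^ p ≤ F ^ (p / 2))
    (hr : 1 ≤ r) (hrq : ∀ i, G.q i ≤ r ∨ Real.logb 2 (G.block i).card ≤ r)
    (hS : (S.card : ℝ) ≤ 2 ^ r) (T : Finset (Fin n → ℝ)) (x₀ : E)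
    (hT : ∀ x ∈ T, ‖Z x - x₀‖ ≤ R)
    (hsep : ∀ x ∈ T, ∀ y ∈ T, x ≠ y → x - y ∉ η • G.samplingBody p S ρ) :
    Real.log T.card ≤ 200 * κ ^ 2 * r * (2 * (H ^ (1 / p) * √F) * R / η) ^ 2 := by
  classical
  have hr0 : 0 < r := by linarith
  set α : Fin m → ℝ := fun i => lqNorm (G.block i) (G.q i) (fun j => ‖u j‖) with hαdef
  have hα0 : ∀ i, 0 ≤ α i := fun i => lqNorm_nonneg _
  -- The maximum over `S` is replaced by an `ℓ_r` sum, at the cost `|S|^{1/r} ≤ 2`. For `ρ_i = 0`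
  -- the factor `0^{-1/p}` is read as `0`, here as in `samplingNorm`.
  set c : Fin m → ℝ := fun i => if i ∈ S then (ρ i ^ (-(1 / p))) ^ r else 0 with hc
  have hc0 : ∀ i, 0 ≤ c i := fun i => by
    have := hρ0 i
    simp only [hc]; split_ifs <;> positivity
  set b := H ^ (1 / p) * √F with hb
  have hb0 : 0 < b := by positivity
  -- The reason is `α_i^p ≤ H ρ_i ∑ α_l^p ≤ H ρ_i F^{p/2}`; a vanishing sum is treated apart because
  -- the hypothesis divides by it.
  have hterm : ∀ i, ρ i ^ (-(1 / p)) * α i ≤ b := by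
    intro i
    rcases (hρ0 i).eq_or_lt with h0 | h0
    · rw [← h0, Real.zero_rpow (by simpa using hp.ne'), zero_mul]; exact hb0.le
    · have h1 : α i ^ p ≤ H * ρ i * F ^ (p / 2) := by
        have hle : α i ^ p ≤ ∑ l, α l ^ p :=
          Finset.single_le_sum (f := fun l => α l ^ p) (fun l _ => Real.rpow_nonneg (hα0 l) p)
            (Finset.mem_univ i)
        have hs0 : 0 ≤ ∑ l, α l ^ p := Finset.sum_nonneg fun l _ => Real.rpow_nonneg (hα0 l) p
        rcases hs0.eq_or_lt with hs | hs
        · rw [← hs] at hle; exact hle.trans (by positivity)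
        · have h2 := (div_le_iff₀ hs).1 (hρ i)
          refine h2.trans ?_
          gcongr
      rw [← Real.rpow_le_rpow_iff (by have := hα0 i; positivity) hb0.le hp,
        Real.mul_rpow (by positivity) (hα0 i), ← Real.rpow_mul h0.le, hb,
        Real.mul_rpow (by positivity) (by positivity), ← Real.rpow_mul hH.le,
        one_div_mul_cancel hp.ne', Real.rpow_one, neg_mul, one_div_mul_cancel hp.ne',
        Real.rpow_neg_one, inv_mul_le_iff₀ h0, Real.sqrt_eq_rpow, ← Real.rpow_mul hF.le]
      refine h1.trans_eq ?_
      rw [show 1 / 2 * p = p / 2 by ring]; ring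
  have hB : ∑ i, c i * α i ^ r ≤ (2 * b) ^ r := by
    calc ∑ i, c i * α i ^ r = ∑ i ∈ S, (ρ i ^ (-(1 / p)) * α i) ^ r := by
          simp only [hc, ite_mul, zero_mul, Finset.sum_ite_mem, Finset.univ_inter]
          refine Finset.sum_congr rfl fun i _ => ?_
          rw [Real.mul_rpow (Real.rpow_nonneg (hρ0 i) _) (hα0 i)]
      _ ≤ ∑ i ∈ S, b ^ r := Finset.sum_le_sum fun i _ => Real.rpow_le_rpow
          (mul_nonneg (Real.rpow_nonneg (hρ0 i) _) (hα0 i)) (hterm i) hr0.le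
      _ = S.card * b ^ r := by rw [Finset.sum_const, nsmul_eq_mul]
      _ ≤ _ := by rw [Real.mul_rpow (by norm_num) hb0.le]; gcongr
  refine G.log_card_le_of_separated hG hκ u hc0 hr hrq (by positivity) hB hR hη T Z x₀ hT ?_
  intro x hx y hy hxy
  obtain ⟨i, hi, hlt⟩ := G.exists_lt_of_notMem hη (hsep x hx y hy hxy)
  have e : G.A *ᵥ (x - y) = fun j => (inner ℝ (u j) (Z x - Z y) : ℝ) := by
    ext j; rw [hA, map_sub]
  rw [e] at hlt
  have hnn := fun i => lqNorm_nonneg (s := G.block i) (q := G.q i)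
    (fun j => (inner ℝ (u j) (Z x - Z y) : ℝ))
  calc η ^ r < (ρ i ^ (-(1 / p)) * lqNorm (G.block i) (G.q i)
        (fun j => inner ℝ (u j) (Z x - Z y))) ^ r := Real.rpow_lt_rpow hη.le hlt hr0
    _ = c i * lqNorm (G.block i) (G.q i) (fun j => inner ℝ (u j) (Z x - Z y)) ^ r := by
        rw [Real.mul_rpow (Real.rpow_nonneg (hρ0 i) _) (hnn i)]
        simp [hc, hi]
    _ ≤ _ := Finset.single_le_sum
        (f := fun i => c i * lqNorm (G.block i) (G.q i) (fun j => inner ℝ (u j) (Z x - Z y)) ^ r)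
        (fun i _ => mul_nonneg (hc0 i) (Real.rpow_nonneg (hnn i) r)) (Finset.mem_univ i)

end BlockData

end

/-! ### Euclidean packings of the unit ball: truncation and halving. -/

noncomputable section

namespace BlockData

variable {k n m : ℕ} (G : BlockData k n m)

/-- `∑ λ_i f_i^s`, with `f_i = λ_i^{-1/p} ‖A_{S_i} x‖`. -/
def weightedPow (p : ℝ) (lam : Fin m → ℝ) (s : ℝ) (x : Fin n → ℝ) : ℝ :=
  ∑ i, lam i * (lam i ^ (-(1 / p)) * lqNorm (G.block i) (G.q i) (G.A *ᵥ x)) ^ s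

variable {p : ℝ} {lam : Fin m → ℝ}

theorem sum_lqNorm_rpow_le_one (hp : 0 < p) {x : Fin n → ℝ} (hx : x ∈ G.unitBall p) :
    ∑ i, lqNorm (G.block i) (G.q i) (G.A *ᵥ x) ^ p ≤ 1 := by
  rw [← gnorm_rpow _ hp]
  exact Real.rpow_le_one (G.gnorm_nonneg _ _) hx hp.le

theorem weightedPow_self_le (hp : 0 < p) (hlam : ∀ i, 0 ≤ lam i) (x : Fin n → ℝ) :
    G.weightedPow p lam p x ≤ ∑ i, lqNorm (G.block i) (G.q i) (G.A *ᵥ x) ^ p := by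
  refine Finset.sum_le_sum fun i _ => ?_
  have hN := lqNorm_nonneg (s := G.block i) (q := G.q i) (G.A *ᵥ x)
  rcases (hlam i).eq_or_lt with h0 | h0
  · rw [← h0, zero_mul]; positivity
  · rw [Real.mul_rpow (by positivity) hN, ← Real.rpow_mul h0.le, neg_mul,
      one_div_mul_cancel hp.ne', Real.rpow_neg_one, ← mul_assoc, mul_inv_cancel₀ h0.ne', one_mul]

theorem weightedPow_sub_le (hp : 0 < p) (hlam : ∀ i, 0 ≤ lam i) {κ : ℝ}
    (hG : G.QuasiTriangle κ) (hκ : 0 ≤ κ) {x y : Fin n → ℝ} (hx : x ∈ G.unitBall p)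
    (hy : y ∈ G.unitBall p) : G.weightedPow p lam p (x - y) ≤ 2 * κ ^ p := by
  refine (G.weightedPow_self_le hp hlam _).trans ?_
  have h1 : ∀ i, lqNorm (G.block i) (G.q i) (G.A *ᵥ (x - y)) ^ p ≤ κ ^ p *
      (lqNorm (G.block i) (G.q i) (G.A *ᵥ x) ^ p + lqNorm (G.block i) (G.q i) (G.A *ᵥ y) ^ p) := by
    intro i
    rw [sub_eq_add_neg, Matrix.mulVec_add, ← lqNorm_neg (G.A *ᵥ y), ← Matrix.mulVec_neg]
    exact hG.rpow_add_le hκ hp i _ _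
  refine (Finset.sum_le_sum fun i _ => h1 i).trans ?_
  rw [← Finset.mul_sum, Finset.sum_add_distrib, mul_comm]
  gcongr
  have := G.sum_lqNorm_rpow_le_one hp hx
  have := G.sum_lqNorm_rpow_le_one hp hy
  linarith

/-- Pointwise `f² ≤ 1 + f^p`, averaged against the probability measure. It places `B_p` in a
Euclidean ball of radius `√2`. -/
theorem weightedPow_two_le_of_ge (hp : 2 ≤ p) (hlam : IsProbVec lam) {x : Fin n → ℝ}
    (hx : x ∈ G.unitBall p) : G.weightedPow p lam 2 x ≤ 2 := by
  have hp0 : 0 < p := by linarith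
  have h1 : G.weightedPow p lam 2 x ≤ ∑ i, (lam i + lam i *
      (lam i ^ (-(1 / p)) * lqNorm (G.block i) (G.q i) (G.A *ᵥ x)) ^ p) := by
    refine Finset.sum_le_sum fun i _ => ?_
    have hl := hlam.1 i
    have hN := lqNorm_nonneg (s := G.block i) (q := G.q i) (G.A *ᵥ x)
    set f := lam i ^ (-(1 / p)) * lqNorm (G.block i) (G.q i) (G.A *ᵥ x)
    have hf : 0 ≤ f := by positivity
    have h2 : f ^ (2 : ℝ) ≤ 1 + f ^ p := by
      rcases le_total f 1 with h | h
      · have := Real.rpow_le_one hf h (z := 2) (by norm_num)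
        have := Real.rpow_nonneg hf p
        linarith
      · have := Real.rpow_le_rpow_of_exponent_le h hp
        linarith
    calc lam i * f ^ (2 : ℝ) ≤ lam i * (1 + f ^ p) := by gcongr
      _ = _ := by ring
  rw [Finset.sum_add_distrib, hlam.2] at h1
  have h2 := G.weightedPow_self_le hp0 hlam.1 x
  have h3 := G.sum_lqNorm_rpow_le_one hp0 hx
  rw [weightedPow] at h2
  linarith

/-- Truncation at height `σ`: `f² ≤ σ^{2-p} f^p` where `f ≤ σ`, and `f² ≤ σ^{2-r} f^r` elsewhere. On
differences of points of `B_p` the first term is controlled, so Euclidean separation must show in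
the `r`-th powers. -/
theorem weightedPow_two_le (hp2 : p ≤ 2) (hlam : ∀ i, 0 ≤ lam i) {r : ℝ} (hr : 2 ≤ r) {σ : ℝ}
    (hσ : 0 < σ) (x : Fin n → ℝ) : G.weightedPow p lam 2 x ≤
      σ ^ (2 - p) * G.weightedPow p lam p x + σ ^ (2 - r) * G.weightedPow p lam r x := by
  simp only [weightedPow]
  rw [Finset.mul_sum, Finset.mul_sum, ← Finset.sum_add_distrib]
  refine Finset.sum_le_sum fun i _ => ?_
  have hl := hlam i
  have hN := lqNorm_nonneg (s := G.block i) (q := G.q i) (G.A *ᵥ x)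
  set f := lam i ^ (-(1 / p)) * lqNorm (G.block i) (G.q i) (G.A *ᵥ x)
  have hf : 0 ≤ f := by positivity
  have h1 : f ^ (2 : ℝ) ≤ σ ^ (2 - p) * f ^ p + σ ^ (2 - r) * f ^ r := by
    rcases hf.eq_or_lt with h0 | h0
    · rw [← h0, Real.zero_rpow two_ne_zero]; positivity
    rcases le_total f σ with h | h
    · have : f ^ (2 : ℝ) = f ^ (2 - p) * f ^ p := by rw [← Real.rpow_add h0]; congr 1; ring
      rw [this]
      have : f ^ (2 - p) * f ^ p ≤ σ ^ (2 - p) * f ^ p := by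
        gcongr
      have : 0 ≤ σ ^ (2 - r) * f ^ r := by positivity
      linarith
    · have : f ^ (2 : ℝ) = f ^ (2 - r) * f ^ r := by rw [← Real.rpow_add h0]; congr 1; ring
      rw [this]
      have : f ^ (2 - r) ≤ σ ^ (2 - r) := Real.rpow_le_rpow_of_nonpos hσ h (by linarith)
      have : f ^ (2 - r) * f ^ r ≤ σ ^ (2 - r) * f ^ r := by gcongr
      have : 0 ≤ σ ^ (2 - p) * f ^ p := by positivity
      linarith
  calc lam i * f ^ (2 : ℝ) ≤ lam i * (σ ^ (2 - p) * f ^ p + σ ^ (2 - r) * f ^ r) := by gcongr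
    _ = _ := by ring

variable {E : Type*} [NormedAddCommGroup E] [InnerProductSpace ℝ E]

theorem weightedPow_eq_powSum (hlam : ∀ i, 0 ≤ lam i) (Z : (Fin n → ℝ) →ₗ[ℝ] E) (u : Fin k → E)
    (hA : ∀ x j, (G.A *ᵥ x) j = inner ℝ (u j) (Z x)) (r : ℝ) (x : Fin n → ℝ) :
    G.weightedPow p lam r x = G.powSum u (fun i => lam i * (lam i ^ (-(1 / p))) ^ r) r (Z x) := by
  refine Finset.sum_congr rfl fun i _ => ?_
  have : G.A *ᵥ x = fun j => (inner ℝ (u j) (Z x) : ℝ) := funext (hA x)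
  rw [this, Real.mul_rpow (Real.rpow_nonneg (hlam i) _) (lqNorm_nonneg _)]
  ring

/-- On differences of points of `B_p`, `p < 2`, the Euclidean length is at most
`c^{1/p} F^{1/p-1/2}`. -/
theorem norm_sq_le_of_weightedPow_le (hp : 0 < p) (hp2 : p < 2) (hlam : ∀ i, 0 ≤ lam i)
    (Z : (Fin n → ℝ) →ₗ[ℝ] E) (u : Fin k → E)
    (hA : ∀ x j, (G.A *ᵥ x) j = inner ℝ (u j) (Z x)) {F : ℝ} (hF0 : 0 < F)
    (hF : ∀ i, lam i ^ (-(1 / p)) * lqNorm (G.block i) (G.q i) (fun j => ‖u j‖) ≤ √F)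
    {x : Fin n → ℝ} (hround : ‖Z x‖ ^ 2 ≤ G.weightedPow p lam 2 x) {c σ : ℝ} (hc : 0 < c)
    (hx : G.weightedPow p lam p x ≤ c) (hσ : (c * F) ^ (1 / p) ≤ σ) :
    ‖Z x‖ ^ 2 ≤ c * σ ^ (2 - p) := by
  set a := ‖Z x‖ with ha
  have hσ0 : 0 < σ := lt_of_lt_of_le (by positivity) hσ
  rcases (norm_nonneg (Z x)).eq_or_lt with h0 | h0
  · rw [ha, ← h0]; simp only [ne_eq, OfNat.ofNat_ne_zero, not_false_eq_true, zero_pow]; positivity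
  -- A self-bounding estimate: Cauchy–Schwarz gives `f_i ≤ √F ‖Z x‖`, hence `‖Z x‖² ≤ c (√F ‖Z
  -- x‖)^{2-p}`, and a power of `‖Z x‖` cancels.
  have h1 : G.weightedPow p lam 2 x ≤ c * (√F * a) ^ (2 - p) := by
    have h2 : 0 ≤ (√F * a) ^ (2 - p) :=
      Real.rpow_nonneg (mul_nonneg (Real.sqrt_nonneg F) (norm_nonneg _)) _
    refine le_trans ?_ (mul_le_mul_of_nonneg_right hx h2)
    rw [weightedPow, weightedPow, Finset.sum_mul]
    refine Finset.sum_le_sum fun i _ => ?_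
    have hl := hlam i
    have hN := lqNorm_nonneg (s := G.block i) (q := G.q i) (G.A *ᵥ x)
    have hf1 : lam i ^ (-(1 / p)) * lqNorm (G.block i) (G.q i) (G.A *ᵥ x) ≤ √F * a := by
      have : G.A *ᵥ x = fun j => (inner ℝ (u j) (Z x) : ℝ) := funext (hA x)
      rw [this]
      calc _ ≤ lam i ^ (-(1 / p)) * (lqNorm (G.block i) (G.q i) (fun j => ‖u j‖) * ‖Z x‖) := by
            gcongr
            exact lqNorm_inner_le (G.q_pos i) u (Z x)
        _ = lam i ^ (-(1 / p)) * lqNorm (G.block i) (G.q i) (fun j => ‖u j‖) * a := by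
            rw [ha]; ring
        _ ≤ _ := by gcongr; exact hF i
    set f := lam i ^ (-(1 / p)) * lqNorm (G.block i) (G.q i) (G.A *ᵥ x)
    have hf : 0 ≤ f := by positivity
    rcases hf.eq_or_lt with h0 | h0
    · rw [← h0, Real.zero_rpow two_ne_zero, mul_zero]; positivity
    have : f ^ (2 : ℝ) = f ^ p * f ^ (2 - p) := by rw [← Real.rpow_add h0]; congr 1; ring
    rw [this, mul_assoc]
    gcongr
  have h2 : a ^ p ≤ c * F ^ ((2 - p) / 2) := by
    have e : a ^ 2 = a ^ p * a ^ (2 - p) := by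
      rw [← Real.rpow_add h0, ← Real.rpow_two]; congr 1; ring
    have h3 := hround.trans h1
    rw [e, Real.mul_rpow (by positivity) h0.le, ← mul_assoc] at h3
    have h4 := le_of_mul_le_mul_right h3 (by positivity)
    rwa [Real.sqrt_eq_rpow, ← Real.rpow_mul hF0.le,
      show 1 / 2 * (2 - p) = (2 - p) / 2 by ring] at h4
  have h3 := Real.rpow_le_rpow (z := 2 / p) (by positivity) h2 (by positivity)
  rw [← Real.rpow_mul h0.le, mul_div_cancel₀ _ hp.ne', Real.rpow_two] at h3
  refine h3.trans ?_
  have h4 : (c * F ^ ((2 - p) / 2)) ^ (2 / p) = c * ((c * F) ^ (1 / p)) ^ (2 - p) := by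
    rw [Real.mul_rpow hc.le (by positivity), ← Real.rpow_mul hF0.le, ← Real.rpow_mul (by positivity),
      Real.mul_rpow hc.le hF0.le, ← mul_assoc]
    congr 1
    · nth_rewrite 2 [← Real.rpow_one c]
      rw [← Real.rpow_add hc]
      congr 1; field_simp; ring
    · congr 1; field_simp
  rw [h4]
  gcongr

variable [FiniteDimensional ℝ E] [MeasurableSpace E] [BorelSpace E]

/-- One step of the halving induction: a cluster of points of `B_p` at scale `2 σ` that is separated
at scale `σ`. -/
theorem log_card_cluster_le (hp : 0 < p) (hp2 : p < 2) (hlam : IsProbVec lam) {κ : ℝ}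
    (hG : G.QuasiTriangle κ) (hκ : 1 ≤ κ) (Z : (Fin n → ℝ) →ₗ[ℝ] E) (u : Fin k → E)
    (hA : ∀ x j, (G.A *ᵥ x) j = inner ℝ (u j) (Z x)) {F : ℝ} (hF0 : 0 < F)
    (hF : ∀ i, lam i ^ (-(1 / p)) * lqNorm (G.block i) (G.q i) (fun j => ‖u j‖) ≤ √F)
    (hround : ∀ x, ‖Z x‖ ^ 2 ≤ G.weightedPow p lam 2 x) {r : ℝ} (hr : 2 ≤ r)
    (hrq : ∀ i, G.q i ≤ r ∨ Real.logb 2 (G.block i).card ≤ r) (hFr : F ≤ 2 ^ r)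
    {c σ : ℝ} (hc : 1 ≤ c) (hσ : 0 < σ) (hσ' : σ < (c * F) ^ (1 / p))
    (T : Finset (Fin n → ℝ)) (x₀ : E)
    (hTp : ∀ x ∈ T, ∀ y ∈ T, G.weightedPow p lam p (x - y) ≤ c)
    (hT : ∀ x ∈ T, ‖Z x - x₀‖ ^ 2 ≤ (c + 1) * (2 * σ) ^ (2 - p))
    (hsep : ∀ x ∈ T, ∀ y ∈ T, x ≠ y → (c + 1) * σ ^ (2 - p) < ‖Z (x - y)‖ ^ 2) :
    Real.log T.card ≤ 3200 * κ ^ 2 * c * (c + 1) * (σ ^ (-p) * F * r) := by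
  have hr0 : 0 < r := by linarith
  have hlam0 := hlam.1
  have hσr : (σ ^ (1 - p / r)) ^ r = σ ^ (r - p) := by
    rw [← Real.rpow_mul hσ.le]; congr 1; field_simp
  have hB : ∑ i, lam i * (lam i ^ (-(1 / p))) ^ r *
      lqNorm (G.block i) (G.q i) (fun j => ‖u j‖) ^ r ≤ √F ^ r := by
    calc _ ≤ ∑ i, lam i * √F ^ r := by
          refine Finset.sum_le_sum fun i _ => ?_
          have hl := hlam0 i
          rw [mul_assoc, ← Real.mul_rpow (by positivity) (lqNorm_nonneg _)]
          gcongr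
          · exact mul_nonneg (by positivity) (lqNorm_nonneg _)
          · exact hF i
      _ = _ := by rw [← Finset.sum_mul, hlam.2, one_mul]
  have h := G.log_card_le_of_separated hG hκ u (fun i => mul_nonneg (hlam0 i)
    (Real.rpow_nonneg (Real.rpow_nonneg (hlam0 i) _) r)) (r := r) (B := √F)
    (R := √((c + 1) * (2 * σ) ^ (2 - p))) (η := σ ^ (1 - p / r)) (by linarith) hrq (by positivity)
    hB (by positivity) (by positivity) T Z x₀ (fun x hx => Real.le_sqrt_of_sq_le (hT x hx))
    (fun x hx y hy hxy => by
      -- If the `r`-th powers were at most `σ^{r-p}`, truncation at `σ` would give `‖Z (x - y)‖² ≤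
      -- (c + 1) σ^{2-p}`, against the separation. This is where `c + 1` comes from.
      rw [← map_sub, ← G.weightedPow_eq_powSum hlam0 Z u hA, hσr]
      by_contra! hle
      have h1 := G.weightedPow_two_le hp2.le hlam0 hr hσ (x - y)
      have h2 : σ ^ (2 - r) * G.weightedPow p lam r (x - y) ≤ σ ^ (2 - p) := by
        calc _ ≤ σ ^ (2 - r) * σ ^ (r - p) := by gcongr
          _ = _ := by rw [← Real.rpow_add hσ]; congr 1; ring
      have h3 : σ ^ (2 - p) * G.weightedPow p lam p (x - y) ≤ σ ^ (2 - p) * c := by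
        gcongr; exact hTp x hx y hy
      have h4 := hsep x hx y hy hxy
      have h5 := hround (x - y)
      linarith)
  refine h.trans ?_
  have e : (√F * √((c + 1) * (2 * σ) ^ (2 - p)) / σ ^ (1 - p / r)) ^ 2 =
      F * (c + 1) * 2 ^ (2 - p) * σ ^ (-p) * σ ^ (2 * p / r) := by
    rw [div_pow, mul_pow, Real.sq_sqrt hF0.le, Real.sq_sqrt (by positivity),
      Real.mul_rpow (by norm_num) hσ.le, ← Real.rpow_two (σ ^ (1 - p / r)), ← Real.rpow_mul hσ.le]
    have : σ ^ (2 - p) = σ ^ (-p) * σ ^ (2 * p / r) * σ ^ ((1 - p / r) * 2) := by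
      rw [← Real.rpow_add hσ, ← Real.rpow_add hσ]; congr 1; ring
    rw [this]
    field_simp
  -- The excess factor left by using finite `r` is at most `(c F)^{2/r}`, harmless because `F ≤
  -- 2^r`.
  have h1 : σ ^ (2 * p / r) ≤ 4 * c := by
    calc σ ^ (2 * p / r) ≤ ((c * F) ^ (1 / p)) ^ (2 * p / r) := by gcongr
      _ = (c * F) ^ (2 / r) := by
          rw [← Real.rpow_mul (by positivity)]; congr 1; field_simp
      _ ≤ (c * 2 ^ r) ^ (2 / r) := by gcongr
      _ = c ^ (2 / r) * 4 := by
          rw [Real.mul_rpow (by linarith) (by positivity), ← Real.rpow_mul (by norm_num),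
            mul_div_cancel₀ _ hr0.ne']
          norm_num
      _ ≤ c ^ (1 : ℝ) * 4 := by
          gcongr
          · rw [div_le_one hr0]; exact hr
      _ = 4 * c := by rw [Real.rpow_one]; ring
  have h2 : (2 : ℝ) ^ (2 - p) ≤ 4 := by
    calc (2 : ℝ) ^ (2 - p) ≤ 2 ^ (2 : ℝ) := by gcongr <;> linarith
      _ = 4 := by norm_num
  rw [e]
  calc 200 * κ ^ 2 * r * (F * (c + 1) * 2 ^ (2 - p) * σ ^ (-p) * σ ^ (2 * p / r))
      ≤ 200 * κ ^ 2 * r * (F * (c + 1) * 4 * σ ^ (-p) * (4 * c)) := by gcongr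
    _ = _ := by ring

/-- Packings of `B_p` in the Euclidean distance, `p < 2`. -/
theorem log_card_le_of_unitBall (hp : 0 < p) (hp2 : p < 2) (hlam : IsProbVec lam) {κ : ℝ}
    (hG : G.QuasiTriangle κ) (hκ : 1 ≤ κ) (Z : (Fin n → ℝ) →ₗ[ℝ] E) (u : Fin k → E)
    (hA : ∀ x j, (G.A *ᵥ x) j = inner ℝ (u j) (Z x)) {F : ℝ} (hF0 : 0 < F)
    (hF : ∀ i, lam i ^ (-(1 / p)) * lqNorm (G.block i) (G.q i) (fun j => ‖u j‖) ≤ √F)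
    (hround : ∀ x, ‖Z x‖ ^ 2 ≤ G.weightedPow p lam 2 x) {r : ℝ} (hr : 2 ≤ r)
    (hrq : ∀ i, G.q i ≤ r ∨ Real.logb 2 (G.block i).card ≤ r) (hFr : F ≤ 2 ^ r)
    {c : ℝ} (hc : 1 ≤ c) {σ : ℝ} (hσ : 0 < σ) (T : Finset (Fin n → ℝ))
    (hTp : ∀ x ∈ T, ∀ y ∈ T, G.weightedPow p lam p (x - y) ≤ c)
    (hsep : ∀ x ∈ T, ∀ y ∈ T, x ≠ y → (c + 1) * σ ^ (2 - p) < ‖Z (x - y)‖ ^ 2) :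
    Real.log T.card ≤
      3200 * κ ^ 2 * c * (c + 1) / (1 - 2 ^ (-p)) * (σ ^ (-p) * F * r) := by
  have hr0 : 0 < r := by linarith
  have h2p : (2 : ℝ) ^ (-p) < 1 := Real.rpow_lt_one_of_one_lt_of_neg (by norm_num) (by linarith)
  have h2p' : 0 < 1 - (2 : ℝ) ^ (-p) := by linarith
  -- `N` doublings bring `σ` to the scale `(c F)^{1/p}`, from which on a separated set has at most
  -- one point.
  obtain ⟨N, hN⟩ : ∃ N : ℕ, (c * F) ^ (1 / p) ≤ 2 ^ N * σ := by
    obtain ⟨N, hN⟩ := pow_unbounded_of_one_lt ((c * F) ^ (1 / p) / σ) (one_lt_two : (1 : ℝ) < 2)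
    exact ⟨N, ((div_lt_iff₀ hσ).1 hN).le⟩
  have base : ∀ σ : ℝ, 0 < σ → (c * F) ^ (1 / p) ≤ σ → ∀ T : Finset (Fin n → ℝ),
      (∀ x ∈ T, ∀ y ∈ T, G.weightedPow p lam p (x - y) ≤ c) →
      (∀ x ∈ T, ∀ y ∈ T, x ≠ y → (c + 1) * σ ^ (2 - p) < ‖Z (x - y)‖ ^ 2) →
      Real.log T.card ≤
        3200 * κ ^ 2 * c * (c + 1) / (1 - 2 ^ (-p)) * (σ ^ (-p) * F * r) := by
    intro σ hσ hle T hTp hsep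
    have hcard : T.card ≤ 1 := by
      refine Finset.card_le_one.2 fun x hx y hy => ?_
      by_contra hxy
      have h1 := hsep x hx y hy hxy
      have h2 := G.norm_sq_le_of_weightedPow_le hp hp2 hlam.1 Z u hA hF0 hF (hround (x - y))
        (by linarith) (hTp x hx y hy) hle
      have h3 : 0 < σ ^ (2 - p) := by positivity
      linarith
    refine (Real.log_nonpos (Nat.cast_nonneg _) (by exact_mod_cast hcard)).trans ?_
    positivity
  induction N generalizing σ T with
  | zero =>
    rw [pow_zero, one_mul] at hN
    exact base σ hσ hN T hTp hsep
  | succ N ih =>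
    rcases le_or_gt ((c * F) ^ (1 / p)) σ with hle | hlt
    · exact base σ hσ hle T hTp hsep
    set C := 3200 * κ ^ 2 * c * (c + 1) with hC
    have hC0 : 0 < C := by positivity
    -- Points far apart at scale `2σ` are counted by induction, clusters at that scale by
    -- `log_card_cluster_le`. Since `2^{-p} C/(1 - 2^{-p}) + C = C/(1 - 2^{-p})`, the number of
    -- steps does not enter the bound.
    have h := log_card_le_of_clusters T
      (fun x y => (c + 1) * (2 * σ) ^ (2 - p) < ‖Z (x - y)‖ ^ 2)
      (X := C / (1 - 2 ^ (-p)) * ((2 * σ) ^ (-p) * F * r)) (Y := C * (σ ^ (-p) * F * r))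
      (fun x => by rw [sub_self, map_zero, norm_zero, not_lt, zero_pow two_ne_zero]; positivity)
      (fun x y hxy => by rw [← norm_neg, ← map_neg, neg_sub]; exact hxy)
      (by positivity) (by positivity)
      (fun T' hT' hfar => ih (by positivity) T' (fun x hx y hy => hTp x (hT' hx) y (hT' hy)) hfar
        (by rw [pow_succ] at hN; linarith))
      (fun T' hT' y hy hclose => G.log_card_cluster_le hp hp2 hlam hG hκ Z u hA hF0 hF hround hr hrq
        hFr hc hσ hlt T' (Z y) (fun x hx y hy => hTp x (hT' hx) y (hT' hy))
        (fun x hx => by rw [← map_sub]; exact not_lt.1 (hclose x hx))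
        (fun x hx y hy hxy => hsep x (hT' hx) y (hT' hy) hxy))
    refine h.trans (le_of_eq ?_)
    rw [Real.mul_rpow (by norm_num) hσ.le]
    field_simp
    ring

end BlockData

end

/-! ### The covering bounds. -/

noncomputable section

/-- A constant for the weak triangle inequality of all block norms. -/
def quasiConst (p : ℝ) : ℝ := 4 * 2 ^ (1 / p)

/-- A constant for packings of `B_p`. -/
def packingConst (p : ℝ) : ℝ :=
  1600 * quasiConst p ^ 2 +
    (3200 * quasiConst p ^ 2 * (2 * quasiConst p ^ p) * (2 * quasiConst p ^ p + 1) /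
      (1 - 2 ^ (-p)) + 800 * quasiConst p ^ 2 * (2 * quasiConst p ^ p + 1))

theorem one_le_quasiConst {p : ℝ} (hp : 0 < p) : 1 ≤ quasiConst p := by
  have : (1 : ℝ) ≤ 2 ^ (1 / p) := Real.one_le_rpow (by norm_num) (by positivity)
  unfold quasiConst; linarith

namespace BlockData

variable {k n m : ℕ} (G : BlockData k n m)

theorem one_le_pStar : 1 ≤ G.pStar := le_max_left _ _

theorem min_le_pStar (i : Fin m) : min (G.q i) (Real.logb 2 (G.block i).card) ≤ G.pStar :=
  (le_ciSup (f := fun i => min (G.q i) (Real.logb 2 (G.block i).card))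
    (Set.finite_range _).bddAbove i).trans (le_max_right _ _)

variable {G} in
-- For `q_i ≥ 2` the constant `2 · 2^{1/q_i}` is at most `4`. Small exponents occur only for
-- singleton groups, whose norm is an absolute value with constant `2`. Hence a constant that
-- depends on `p` alone.
theorem GroupRegime.quasiTriangle {p : ℝ} (h : G.GroupRegime p) (hp : 0 < p) :
    G.QuasiTriangle (quasiConst p) := by
  intro i y z
  have h1 : (1 : ℝ) ≤ 2 ^ (1 / p) := Real.one_le_rpow (by norm_num) (by positivity)
  have hM : 0 ≤ max (lqNorm (G.block i) (G.q i) y) (lqNorm (G.block i) (G.q i) z) :=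
    (lqNorm_nonneg y).trans (le_max_left _ _)
  have h2 : 2 ≤ G.q i → lqNorm (G.block i) (G.q i) (y + z) ≤ quasiConst p *
      max (lqNorm (G.block i) (G.q i) y) (lqNorm (G.block i) (G.q i) z) := fun hq => by
    refine (lqNorm_add_le (G.q_pos i) y z).trans ?_
    gcongr
    have : (2 : ℝ) ^ (1 / G.q i) ≤ 2 ^ (1 : ℝ) := by
      gcongr
      · norm_num
      · rw [div_le_one (G.q_pos i)]; linarith
    rw [Real.rpow_one] at this
    unfold quasiConst
    linarith
  rcases h with h | h | h
  · refine (lqNorm_add_le_of_card_eq_one (G.q_pos i) (h.2 i) y z).trans ?_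
    gcongr
    unfold quasiConst
    linarith
  · exact h2 (h.2 i)
  · exact h2 (h.2 i).ge

variable {G} in
theorem RowRegime.quasiTriangle {p : ℝ} (h : G.RowRegime p) :
    G.QuasiTriangle (quasiConst p) := by
  intro i y z
  have hM : 0 ≤ max (lqNorm (G.block i) (G.q i) y) (lqNorm (G.block i) (G.q i) z) :=
    (lqNorm_nonneg y).trans (le_max_left _ _)
  refine (lqNorm_add_le (G.q_pos i) y z).trans ?_
  gcongr
  rw [h.2 i, quasiConst]
  gcongr
  norm_num

theorem rowwise_block {p : ℝ} (hp : 0 < p) (j : Fin k) : (G.rowwise p hp).block j = {j} := by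
  ext j'
  rw [mem_block, Finset.mem_singleton]
  rfl

theorem rowwise_quasiTriangle {p : ℝ} (hp : 0 < p) :
    (G.rowwise p hp).QuasiTriangle (quasiConst p) := by
  intro j y z
  have hM : 0 ≤ max (lqNorm ((G.rowwise p hp).block j) p y)
    (lqNorm ((G.rowwise p hp).block j) p z) := (lqNorm_nonneg y).trans (le_max_left _ _)
  refine (lqNorm_add_le hp y z).trans ?_
  change _ ≤ quasiConst p * max (lqNorm ((G.rowwise p hp).block j) p y)
    (lqNorm ((G.rowwise p hp).block j) p z)
  gcongr
  rw [quasiConst]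
  gcongr
  norm_num

theorem sum_block (f : Fin k → ℝ) : ∑ i, ∑ j ∈ G.block i, f j = ∑ j, f j :=
  Finset.sum_fiberwise _ _ _

theorem lqNorm_rowwise {p : ℝ} (hp : 0 < p) (j : Fin k) (y : Fin k → ℝ) :
    lqNorm ((G.rowwise p hp).block j) ((G.rowwise p hp).q j) y = |y j| := by
  rw [rowwise_block]
  exact lqNorm_singleton hp j y

/-- With all exponents equal to `p`, both bodies are given by `∑_j |(A x)_j|^p`, whatever the
grouping; so a measure on the rows can serve the grouped problem. -/
theorem rowwise_unitBall {p : ℝ} (hp : 0 < p) (hq : ∀ i, G.q i = p) :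
    (G.rowwise p hp).unitBall p = G.unitBall p := by
  have h : ∀ y, (G.rowwise p hp).gnorm p y = G.gnorm p y := by
    intro y
    rw [gnorm, gnorm]
    congr 1
    simp_rw [lqNorm_rowwise, hq, lqNorm_rpow_self hp]
    exact (G.sum_block _).symm
  ext x
  change (G.rowwise p hp).gnorm p (G.A *ᵥ x) ≤ 1 ↔ _
  rw [h]; rfl

/-- Each `α_i^p` is at most `λ_i F^{p/2}`, and `λ` has total mass one. -/
theorem sum_lqNorm_norm_le {E : Type*} [NormedAddCommGroup E] {p F : ℝ} (hp : 0 < p) (hF0 : 0 < F) {lam : Fin m → ℝ}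
    (hlam : IsProbVec lam) (u : Fin k → E)
    (hF : ∀ i, lam i ^ (-(1 / p)) * lqNorm (G.block i) (G.q i) (fun j => ‖u j‖) ≤ √F)
    (hz : ∀ j, lam (G.grp j) = 0 → u j = 0) :
    ∑ i, lqNorm (G.block i) (G.q i) (fun j => ‖u j‖) ^ p ≤ F ^ (p / 2) := by
  calc _ ≤ ∑ i, lam i * F ^ (p / 2) := by
        refine Finset.sum_le_sum fun i _ => ?_
        have hN := lqNorm_nonneg (s := G.block i) (q := G.q i) (fun j => ‖u j‖)
        rcases (hlam.1 i).eq_or_lt with h0 | h0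
        · rw [lqNorm_eq_zero_of_forall (G.q_pos i), Real.zero_rpow hp.ne', ← h0, zero_mul]
          intro j hj
          rw [hz j (by rw [G.mem_block.1 hj, ← h0]), norm_zero]
        · have h1 := Real.rpow_le_rpow (by positivity) (hF i) hp.le
          rw [Real.mul_rpow (by positivity) hN, ← Real.rpow_mul h0.le, neg_mul,
            one_div_mul_cancel hp.ne', Real.rpow_neg_one, inv_mul_le_iff₀ h0,
            Real.sqrt_eq_rpow, ← Real.rpow_mul hF0.le, show 1 / 2 * p = p / 2 by ring] at h1
          exact h1
    _ = _ := by rw [← Finset.sum_mul, hlam.2, one_mul]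

/-- Packing bounds at the exponents `r` allowed by `p⋆`, `|S|` and `F` give the covering bound. -/
theorem coveringBound_of_packing {p F C : ℝ} (hF : 0 < F) (hC : 0 ≤ C) (aPow : Fin m → ℝ)
    (h : ∀ (S : Finset (Fin m)) (ρ : Fin m → ℝ) (H η r : ℝ), IsProbVec ρ → 1 ≤ H →
      (∀ i, aPow i / ∑ l, aPow l ≤ H * ρ i) → 0 < η → 2 ≤ r →
      (∀ i, G.q i ≤ r ∨ Real.logb 2 (G.block i).card ≤ r) → (S.card : ℝ) ≤ 2 ^ r → F ≤ 2 ^ r →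
      ∀ T : Finset (Fin n → ℝ), (∀ x ∈ T, x ∈ G.unitBall p) →
        (∀ x ∈ T, ∀ y ∈ T, x ≠ y → x - y ∉ η • G.samplingBody p S ρ) →
        Real.log T.card ≤ C * (η ^ (-(min 2 p)) * H ^ (2 / max p 2) * F * r)) :
    G.CoveringBound (4 * C) p F aPow := by
  intro S ρ H η hρ hH hcond hη
  set M := max 2 (max (S.card : ℝ) F) with hM
  set L := Real.logb 2 M with hL
  have hM2 : 2 ≤ M := le_max_left _ _
  have hM0 : 0 < M := by linarith
  have h2L : (2 : ℝ) ^ L = M := Real.rpow_logb (by norm_num) (by norm_num) hM0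
  have hL1 : 1 ≤ L := by
    rw [hL, Real.le_logb_iff_rpow_le (by norm_num) hM0, Real.rpow_one]; exact hM2
  have hP1 := G.one_le_pStar
  -- This `r` meets all demands on the moment exponent at once, and `r ≤ 2 p⋆ L` because both
  -- summands are at least `1`. The other factor `2` in `4 * C` is `1 / log 2 < 2`, from natural to
  -- binary logarithms.
  set r := G.pStar + L with hr
  have hMr : M ≤ 2 ^ r := by
    rw [← h2L]; gcongr
    · norm_num
    · linarith
  have hrq : ∀ i, G.q i ≤ r ∨ Real.logb 2 (G.block i).card ≤ r := by
    intro i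
    have := G.min_le_pStar i
    rcases min_choice (G.q i) (Real.logb 2 (G.block i).card) with h | h <;> rw [h] at this
    · left; linarith
    · right; linarith
  have hH0 : 0 < H := by linarith
  obtain ⟨N, hN, hlog⟩ := exists_coveringNumber_eq (X := G.unitBall p)
    (Y := η • G.samplingBody p S ρ)
    ((G.mem_smul_samplingBody hη S ρ 0).2 (by
      have := G.samplingNorm_smul p S ρ le_rfl 0
      rw [zero_smul, zero_mul] at this
      rw [this]; exact hη.le))
    (fun y hy => by
      rw [mem_smul_samplingBody _ hη] at hy ⊢
      rwa [samplingNorm_neg])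
    (L := C * (η ^ (-(min 2 p)) * H ^ (2 / max p 2) * F * r)) (by
      have : 0 ≤ r := by linarith
      positivity)
    (h S ρ H η r hρ hH hcond hη (by linarith) hrq
      (((le_max_left _ _).trans (le_max_right _ _)).trans hMr)
      (((le_max_right _ _).trans (le_max_right _ _)).trans hMr))
  refine ⟨N, hN, ?_⟩
  have hl2 : 1 / 2 < Real.log 2 := by have := Real.log_two_gt_d9; linarith
  rw [Real.logb, div_le_iff₀ (by linarith)]
  refine hlog.trans ?_
  have hr2 : r ≤ 2 * (G.pStar * L) := by nlinarith
  set W := η ^ (-(min 2 p)) * H ^ (2 / max p 2) * F with hW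
  have hW0 : 0 ≤ W := by positivity
  calc C * (W * r) ≤ C * (W * (2 * (G.pStar * L))) := by gcongr
    _ = 4 * C * W * (G.pStar * L) * (1 / 2) := by ring
    _ ≤ 4 * C * W * (G.pStar * L) * Real.log 2 := by
        gcongr
    _ = _ := by rw [hW]; ring

variable {E : Type*} [NormedAddCommGroup E] [InnerProductSpace ℝ E] [FiniteDimensional ℝ E]
  [MeasurableSpace E] [BorelSpace E]

/-- The packing bound for `p ≥ 2`. -/
theorem log_card_le_of_two_le {p : ℝ} (hp2 : 2 ≤ p) {κ : ℝ} (hG : G.QuasiTriangle κ)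
    (hκ : 1 ≤ κ) {lam : Fin m → ℝ} (hlam : IsProbVec lam) (Z : (Fin n → ℝ) →ₗ[ℝ] E)
    (u : Fin k → E) (hA : ∀ x j, (G.A *ᵥ x) j = inner ℝ (u j) (Z x))
    (hround : ∀ x, ‖Z x‖ ^ 2 ≤ G.weightedPow p lam 2 x)
    {S : Finset (Fin m)} {ρ : Fin m → ℝ} {H F η r : ℝ} (hρ0 : ∀ i, 0 ≤ ρ i) (hH : 0 < H)
    (hF : 0 < F) (hη : 0 < η)
    (hρ : ∀ i, lqNorm (G.block i) (G.q i) (fun j => ‖u j‖) ^ p /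
      ∑ l, lqNorm (G.block l) (G.q l) (fun j => ‖u j‖) ^ p ≤ H * ρ i)
    (hα : ∑ l, lqNorm (G.block l) (G.q l) (fun j => ‖u j‖) ^ p ≤ F ^ (p / 2))
    (hr : 1 ≤ r) (hrq : ∀ i, G.q i ≤ r ∨ Real.logb 2 (G.block i).card ≤ r)
    (hS : (S.card : ℝ) ≤ 2 ^ r) (T : Finset (Fin n → ℝ)) (hT : ∀ x ∈ T, x ∈ G.unitBall p)
    (hsep : ∀ x ∈ T, ∀ y ∈ T, x ≠ y → x - y ∉ η • G.samplingBody p S ρ) :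
    Real.log T.card ≤ 1600 * κ ^ 2 * (η ^ (-(min 2 p)) * H ^ (2 / max p 2) * F * r) := by
  have hp : 0 < p := by linarith
  -- The constant `1600 = 200 · 2² · (√2)²` collects the loss `2` for the maximum over `S` and the
  -- radius `√2`.
  have h := G.log_card_le_of_sampling hG hκ hp Z u hA hρ0 hH hF hη (R := √2) (by positivity) hρ hα
    hr hrq hS T 0 (fun x hx => by
      rw [sub_zero]
      exact Real.le_sqrt_of_sq_le
        ((hround x).trans (G.weightedPow_two_le_of_ge hp2 hlam (hT x hx)))) hsep
  refine h.trans (le_of_eq ?_)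
  rw [min_eq_left hp2, max_eq_left hp2, div_pow, mul_pow, mul_pow, mul_pow,
    Real.sq_sqrt hF.le, Real.sq_sqrt zero_le_two, ← Real.rpow_two (H ^ (1 / p)),
    ← Real.rpow_mul hH.le, Real.rpow_neg hη.le, Real.rpow_two,
    show 1 / p * 2 = 2 / p by ring]
  field_simp
  norm_num

/-- The packing bound for `p < 2`; the measure may live on a partition of the rows other than the
one that defines the sampling body. -/
theorem log_card_le_of_lt_two {m₀ : ℕ} (G₀ : BlockData k n m₀) (hGA : G₀.A = G.A) {p : ℝ}
    (hp : 0 < p) (hp2 : p < 2) (hball : G₀.unitBall p = G.unitBall p) {κ : ℝ}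
    (hG₀ : G₀.QuasiTriangle κ) (hG : G.QuasiTriangle κ)
    (hκ : 1 ≤ κ) {lam : Fin m₀ → ℝ} (hlam : IsProbVec lam) (Z : (Fin n → ℝ) →ₗ[ℝ] E)
    (u : Fin k → E) (hA : ∀ x j, (G₀.A *ᵥ x) j = inner ℝ (u j) (Z x))
    (hround : ∀ x, ‖Z x‖ ^ 2 ≤ G₀.weightedPow p lam 2 x)
    {S : Finset (Fin m)} {ρ : Fin m → ℝ} {H F η r : ℝ} (hρ0 : ∀ i, 0 ≤ ρ i) (hH : 0 < H)
    (hF0 : 0 < F) (hη : 0 < η)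
    (hF : ∀ i, lam i ^ (-(1 / p)) * lqNorm (G₀.block i) (G₀.q i) (fun j => ‖u j‖) ≤ √F)
    (hρ : ∀ i, lqNorm (G.block i) (G.q i) (fun j => ‖u j‖) ^ p /
      ∑ l, lqNorm (G.block l) (G.q l) (fun j => ‖u j‖) ^ p ≤ H * ρ i)
    (hα : ∑ l, lqNorm (G.block l) (G.q l) (fun j => ‖u j‖) ^ p ≤ F ^ (p / 2))
    (hr : 2 ≤ r) (hrq₀ : ∀ i, G₀.q i ≤ r ∨ Real.logb 2 (G₀.block i).card ≤ r)
    (hrq : ∀ i, G.q i ≤ r ∨ Real.logb 2 (G.block i).card ≤ r)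
    (hS : (S.card : ℝ) ≤ 2 ^ r) (hFr : F ≤ 2 ^ r)
    (T : Finset (Fin n → ℝ)) (hT : ∀ x ∈ T, x ∈ G.unitBall p)
    (hsep : ∀ x ∈ T, ∀ y ∈ T, x ≠ y → x - y ∉ η • G.samplingBody p S ρ) :
    Real.log T.card ≤ (3200 * κ ^ 2 * (2 * κ ^ p) * (2 * κ ^ p + 1) / (1 - 2 ^ (-p)) +
      800 * κ ^ 2 * (2 * κ ^ p + 1)) * (η ^ (-(min 2 p)) * H ^ (2 / max p 2) * F * r) := by
  have h2p : (2 : ℝ) ^ (-p) < 1 := Real.rpow_lt_one_of_one_lt_of_neg (by norm_num) (by linarith)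
  have h2p' : 0 < 1 - (2 : ℝ) ^ (-p) := by linarith
  have hr0 : 0 < r := by linarith
  have hc : 1 ≤ 2 * κ ^ p := by have := Real.one_le_rpow hκ hp.le; linarith
  have hκ0 : 0 < κ := by linarith
  set c := 2 * κ ^ p with hcdef
  -- This scale balances the two counts: clusters of `B_p` cost `σ^{-p} F r`, and separation by the
  -- sampling body inside a cluster costs `H^{2/p} F r σ^{2-p} / η²`. Both become `η^{-p} H F r`.
  set σ := η * H ^ (-(1 / p)) with hσdef
  have hσ : 0 < σ := by positivity
  set W := η ^ (-p) * H * F * r with hW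
  have hW0 : 0 < W := by positivity
  have hTp : ∀ x ∈ T, ∀ y ∈ T, G₀.weightedPow p lam p (x - y) ≤ c := fun x hx y hy =>
    G₀.weightedPow_sub_le hp hlam.1 hG₀ hκ0.le (by rw [hball]; exact hT x hx)
      (by rw [hball]; exact hT y hy)
  have hσp : σ ^ (-p) = η ^ (-p) * H := by
    rw [hσdef, Real.mul_rpow hη.le (by positivity), ← Real.rpow_mul hH.le,
      show -(1 / p) * -p = 1 by field_simp, Real.rpow_one]
  have h := log_card_le_of_clusters T
    (fun x y => (c + 1) * σ ^ (2 - p) < ‖Z (x - y)‖ ^ 2)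
    (X := 3200 * κ ^ 2 * c * (c + 1) / (1 - 2 ^ (-p)) * W) (Y := 800 * κ ^ 2 * (c + 1) * W)
    (fun x => by rw [sub_self, map_zero, norm_zero, not_lt, zero_pow two_ne_zero]; positivity)
    (fun x y hxy => by rw [← norm_neg, ← map_neg, neg_sub]; exact hxy)
    (by positivity) (by positivity)
    (fun T' hT' hfar => by
      have := G₀.log_card_le_of_unitBall hp hp2 hlam hG₀ hκ Z u hA hF0 hF hround hr hrq₀ hFr hc hσ
        T' (fun x hx y hy => hTp x (hT' hx) y (hT' hy)) hfar
      rwa [hσp] at this)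
    (fun T' hT' y hy hclose => by
      have := G.log_card_le_of_sampling hG hκ hp Z u (by rw [← hGA]; exact hA) hρ0 hH hF0 hη
        (R := √((c + 1) * σ ^ (2 - p))) (by positivity) hρ hα (by linarith) hrq hS T' (Z y)
        (fun x hx => by
          rw [← map_sub]
          exact Real.le_sqrt_of_sq_le (not_lt.1 (hclose x hx)))
        (fun x hx y hy hxy => hsep x (hT' hx) y (hT' hy) hxy)
      refine this.trans (le_of_eq ?_)
      rw [div_pow, mul_pow, mul_pow, mul_pow, Real.sq_sqrt hF0.le, Real.sq_sqrt (by positivity),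
        ← Real.rpow_two (H ^ (1 / p)), ← Real.rpow_mul hH.le, hW]
      have e1 : σ ^ (2 - p) = η ^ 2 * η ^ (-p) * H ^ (-(1 / p * 2)) * H := by
        rw [sub_eq_add_neg, Real.rpow_add hσ, hσp, hσdef, Real.rpow_two, mul_pow,
          ← Real.rpow_two (H ^ _), ← Real.rpow_mul hH.le, neg_mul]
        ring
      rw [e1, Real.rpow_neg hH.le (1 / p * 2)]
      have : 0 < H ^ (1 / p * 2) := by positivity
      field_simp
      norm_num)
  refine h.trans (le_of_eq ?_)
  rw [min_eq_right hp2.le, max_eq_right hp2.le, div_self two_ne_zero, Real.rpow_one, hW]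
  ring

theorem packingConst_pos {p : ℝ} (hp : 0 < p) : 0 < packingConst p := by
  have h2p : (2 : ℝ) ^ (-p) < 1 := Real.rpow_lt_one_of_one_lt_of_neg (by norm_num) (by linarith)
  have h2p' : 0 < 1 - (2 : ℝ) ^ (-p) := by linarith
  have := one_le_quasiConst hp
  have h0 : 0 < quasiConst p := by linarith
  unfold packingConst
  positivity

variable {G}

theorem IsBlockLewisOverestimate.coveringBound {p F : ℝ} (hp : 0 < p) (hreg : G.GroupRegime p)
    {lam : Fin m → ℝ} {w : Fin k → ℝ} (h : G.IsBlockLewisOverestimate p F lam w) :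
    G.CoveringBound (4 * packingConst p) p F (G.alphaPow p lam w) := by
  obtain ⟨Z, u, hA, hround, hα, hF, hz⟩ := h.exists_embedding hp
  have hlam := h.measure.1
  have hF0 := h.pos
  have hG := hreg.quasiTriangle hp
  have hκ := one_le_quasiConst hp
  have h2p : (2 : ℝ) ^ (-p) < 1 := Real.rpow_lt_one_of_one_lt_of_neg (by norm_num) (by linarith)
  have h2p' : 0 < 1 - (2 : ℝ) ^ (-p) := by linarith
  have hround' : ∀ x, ‖Z x‖ ^ 2 ≤ G.weightedPow p lam 2 x := fun x => by
    simpa only [weightedPow, Real.rpow_two] using hround x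
  have hsum := G.sum_lqNorm_norm_le hp hF0 hlam u hF hz
  refine G.coveringBound_of_packing hF0 (packingConst_pos hp).le _ ?_
  intro S ρ H η r hρ hH hcond hη hr hrq hS hFr T hT hsep
  have hH0 : 0 < H := by linarith
  have hr0 : 0 < r := by linarith
  have hκ0 : 0 < quasiConst p := by linarith
  simp_rw [← hα] at hcond
  rcases le_or_gt 2 p with hp2 | hp2
  · refine (G.log_card_le_of_two_le hp2 hG hκ hlam Z u hA hround' hρ.1 hH0 hF0 hη hcond
      hsum (by linarith) hrq hS T hT hsep).trans ?_
    refine mul_le_mul_of_nonneg_right ?_ (by positivity)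
    unfold packingConst
    exact le_add_of_nonneg_right (by positivity)
  · refine (G.log_card_le_of_lt_two G rfl hp hp2 rfl hG hG hκ hlam Z u hA hround' hρ.1 hH0 hF0 hη
      hF hcond hsum hr hrq hrq hS hFr T hT hsep).trans ?_
    refine mul_le_mul_of_nonneg_right ?_ (by positivity)
    unfold packingConst
    exact le_add_of_nonneg_left (by positivity)

/-- The Euclidean structure comes from the partition into rows, the sampling body from the groups.
They fit because, for `q_i = p`, the block norm of the lengths `‖u_j‖` has as `p`-th power the sum
of the row importances. -/
theorem IsBlockLewisOverestimate.coveringBound_rowwise {p F : ℝ} (hp : 0 < p)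
    (hreg : G.RowRegime p) {lam : Fin k → ℝ} {w : Fin k → ℝ}
    (h : (G.rowwise p hp).IsBlockLewisOverestimate p F lam w) :
    G.CoveringBound (4 * packingConst p) p F (G.alphaPowHat p hp lam w) := by
  obtain ⟨Z, u, hA, hround, hα, hF, hz⟩ := h.exists_embedding hp
  have hlam := h.measure.1
  have hF0 := h.pos
  have hκ := one_le_quasiConst hp
  have h2p : (2 : ℝ) ^ (-p) < 1 := Real.rpow_lt_one_of_one_lt_of_neg (by norm_num) (by linarith)
  have h2p' : 0 < 1 - (2 : ℝ) ^ (-p) := by linarith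
  have hround' : ∀ x, ‖Z x‖ ^ 2 ≤ (G.rowwise p hp).weightedPow p lam 2 x := fun x => by
    simpa only [weightedPow, Real.rpow_two] using hround x
  have hblock : ∀ i, G.alphaPowHat p hp lam w i =
      lqNorm (G.block i) (G.q i) (fun j => ‖u j‖) ^ p := fun i => by
    rw [hreg.2 i, lqNorm_rpow_self hp, alphaPowHat]
    refine Finset.sum_congr rfl fun j _ => ?_
    rw [← hα, lqNorm_rowwise]
  have hsum : ∑ i, lqNorm (G.block i) (G.q i) (fun j => ‖u j‖) ^ p ≤ F ^ (p / 2) := by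
    have h1 := (G.rowwise p hp).sum_lqNorm_norm_le hp hF0 hlam u hF hz
    simp_rw [lqNorm_rowwise] at h1
    simp_rw [hreg.2, lqNorm_rpow_self hp]
    rwa [G.sum_block]
  refine G.coveringBound_of_packing hF0 (packingConst_pos hp).le _ ?_
  intro S ρ H η r hρ hH hcond hη hr hrq hS hFr T hT hsep
  have hH0 : 0 < H := by linarith
  have hr0 : 0 < r := by linarith
  have hκ0 : 0 < quasiConst p := by linarith
  simp_rw [hblock] at hcond
  refine (G.log_card_le_of_lt_two (G.rowwise p hp) rfl hp hreg.1 (G.rowwise_unitBall hp hreg.2)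
    (G.rowwise_quasiTriangle hp) hreg.quasiTriangle hκ hlam Z u hA hround' hρ.1 hH0 hF0 hη
    hF hcond hsum hr (fun i => Or.inl (show p ≤ r by linarith [hreg.1])) hrq hS hFr T hT
    hsep).trans ?_
  refine mul_le_mul_of_nonneg_right ?_ (by positivity)
  unfold packingConst
  exact le_add_of_nonneg_left (by positivity)

end BlockData

end

/-! ### Lewis' position: maximizing the determinant. -/

noncomputable section

section Deriv

variable {E : Type*} [NormedAddCommGroup E] [InnerProductSpace ℝ E]

/-- The curve is the motion of a row `u` under the rank-one change `1 + s v vᵀ`. Written as a power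
`q/2 ≥ 1` of the squared norm, it is differentiable even for `u = 0`. -/
theorem hasDerivAt_norm_add_smul_rpow (u v : E) {q : ℝ} (hq : 2 ≤ q) :
    HasDerivAt (fun s : ℝ => ‖u + (s * inner ℝ u v) • v‖ ^ q)
      (q * (‖u‖ ^ (q - 2) * (inner ℝ u v) ^ 2)) 0 := by
  have e : (fun s : ℝ => ‖u + (s * inner ℝ u v) • v‖ ^ q) = fun s : ℝ =>
      (‖u‖ ^ 2 + (2 * s + s ^ 2 * ‖v‖ ^ 2) * (inner ℝ u v) ^ 2) ^ (q / 2) := by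
    ext s
    have : ‖u + (s * inner ℝ u v) • v‖ ^ 2 =
        ‖u‖ ^ 2 + (2 * s + s ^ 2 * ‖v‖ ^ 2) * (inner ℝ u v) ^ 2 := by
      rw [norm_add_sq_real, real_inner_smul_right, norm_smul, Real.norm_eq_abs, mul_pow, sq_abs]
      ring
    rw [← this, ← Real.rpow_two, ← Real.rpow_mul (norm_nonneg _), mul_div_cancel₀ _ two_ne_zero]
  rw [e]
  have h1 : HasDerivAt (fun s : ℝ => ‖u‖ ^ 2 + (2 * s + s ^ 2 * ‖v‖ ^ 2) * (inner ℝ u v) ^ 2)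
      (2 * (inner ℝ u v) ^ 2) 0 := by
    have h2 : HasDerivAt (fun s : ℝ => 2 * s + s ^ 2 * ‖v‖ ^ 2) 2 0 := by
      have := ((hasDerivAt_id (0 : ℝ)).const_mul 2).fun_add
        (((hasDerivAt_id (0 : ℝ)).pow 2).mul_const (‖v‖ ^ 2))
      simpa using this
    exact (h2.mul_const _).const_add _
  convert h1.rpow_const (p := q / 2) (Or.inr (by linarith)) using 1
  have : (‖u‖ ^ 2 + (2 * 0 + 0 ^ 2 * ‖v‖ ^ 2) * (inner ℝ u v) ^ 2) ^ (q / 2 - 1) =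
      ‖u‖ ^ (q - 2) := by
    rw [show ‖u‖ ^ 2 + (2 * 0 + 0 ^ 2 * ‖v‖ ^ 2) * (inner ℝ u v) ^ 2 = ‖u‖ ^ (2 : ℝ) by
      rw [Real.rpow_two]; ring, ← Real.rpow_mul (norm_nonneg _)]
    congr 1; ring
  rw [this]; ring

theorem hasDerivAt_lqNorm_rpow {k : ℕ} (t : Finset (Fin k)) (u : Fin k → E) (v : E) {q : ℝ}
    (hq : 2 ≤ q) {p : ℝ} (hp : 0 < p) :
    HasDerivAt (fun s : ℝ => lqNorm t q (fun j => ‖u j + (s * inner ℝ (u j) v) • v‖) ^ p)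
      (p * (lqNorm t q (fun j => ‖u j‖) ^ (p - q) *
        ∑ j ∈ t, ‖u j‖ ^ (q - 2) * (inner ℝ (u j) v) ^ 2)) 0 := by
  have hq0 : 0 < q := by linarith
  set α := lqNorm t q (fun j => ‖u j‖) with hα
  have hαq : α ^ q = ∑ j ∈ t, ‖u j‖ ^ q := by rw [hα, lqNorm_rpow_self hq0]; simp
  -- A block of size zero stays zero along the curve, so the outer power is never differentiated at
  -- `0`.
  rcases (lqNorm_nonneg (s := t) (q := q) fun j => ‖u j‖).eq_or_lt with h0 | h0
  · rw [← hα] at h0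
    have hu : ∀ j ∈ t, u j = 0 := fun j hj => by
      rw [← h0, Real.zero_rpow hq0.ne'] at hαq
      have := (Finset.sum_eq_zero_iff_of_nonneg fun j _ => by positivity).1 hαq.symm j hj
      exact norm_eq_zero.1 ((Real.rpow_eq_zero (norm_nonneg _) hq0.ne').1 this)
    have e1 : ∑ j ∈ t, ‖u j‖ ^ (q - 2) * (inner ℝ (u j) v) ^ 2 = 0 :=
      Finset.sum_eq_zero fun j hj => by simp [hu j hj]
    have e2 : (fun s : ℝ => lqNorm t q (fun j => ‖u j + (s * inner ℝ (u j) v) • v‖) ^ p) =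
        fun _ => 0 := by
      ext s
      rw [lqNorm_eq_zero_of_forall hq0, Real.zero_rpow hp.ne']
      intro j hj
      simp [hu j hj]
    rw [e1, e2, mul_zero, mul_zero]
    exact hasDerivAt_const _ _
  · rw [← hα] at h0
    have e : (fun s : ℝ => lqNorm t q (fun j => ‖u j + (s * inner ℝ (u j) v) • v‖) ^ p) =
        fun s : ℝ => (∑ j ∈ t, ‖u j + (s * inner ℝ (u j) v) • v‖ ^ q) ^ (p / q) := by
      ext s
      rw [lqNorm_rpow]; simp
    have h1 : HasDerivAt (fun s : ℝ => ∑ j ∈ t, ‖u j + (s * inner ℝ (u j) v) • v‖ ^ q)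
        (∑ j ∈ t, q * (‖u j‖ ^ (q - 2) * (inner ℝ (u j) v) ^ 2)) 0 :=
      HasDerivAt.fun_sum fun j _ => hasDerivAt_norm_add_smul_rpow (u j) v hq
    have e0 : ∑ j ∈ t, ‖u j + ((0 : ℝ) * inner ℝ (u j) v) • v‖ ^ q = α ^ q := by
      rw [hαq]; simp
    rw [e]
    convert h1.rpow_const (p := p / q) (Or.inl (by rw [e0]; positivity)) using 1
    rw [e0, ← Real.rpow_mul h0.le, ← Finset.mul_sum,
      show q * (p / q - 1) = p - q by field_simp]
    field_simp

end Deriv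

namespace BlockData

variable {k n m : ℕ} (G : BlockData k n m)

/-- `∑_i (∑_{j ∈ S_i} ‖v_j‖^{q_i})^{p/q_i}` for the rows `v_j` of a matrix. -/
def blockSize {d : ℕ} (p : ℝ) (V : Matrix (Fin k) (Fin d) ℝ) : ℝ :=
  ∑ i, lqNorm (G.block i) (G.q i) (fun j => ‖WithLp.toLp 2 (V j)‖) ^ p

variable {d : ℕ} {p : ℝ}

theorem blockSize_nonneg (V : Matrix (Fin k) (Fin d) ℝ) : 0 ≤ G.blockSize p V :=
  Finset.sum_nonneg fun _ _ => Real.rpow_nonneg (lqNorm_nonneg _) p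

theorem blockSize_smul {a : ℝ} (ha : 0 ≤ a) (V : Matrix (Fin k) (Fin d) ℝ) :
    G.blockSize p (a • V) = a ^ p * G.blockSize p V := by
  rw [blockSize, blockSize, Finset.mul_sum]
  refine Finset.sum_congr rfl fun i _ => ?_
  have : (fun j => ‖WithLp.toLp 2 ((a • V) j)‖) = a • fun j => ‖WithLp.toLp 2 (V j)‖ := by
    ext j
    change ‖WithLp.toLp 2 (a • V j)‖ = a * _
    rw [WithLp.toLp_smul, norm_smul, Real.norm_of_nonneg ha]
  rw [this, lqNorm_smul (G.q_pos i), abs_of_nonneg ha, Real.mul_rpow ha (lqNorm_nonneg _)]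

theorem continuous_blockSize (hp : 0 ≤ p) :
    Continuous fun V : Matrix (Fin k) (Fin d) ℝ => G.blockSize p V := by
  unfold blockSize lqNorm
  refine continuous_finsetSum _ fun i _ => (Real.continuous_rpow_const hp).comp
    ((Real.continuous_rpow_const (one_div_nonneg.2 (G.q_pos i).le)).comp
      (continuous_finsetSum _ fun j _ => (Real.continuous_rpow_const (G.q_pos i).le).comp ?_))
  have h1 : Continuous fun V : Matrix (Fin k) (Fin d) ℝ => V j := continuous_apply j
  have h2 : Continuous fun V : Matrix (Fin k) (Fin d) ℝ => WithLp.toLp 2 (V j) :=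
    (PiLp.continuous_toLp 2 _).comp h1
  exact h2.norm.abs

theorem abs_le_one_of_blockSize_le (hp : 0 < p) {V : Matrix (Fin k) (Fin d) ℝ}
    (hV : G.blockSize p V ≤ 1) (j : Fin k) (l : Fin d) : |V j l| ≤ 1 := by
  have hq := G.q_pos (G.grp j)
  have h1 : lqNorm (G.block (G.grp j)) (G.q (G.grp j)) (fun j => ‖WithLp.toLp 2 (V j)‖) ^ p ≤ 1 :=
    (Finset.single_le_sum (f := fun i => lqNorm (G.block i) (G.q i)
      (fun j => ‖WithLp.toLp 2 (V j)‖) ^ p)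
      (fun i _ => Real.rpow_nonneg (lqNorm_nonneg _) p) (Finset.mem_univ (G.grp j))).trans hV
  have h2 : lqNorm (G.block (G.grp j)) (G.q (G.grp j)) (fun j => ‖WithLp.toLp 2 (V j)‖) ≤ 1 := by
    by_contra! hlt
    exact absurd h1 (not_le.2 (Real.one_lt_rpow hlt hp))
  have h3 : |V j l| ≤ lqNorm (G.block (G.grp j)) (G.q (G.grp j))
      (fun j => ‖WithLp.toLp 2 (V j)‖) := by
    have h4 : lqNorm {j} (G.q (G.grp j)) (fun j => ‖WithLp.toLp 2 (V j)‖) ≤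
        lqNorm (G.block (G.grp j)) (G.q (G.grp j)) (fun j => ‖WithLp.toLp 2 (V j)‖) := by
      unfold lqNorm
      refine Real.rpow_le_rpow (Finset.sum_nonneg fun _ _ => by positivity)
        (Finset.sum_le_sum_of_subset_of_nonneg
          (Finset.singleton_subset_iff.2 (G.mem_block.2 rfl)) fun _ _ _ => by positivity)
        (by positivity)
    rw [lqNorm_singleton hq, abs_norm] at h4
    exact (PiLp.norm_apply_le (WithLp.toLp 2 (V j)) l).trans h4
  exact h3.trans h2

/-- The change of position that maximizes the determinant, with its first-order condition. -/
theorem exists_lewis_position (hp : 0 < p) (hq : ∀ i, 2 ≤ G.q i) (hd : 0 < d)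
    (B : Matrix (Fin k) (Fin d) ℝ) (C : Matrix (Fin d) (Fin k) ℝ) (hCB : C * B = 1) :
    ∃ U : Matrix (Fin d) (Fin d) ℝ, IsUnit U.det ∧ G.blockSize p (B * U) = 1 ∧
      ∀ v : EuclideanSpace ℝ (Fin d), ‖v‖ ^ 2 = d * ∑ i,
        (lqNorm (G.block i) (G.q i) (fun j => ‖WithLp.toLp 2 ((B * U) j)‖) ^ (p - G.q i) *
          ∑ j ∈ G.block i, ‖WithLp.toLp 2 ((B * U) j)‖ ^ (G.q i - 2) *
            (inner ℝ (WithLp.toLp 2 ((B * U) j)) v) ^ 2) := by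
  set g : Matrix (Fin d) (Fin d) ℝ → ℝ := fun U => G.blockSize p (B * U) with hg
  have hg0 : ∀ U, 0 ≤ g U := fun U => G.blockSize_nonneg _
  have hgs : ∀ (a : ℝ) (U), 0 ≤ a → g (a • U) = a ^ p * g U := fun a U ha => by
    simp only [hg]
    rw [Matrix.mul_smul, G.blockSize_smul ha]
  have hgc : Continuous g := (G.continuous_blockSize hp.le).comp
    (continuous_const.matrix_mul continuous_id)
  set K : Set (Matrix (Fin d) (Fin d) ℝ) := {U | g U ≤ 1} with hK
  -- The entries of `B * U` are bounded by `1` on `K`, and `C` recovers `U` from `B * U`; so `K` is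
  -- a closed subset of the image of a cube.
  have hKc : IsCompact K := by
    have h1 : IsCompact {V : Matrix (Fin k) (Fin d) ℝ | ∀ j l, V j l ∈ Set.Icc (-1 : ℝ) 1} := by
      have h2 := isCompact_univ_pi (X := fun _ : Fin k => Fin d → ℝ)
        (s := fun _ => Set.univ.pi fun _ : Fin d => Set.Icc (-1 : ℝ) 1)
        fun _ => isCompact_univ_pi fun _ => isCompact_Icc
      change IsCompact (X := Fin k → Fin d → ℝ) {V | ∀ j l, V j l ∈ Set.Icc (-1 : ℝ) 1}
      have e : {V : Fin k → Fin d → ℝ | ∀ j l, V j l ∈ Set.Icc (-1 : ℝ) 1} =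
          Set.univ.pi fun _ : Fin k => Set.univ.pi fun _ : Fin d => Set.Icc (-1 : ℝ) 1 := by
        ext V
        exact ⟨fun h j _ l _ => h j l, fun h j l => h j trivial l trivial⟩
      rw [e]
      exact h2
    refine (h1.image (f := fun V => C * V)
      (continuous_const.matrix_mul continuous_id)).of_isClosed_subset
      (isClosed_le hgc continuous_const) fun U hU => ⟨B * U, fun j l => ?_, ?_⟩
    · exact abs_le.1 (G.abs_le_one_of_blockSize_le hp hU j l)
    · simp only
      rw [← Matrix.mul_assoc, hCB, Matrix.one_mul]
  obtain ⟨U, hUK, hmax⟩ := hKc.exists_isMaxOn (f := fun U => |U.det|)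
    ⟨0, by
      have := hgs 0 0 le_rfl
      rw [smul_zero, Real.zero_rpow hp.ne', zero_mul] at this
      change g 0 ≤ 1
      rw [this]; norm_num⟩
    (continuous_id.matrix_det.abs.continuousOn)
  have hdet : ∀ (a : ℝ) (V : Matrix (Fin d) (Fin d) ℝ), 0 < a → a ^ p * g V ≤ 1 →
      a ^ d * |V.det| ≤ |U.det| := fun a V ha hle => by
    have h1 : a • V ∈ K := by change g (a • V) ≤ 1; rw [hgs a V ha.le]; exact hle
    have h2 : |(a • V).det| ≤ |U.det| := hmax h1
    rwa [Matrix.det_smul, Fintype.card_fin, abs_mul, abs_of_pos (by positivity)] at h2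
  have hU0 : 0 < |U.det| := by
    have hpos : 0 < 1 + g 1 := by have := hg0 1; linarith
    have := hdet ((1 + g 1) ^ (-(1 / p))) 1 (by positivity) (by
      rw [← Real.rpow_mul hpos.le, neg_mul, one_div_mul_cancel hp.ne', Real.rpow_neg_one,
        inv_mul_le_iff₀ hpos]
      linarith)
    rw [Matrix.det_one, abs_one, mul_one] at this
    exact lt_of_lt_of_le (by positivity) this
  have hgU : g U ≤ 1 := hUK
  have hgU0 : 0 < g U := by
    refine lt_of_le_of_ne (hg0 U) fun h => ?_
    have := hdet 2 U two_pos (by rw [← h, mul_zero]; norm_num)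
    have h2 : (2 : ℝ) ≤ 2 ^ d := le_self_pow₀ (by norm_num) hd.ne'
    nlinarith
  -- Homogeneity frees the maximality of `U` from its constraint, so that unnormalized perturbations
  -- can be compared with it.
  have hscale : ∀ V : Matrix (Fin d) (Fin d) ℝ, 0 < g V →
      |V.det| ≤ g V ^ (d / p) * |U.det| := fun V hV => by
    have h1 := hdet (g V ^ (-(1 / p))) V (by positivity) (by
      rw [← Real.rpow_mul hV.le, neg_mul, one_div_mul_cancel hp.ne', Real.rpow_neg_one,
        inv_mul_cancel₀ hV.ne'])
    rw [← Real.rpow_natCast, ← Real.rpow_mul hV.le,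
      show -(1 / p) * (d : ℝ) = -(d / p) by ring, Real.rpow_neg hV.le,
      inv_mul_le_iff₀ (by positivity)] at h1
    exact h1
  have hd' : (0 : ℝ) < d := by exact_mod_cast hd
  have hgU1 : g U = 1 := by
    refine le_antisymm hgU ?_
    have h1 := hscale U hgU0
    have h2 : 1 ≤ g U ^ (d / p) := by
      by_contra! hlt
      nlinarith
    by_contra! hlt
    exact absurd h2 (not_le.2 (Real.rpow_lt_one hgU0.le hlt (by positivity)))
  refine ⟨U, isUnit_iff_ne_zero.2 (abs_pos.1 hU0), hgU1, fun v => ?_⟩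
  set u : Fin k → EuclideanSpace ℝ (Fin d) := fun j => WithLp.toLp 2 ((B * U) j) with hu
  -- The perturbation `U (1 + s v vᵀ)` multiplies the determinant by exactly `1 + s ‖v‖²`.
  set Vs : ℝ → Matrix (Fin d) (Fin d) ℝ := fun s =>
    U * (1 + Matrix.replicateCol Unit (s • v.ofLp) * Matrix.replicateRow Unit v.ofLp) with hVs
  have hrow : ∀ s j, WithLp.toLp 2 ((B * Vs s) j) = u j + (s * inner ℝ (u j) v) • v := by
    intro s j
    ext l
    have h1 : (B * Vs s) j l = (B * U) j l +
        ((B * U) * (Matrix.replicateCol Unit (s • v.ofLp) *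
          Matrix.replicateRow Unit v.ofLp)) j l := by
      simp only [hVs]
      rw [← Matrix.mul_assoc, Matrix.mul_add, Matrix.mul_one, Matrix.add_apply]
    have h2 : ((B * U) * (Matrix.replicateCol Unit (s • v.ofLp) *
          Matrix.replicateRow Unit v.ofLp)) j l = s * inner ℝ (u j) v * v l := by
      rw [Matrix.mul_apply, PiLp.inner_apply, Finset.mul_sum, Finset.sum_mul]
      refine Finset.sum_congr rfl fun a _ => ?_
      simp [hu, Matrix.mul_apply]
      ring
    change (B * Vs s) j l = (B * U) j l + (s * inner ℝ (u j) v) * v l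
    rw [h1, h2]
  have hdets : ∀ s, (Vs s).det = U.det * (1 + s * ‖v‖ ^ 2) := by
    intro s
    simp only [hVs]
    rw [Matrix.det_mul, Matrix.det_one_add_replicateCol_mul_replicateRow, dotProduct_smul,
      EuclideanSpace.real_norm_sq_eq]
    simp [dotProduct, sq]
  set D := ∑ i, p * (lqNorm (G.block i) (G.q i) (fun j => ‖u j‖) ^ (p - G.q i) *
    ∑ j ∈ G.block i, ‖u j‖ ^ (G.q i - 2) * (inner ℝ (u j) v) ^ 2) with hD
  have hderiv : HasDerivAt (fun s => g (Vs s)) D 0 := by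
    have e : (fun s => g (Vs s)) = fun s : ℝ => ∑ i, lqNorm (G.block i) (G.q i)
        (fun j => ‖u j + (s * inner ℝ (u j) v) • v‖) ^ p := by
      ext s
      simp only [hg, blockSize, hrow]
    rw [e]
    exact HasDerivAt.fun_sum fun i _ => hasDerivAt_lqNorm_rpow (G.block i) u v (hq i) hp
  have hV0 : g (Vs 0) = 1 := by
    have : Vs 0 = U := by
      simp only [hVs, zero_smul]
      have : Matrix.replicateCol Unit (0 : Fin d → ℝ) = 0 := by ext; simp
      rw [this, Matrix.zero_mul, add_zero, Matrix.mul_one]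
    rw [this, hgU1]
  have hderiv2 : HasDerivAt (fun s => g (Vs s) ^ (d / p) - (1 + s * ‖v‖ ^ 2))
      (D * (d / p) - ‖v‖ ^ 2) 0 := by
    have h1 := hderiv.rpow_const (p := d / p) (Or.inl (by rw [hV0]; norm_num))
    rw [hV0, Real.one_rpow, mul_one] at h1
    have h2 : HasDerivAt (fun s : ℝ => 1 + s * ‖v‖ ^ 2) (‖v‖ ^ 2) 0 := by
      simpa using ((hasDerivAt_id (0 : ℝ)).mul_const (‖v‖ ^ 2)).const_add 1
    exact h1.sub h2
  -- By `hscale` the function is nonnegative near `0`, and it vanishes at `0`. Its derivative there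
  -- is `d D / p - ‖v‖²`, whose vanishing is the Lewis identity.
  have hmin : IsLocalMin (fun s => g (Vs s) ^ (d / p) - (1 + s * ‖v‖ ^ 2)) 0 := by
    have hev : ∀ᶠ s in nhds (0 : ℝ), 0 < g (Vs s) :=
      hderiv.continuousAt.eventually (lt_mem_nhds (show 0 < g (Vs 0) by rw [hV0]; norm_num))
    filter_upwards [hev] with s hs
    have h1 := hscale (Vs s) hs
    rw [hdets, abs_mul, mul_comm] at h1
    have h2 := le_of_mul_le_mul_right h1 hU0
    have h3 := le_abs_self (1 + s * ‖v‖ ^ 2)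
    rw [hV0, Real.one_rpow]
    linarith
  have h0 := hmin.hasDerivAt_eq_zero hderiv2
  have h1 : D * (d / p) = d * (D / p) := by ring
  rw [h1, hD, ← Finset.mul_sum, mul_div_cancel_left₀ _ hp.ne'] at h0
  linarith

end BlockData

end

/-! ### Existence of block Lewis overestimates with `F = n`. -/

noncomputable section

/-- The power mean inequality of order `q/2 ≥ 1` for `(y_j/t_j)²` with weights `t_j^q / ‖t‖_q^q`.
Applied blockwise, it yields the rounding property of the Lewis weights. -/
theorem sum_rpow_mul_sq_le {k : ℕ} (s : Finset (Fin k)) {q : ℝ} (hq : 2 ≤ q) (t y : Fin k → ℝ)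
    (ht : ∀ j, 0 ≤ t j) (hα : 0 < lqNorm s q t) (hy : ∀ j ∈ s, t j = 0 → y j = 0) :
    ∑ j ∈ s, t j ^ (q - 2) * y j ^ 2 ≤ lqNorm s q t ^ (q - 2) * lqNorm s q y ^ 2 := by
  have hq0 : 0 < q := by linarith
  set α := lqNorm s q t with hαdef
  have hαq : α ^ q = ∑ j ∈ s, t j ^ q := by
    rw [hαdef, lqNorm_rpow_self hq0]
    exact Finset.sum_congr rfl fun j _ => by rw [abs_of_nonneg (ht j)]
  have hαq0 : 0 < α ^ q := by positivity
  have h := Real.arith_mean_le_rpow_mean s (fun j => t j ^ q / α ^ q) (fun j => (y j / t j) ^ 2)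
    (fun j _ => div_nonneg (Real.rpow_nonneg (ht j) q) hαq0.le)
    (by rw [← Finset.sum_div, ← hαq, div_self hαq0.ne'])
    (fun j _ => sq_nonneg _) (p := q / 2) (by linarith)
  have e1 : ∑ j ∈ s, t j ^ q / α ^ q * (y j / t j) ^ 2 =
      (α ^ q)⁻¹ * ∑ j ∈ s, t j ^ (q - 2) * y j ^ 2 := by
    rw [Finset.mul_sum]
    refine Finset.sum_congr rfl fun j hj => ?_
    rcases (ht j).eq_or_lt with h0 | h0
    · rw [hy j hj h0.symm]; simp
    · rw [Real.rpow_sub h0, Real.rpow_two]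
      field_simp
  have e2 : ∑ j ∈ s, t j ^ q / α ^ q * ((y j / t j) ^ 2) ^ (q / 2) ≤
      (α ^ q)⁻¹ * lqNorm s q y ^ q := by
    rw [lqNorm_rpow_self (s := s) hq0 y, Finset.mul_sum]
    refine Finset.sum_le_sum fun j _ => ?_
    rcases (ht j).eq_or_lt with h0 | h0
    · rw [← h0, Real.zero_rpow hq0.ne', zero_div, zero_mul]; positivity
    · have : ((y j / t j) ^ 2) ^ (q / 2) = |y j| ^ q / t j ^ q := by
        rw [← sq_abs, ← Real.rpow_two, ← Real.rpow_mul (abs_nonneg _),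
          mul_div_cancel₀ _ two_ne_zero, abs_div, abs_of_pos h0,
          Real.div_rpow (abs_nonneg _) h0.le]
      rw [this]
      have : 0 < t j ^ q := by positivity
      apply le_of_eq
      field_simp
  have hN := lqNorm_nonneg (s := s) (q := q) y
  have h3 := h.trans (Real.rpow_le_rpow (Finset.sum_nonneg fun j _ => mul_nonneg
    (div_nonneg (Real.rpow_nonneg (ht j) q) hαq0.le) (Real.rpow_nonneg (sq_nonneg _) _)) e2
    (by positivity))
  rw [e1, Real.mul_rpow (by positivity) (by positivity), Real.inv_rpow hαq0.le,
    ← Real.rpow_mul hα.le, ← Real.rpow_mul hN, show q * (1 / (q / 2)) = 2 by field_simp,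
    Real.rpow_two, Real.rpow_two, inv_mul_le_iff₀ hαq0] at h3
  refine h3.trans_eq ?_
  rw [Real.rpow_sub hα, Real.rpow_two]
  field_simp

/-- Every matrix has the same values as a matrix with a left inverse and at most as many columns. -/
theorem Matrix.exists_fullRank_factor {k n : ℕ} (A : Matrix (Fin k) (Fin n) ℝ) :
    ∃ (d : ℕ) (B : Matrix (Fin k) (Fin d) ℝ) (C : Matrix (Fin d) (Fin k) ℝ), d ≤ n ∧ C * B = 1 ∧
      ∀ x, ∃ y, A *ᵥ x = B *ᵥ y := by
  have hdn : Module.finrank ℝ (LinearMap.range A.mulVecLin) ≤ n := by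
    have := LinearMap.finrank_range_le A.mulVecLin
    rwa [Module.finrank_fin_fun] at this
  obtain ⟨e⟩ : Nonempty (LinearMap.range A.mulVecLin ≃ₗ[ℝ]
      (Fin (Module.finrank ℝ (LinearMap.range A.mulVecLin)) → ℝ)) :=
    ⟨(Module.finBasis ℝ _).equivFun⟩
  generalize Module.finrank ℝ (LinearMap.range A.mulVecLin) = d at e hdn
  obtain ⟨Cl, hCl⟩ := ((LinearMap.range A.mulVecLin).subtype ∘ₗ
    e.symm.toLinearMap).exists_leftInverse_of_injective (by
      rw [LinearMap.ker_eq_bot]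
      exact (Subtype.val_injective).comp e.symm.injective)
  refine ⟨d, LinearMap.toMatrix' ((LinearMap.range A.mulVecLin).subtype ∘ₗ e.symm.toLinearMap),
    LinearMap.toMatrix' Cl, hdn, ?_, fun x => ⟨e ⟨A *ᵥ x, LinearMap.mem_range.2 ⟨x, rfl⟩⟩, ?_⟩⟩
  · rw [← LinearMap.toMatrix'_comp, hCl, LinearMap.toMatrix'_id]
  · rw [LinearMap.toMatrix'_mulVec]
    simp

namespace BlockData

variable {k n m : ℕ} (G : BlockData k n m) {p : ℝ}

/-- Lewis vectors: the rows of `A`, in a position that satisfies the Lewis identity. -/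
theorem exists_lewis_vectors (hp : 0 < p) (hq : ∀ i, 2 ≤ G.q i) (hA : G.A ≠ 0) :
    ∃ (d : ℕ) (u : Fin k → EuclideanSpace ℝ (Fin d)), 0 < d ∧ d ≤ n ∧
      (∀ x, ∃ v, ∀ j, (G.A *ᵥ x) j = inner ℝ (u j) v) ∧
      ∑ i, lqNorm (G.block i) (G.q i) (fun j => ‖u j‖) ^ p = 1 ∧
      ∀ v, ‖v‖ ^ 2 = d * ∑ i, (lqNorm (G.block i) (G.q i) (fun j => ‖u j‖) ^ (p - G.q i) *
        ∑ j ∈ G.block i, ‖u j‖ ^ (G.q i - 2) * (inner ℝ (u j) v) ^ 2) := by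
  obtain ⟨d, B, C, hdn, hCB, hAB⟩ := Matrix.exists_fullRank_factor G.A
  have hd0 : 0 < d := by
    rcases Nat.eq_zero_or_pos d with rfl | h
    · obtain ⟨j, hj⟩ := Function.ne_iff.1 hA
      obtain ⟨y, hy⟩ := hAB (G.A j)
      have h1 : G.A j ⬝ᵥ G.A j = 0 := by
        have := congrFun hy j
        simpa [Matrix.mulVec, dotProduct] using this
      exact absurd (dotProduct_self_eq_zero.1 h1) hj
    · exact h
  obtain ⟨U, hU, h1, h2⟩ := G.exists_lewis_position hp hq hd0 B C hCB
  refine ⟨d, fun j => WithLp.toLp 2 ((B * U) j), hd0, hdn, fun x => ?_, h1, h2⟩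
  obtain ⟨y, hy⟩ := hAB x
  refine ⟨WithLp.toLp 2 (U⁻¹ *ᵥ y), fun j => ?_⟩
  have h4 : B *ᵥ y = (B * U) *ᵥ (U⁻¹ *ᵥ y) := by
    rw [Matrix.mulVec_mulVec, Matrix.mul_assoc, Matrix.mul_nonsing_inv U hU, Matrix.mul_one]
  rw [hy, h4, PiLp.inner_apply]
  change ∑ l, (B * U) j l * (U⁻¹ *ᵥ y) l = _
  refine Finset.sum_congr rfl fun l _ => ?_
  simp [mul_comm]

/-- A zero matrix has rank `0` and hence no Lewis position, but all leverage scores vanish and a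
point mass suffices. -/
theorem exists_isBlockLewisOverestimate_of_eq_zero (hn : 0 < n) (hm : 0 < m) (hA : G.A = 0) :
    ∃ lam w, G.IsBlockLewisOverestimate p n lam w := by
  refine ⟨Pi.single ⟨0, hm⟩ 1, fun _ => 1, ⟨⟨fun i => ?_, by simp⟩, fun j hj => ?_⟩,
    ⟨fun _ => one_pos, fun x => ?_⟩, by exact_mod_cast hn, fun i => ?_⟩
  · by_cases h : i = ⟨0, hm⟩
    · subst h; simp
    · simp [Pi.single_eq_of_ne h]
  · exact absurd (by rw [hA]; rfl) hj
  · have : G.rounded p (Pi.single ⟨0, hm⟩ 1) (fun _ => 1) = 0 := by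
      simp [rounded, scaled, hA]
    rw [this, Matrix.zero_mulVec, WithLp.toLp_zero, norm_zero]
    exact G.gnorm_nonneg _ _
  · have : G.levSum p (Pi.single ⟨0, hm⟩ 1) (fun _ => 1) i = 0 := by
      refine Finset.sum_eq_zero fun j _ => ?_
      rw [leverageScore_eq_zero (rounded_row_eq_zero (by rw [hA]; rfl) _ _ _), zero_div,
        Real.zero_rpow (half_pos (G.q_pos i)).ne']
    rw [this, Real.zero_rpow (div_pos two_pos (G.q_pos i)).ne', mul_zero]
    positivity

/-- Block Lewis weights exist if all inner exponents are at least `2`. -/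
theorem exists_isBlockLewisOverestimate (hp : 0 < p) (hq : ∀ i, 2 ≤ G.q i) (hn : 0 < n)
    (hm : 0 < m) : ∃ lam w, G.IsBlockLewisOverestimate p n lam w := by
  classical
  by_cases hA : G.A = 0
  · exact G.exists_isBlockLewisOverestimate_of_eq_zero hn hm hA
  obtain ⟨d, u, hd, hdn, hAu, hsum, hid⟩ := G.exists_lewis_vectors hp hq hA
  have hd' : (0 : ℝ) < d := by exact_mod_cast hd
  set α : Fin m → ℝ := fun i => lqNorm (G.block i) (G.q i) (fun j => ‖u j‖) with hαdef
  have hα0 : ∀ i, 0 ≤ α i := fun i => lqNorm_nonneg _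
  have hαq : ∀ i, α i ^ G.q i = ∑ j ∈ G.block i, ‖u j‖ ^ G.q i := fun i => by
    simp only [hαdef]
    rw [lqNorm_rpow_self (G.q_pos i)]; simp
  have hαpos : ∀ i, ∀ j ∈ G.block i, u j ≠ 0 → 0 < α i := by
    intro i j hj hu
    refine lt_of_le_of_ne (hα0 i) fun h => ?_
    have h1 := hαq i
    rw [← h, Real.zero_rpow (G.q_pos i).ne'] at h1
    have h2 := (Finset.sum_eq_zero_iff_of_nonneg fun j _ => by positivity).1 h1.symm j hj
    exact hu (norm_eq_zero.1 ((Real.rpow_eq_zero (norm_nonneg _) (G.q_pos i).ne').1 h2))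
  -- The normalization of the position makes `λ` a probability vector. The matrix `W` below is
  -- chosen so that the rounded entries squared carry the weights `α_i^{p-q_i} ‖u_j‖^{q_i-2}` of the
  -- Lewis identity; its value `1` at `u_j = 0` only keeps it positive.
  set lam : Fin m → ℝ := fun i => α i ^ p with hlam
  set w : Fin k → ℝ := fun j =>
    if u j = 0 then 1 else (‖u j‖ / α (G.grp j)) ^ (G.q (G.grp j) - 2) with hw
  have hw0 : ∀ j, 0 < w j := fun j => by
    simp only [hw]
    split_ifs with h
    · exact one_pos
    · have := hαpos (G.grp j) j (G.mem_block.2 rfl) h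
      have := norm_pos_iff.2 h
      positivity
  have hmeas : G.IsGroupMeasure lam := by
    refine ⟨⟨fun i => Real.rpow_nonneg (hα0 i) p, hsum⟩, fun j hj => ?_⟩
    refine Real.rpow_pos_of_pos (hαpos _ j (G.mem_block.2 rfl) fun h => ?_) p
    obtain ⟨v, hv⟩ := hAu (G.A j)
    have h1 := hv j
    rw [h, inner_zero_left] at h1
    exact hj (dotProduct_self_eq_zero.1 h1)
  have hentry : ∀ x v, (∀ j, (G.A *ᵥ x) j = inner ℝ (u j) v) → ∀ i, ∀ j ∈ G.block i,
      (G.rounded p lam w *ᵥ x) j ^ 2 =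
        α i ^ (p - G.q i) * (‖u j‖ ^ (G.q i - 2) * (inner ℝ (u j) v) ^ 2) := by
    intro x v hv i j hj
    rw [rounded_mulVec, hv, G.mem_block.1 hj]
    by_cases h : u j = 0
    · simp [h]
    have ha := hαpos i j hj h
    have hu := norm_pos_iff.2 h
    simp only [hw, if_neg h, hlam, G.mem_block.1 hj]
    rw [mul_pow, mul_pow, ← Real.sqrt_eq_rpow, Real.sq_sqrt (by positivity),
      ← Real.rpow_two ((α i ^ p) ^ _), ← Real.rpow_mul (x := α i ^ p) (by positivity),
      ← Real.rpow_mul ha.le, Real.div_rpow hu.le ha.le,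
      show p * ((1 / 2 - 1 / p) * 2) = (p - G.q i) + (G.q i - 2) by field_simp; ring,
      Real.rpow_add ha]
    have : 0 < α i ^ (G.q i - 2) := by positivity
    field_simp
  have hnormsum : ∀ x v, (∀ j, (G.A *ᵥ x) j = inner ℝ (u j) v) →
      ‖WithLp.toLp 2 (G.rounded p lam w *ᵥ x)‖ ^ 2 = ∑ i, (α i ^ (p - G.q i) *
        ∑ j ∈ G.block i, ‖u j‖ ^ (G.q i - 2) * (inner ℝ (u j) v) ^ 2) := by
    intro x v hv
    rw [EuclideanSpace.real_norm_sq_eq, ← G.sum_block]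
    refine Finset.sum_congr rfl fun i _ => ?_
    rw [Finset.mul_sum]
    exact Finset.sum_congr rfl fun j hj => hentry x v hv i j hj
  -- By the Lewis identity the rounded norm is `‖v‖ / √d`, so Cauchy–Schwarz bounds the leverage
  -- scores with the factor `d ≤ n`.
  have hnorm : ∀ x v, (∀ j, (G.A *ᵥ x) j = inner ℝ (u j) v) →
      ‖v‖ ^ 2 = d * ‖WithLp.toLp 2 (G.rounded p lam w *ᵥ x)‖ ^ 2 := fun x v hv => by
    rw [hnormsum x v hv]; exact hid v
  have hlev : ∀ i, ∀ j ∈ G.block i, leverageScore (G.rounded p lam w) j / w j ≤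
      d * α i ^ (p - 2) * ‖u j‖ ^ 2 := by
    intro i j hj
    have hq0 := hq i
    have h1 : leverageScore (G.rounded p lam w) j ≤
        d * (α i ^ (p - G.q i) * (‖u j‖ ^ (G.q i - 2) * ‖u j‖ ^ 2)) := by
      have := hα0 i
      refine leverageScore_le _ j _ (fun x => ?_) (by positivity)
      obtain ⟨v, hv⟩ := hAu x
      have hI : (inner ℝ (u j) v) ^ 2 ≤ ‖u j‖ ^ 2 * ‖v‖ ^ 2 := by
        rw [← mul_pow, ← sq_abs]
        exact pow_le_pow_left₀ (abs_nonneg _) (abs_real_inner_le_norm _ _) 2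
      rw [hentry x v hv i j hj]
      calc _ ≤ α i ^ (p - G.q i) * (‖u j‖ ^ (G.q i - 2) * (‖u j‖ ^ 2 * ‖v‖ ^ 2)) := by gcongr
        _ = _ := by rw [hnorm x v hv]; ring
    rw [div_le_iff₀ (hw0 j)]
    refine h1.trans ?_
    by_cases h : u j = 0
    · simp [h]
    have ha := hαpos i j hj h
    have hu := norm_pos_iff.2 h
    simp only [hw, if_neg h, G.mem_block.1 hj]
    rw [show p - G.q i = (p - 2) - (G.q i - 2) by ring, Real.rpow_sub ha,
      Real.div_rpow hu.le ha.le]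
    apply le_of_eq
    field_simp
  refine ⟨lam, w, hmeas, ⟨hw0, fun x => ?_⟩, by exact_mod_cast hn, fun i => ?_⟩
  · refine (sq_le_sq₀ (norm_nonneg _) (G.gnorm_nonneg _ _)).1 ?_
    obtain ⟨v, hv⟩ := hAu x
    rw [gnorm_two_scaled_sq G hmeas, hnormsum x v hv]
    refine Finset.sum_le_sum fun i _ => ?_
    have hyv : G.A *ᵥ x = fun j => (inner ℝ (u j) v : ℝ) := funext hv
    rcases (hα0 i).eq_or_lt with h0 | h0
    · rw [Finset.sum_eq_zero, mul_zero]
      · have := hα0 i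
        positivity
      · intro j hj
        have : u j = 0 := by
          by_contra h
          exact (hαpos i j hj h).ne h0
        simp [this]
    · have h1 := sum_rpow_mul_sq_le (G.block i) (hq i) (fun j => ‖u j‖)
        (fun j => (inner ℝ (u j) v : ℝ)) (fun j => norm_nonneg _) h0
        (fun j _ h => by rw [norm_eq_zero.1 h, inner_zero_left])
      rw [← hyv] at h1
      refine (mul_le_mul_of_nonneg_left h1 (Real.rpow_nonneg (hα0 i) _)).trans (le_of_eq ?_)
      change α i ^ (p - G.q i) * (α i ^ (G.q i - 2) * _) = α i ^ p * ((α i ^ p) ^ (-(1 / p)) * _) ^ 2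
      rw [← mul_assoc, ← Real.rpow_add h0, ← Real.rpow_mul h0.le,
        show p * -(1 / p) = -1 by field_simp, Real.rpow_neg_one, mul_pow, ← mul_assoc,
        show p - G.q i + (G.q i - 2) = p - 2 by ring, Real.rpow_sub h0, Real.rpow_two]
      field_simp
  · have hq0 := G.q_pos i
    rcases (hα0 i).eq_or_lt with h0 | h0
    · simp only [hlam]
      rw [← h0, Real.zero_rpow hp.ne', div_zero, zero_mul]
      positivity
    have h1 : G.levSum p lam w i ≤ (d * α i ^ (p - 2)) ^ (G.q i / 2) * α i ^ G.q i := by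
      rw [hαq, Finset.mul_sum]
      refine Finset.sum_le_sum fun j hj => ?_
      refine (Real.rpow_le_rpow (div_nonneg (leverageScore_nonneg _ j) (hw0 j).le)
        (hlev i j hj) (by positivity)).trans (le_of_eq ?_)
      rw [Real.mul_rpow (by positivity) (by positivity), ← Real.rpow_two,
        ← Real.rpow_mul (norm_nonneg _), mul_div_cancel₀ _ two_ne_zero]
    have h2 : G.levSum p lam w i ^ (2 / G.q i) ≤ d * lam i := by
      refine (Real.rpow_le_rpow (Finset.sum_nonneg fun j _ => Real.rpow_nonneg
        (div_nonneg (leverageScore_nonneg _ j) (hw0 j).le) _) h1 (by positivity)).trans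
        (le_of_eq ?_)
      rw [Real.mul_rpow (by positivity) (by positivity), ← Real.rpow_mul (by positivity),
        ← Real.rpow_mul h0.le, show G.q i / 2 * (2 / G.q i) = 1 by field_simp,
        mul_div_cancel₀ _ hq0.ne', Real.rpow_one, mul_assoc, ← Real.rpow_add h0, sub_add_cancel]
    have hl : 0 < lam i := Real.rpow_pos_of_pos h0 p
    rw [one_div, inv_mul_le_iff₀ hl, mul_comm]
    refine h2.trans ?_
    gcongr

/-- For singleton groups the inner exponents play no role. -/
theorem exists_isBlockLewisOverestimate_of_card_eq_one (hp : 0 < p)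
    (h1 : ∀ i, (G.block i).card = 1) (hn : 0 < n) (hm : 0 < m) :
    ∃ lam w, G.IsBlockLewisOverestimate p n lam w := by
  let G' : BlockData k n m := { G with q := fun _ => 2, q_pos := fun _ => two_pos }
  obtain ⟨lam, w, hmeas, hround, hpos, hb⟩ :=
    G'.exists_isBlockLewisOverestimate hp (fun _ => le_rfl) hn hm
  refine ⟨lam, w, hmeas, ⟨hround.1, fun x => ?_⟩, hpos, fun i => ?_⟩
  · refine (hround.2 x).trans (le_of_eq ?_)
    change G'.gnorm 2 (G.scaled p lam *ᵥ x) = _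
    rw [gnorm, gnorm]
    congr 1
    refine Finset.sum_congr rfl fun i _ => ?_
    change lqNorm (G.block i) 2 _ ^ _ = _
    obtain ⟨j, hj⟩ := Finset.card_eq_one.1 (h1 i)
    rw [hj, lqNorm_singleton two_pos, lqNorm_singleton (G.q_pos i)]
  · refine le_trans (le_of_eq ?_) (hb i)
    congr 1
    change _ = (∑ j ∈ G.block i, (leverageScore (G.rounded p lam w) j / w j) ^ ((2 : ℝ) / 2)) ^
      ((2 : ℝ) / 2)
    rw [levSum]
    obtain ⟨j, hj⟩ := Finset.card_eq_one.1 (h1 i)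
    have hq := G.q_pos i
    have h0 : 0 ≤ leverageScore (G.rounded p lam w) j / w j :=
      div_nonneg (leverageScore_nonneg _ j) (hround.1 j).le
    rw [hj, Finset.sum_singleton, Finset.sum_singleton, ← Real.rpow_mul h0, ← Real.rpow_mul h0]
    congr 1
    field_simp

variable {G} in
theorem GroupRegime.exists_isBlockLewisOverestimate (h : G.GroupRegime p) (hp : 0 < p)
    (hn : 0 < n) (hm : 0 < m) : ∃ lam w, G.IsBlockLewisOverestimate p n lam w := by
  rcases h with h | h | h
  · exact G.exists_isBlockLewisOverestimate_of_card_eq_one hp h.2 hn hm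
  · exact BlockData.exists_isBlockLewisOverestimate G hp h.2 hn hm
  · exact BlockData.exists_isBlockLewisOverestimate G hp (fun i => (h.2 i).ge) hn hm

end BlockData

end
theorem mainTheorem5 :
    ∃ C : ℝ → ℝ, (∀ p, 0 < C p) ∧
      ∀ (p : ℝ) (hp : 0 < p) (k n m : ℕ) (G : BlockData k n m),
        (G.GroupRegime p →
          (∀ (F : ℝ) (lam : Fin m → ℝ) (w : Fin k → ℝ),
            G.IsBlockLewisOverestimate p F lam w →
              G.CoveringBound (C p) p F (G.alphaPow p lam w)) ∧
          (0 < n → 0 < m →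
            ∃ (lam : Fin m → ℝ) (w : Fin k → ℝ),
              G.IsBlockLewisOverestimate p n lam w ∧
              G.CoveringBound (C p) p n (G.alphaPow p lam w))) ∧
        (G.RowRegime p →
          (∀ (F : ℝ) (lamHat : Fin k → ℝ) (w : Fin k → ℝ),
            (G.rowwise p hp).IsBlockLewisOverestimate p F lamHat w →
              G.CoveringBound (C p) p F (G.alphaPowHat p hp lamHat w)) ∧
          (0 < n → 0 < m →
            ∃ (lamHat : Fin k → ℝ) (w : Fin k → ℝ),
              (G.rowwise p hp).IsBlockLewisOverestimate p n lamHat w ∧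
              G.CoveringBound (C p) p n (G.alphaPowHat p hp lamHat w))) := by
  -- The value for `p ≤ 0` is arbitrary and only has to be positive.
  refine ⟨fun p => if 0 < p then 4 * packingConst p else 1, fun p => ?_,
    fun p hp k n m G => ⟨fun hreg => ?_, fun hreg => ?_⟩⟩
  · dsimp only
    split_ifs with hp
    · have := BlockData.packingConst_pos hp
      positivity
    · exact one_pos
  · simp only [if_pos hp]
    refine ⟨fun F lam w h => h.coveringBound hp hreg, fun hn hm => ?_⟩
    obtain ⟨lam, w, h⟩ := hreg.exists_isBlockLewisOverestimate hp hn hm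
    exact ⟨lam, w, h, h.coveringBound hp hreg⟩
  · simp only [if_pos hp]
    refine ⟨fun F lamHat w h => h.coveringBound_rowwise hp hreg, fun hn hm => ?_⟩
    have hk : 0 < k := by
      obtain ⟨j, -⟩ := G.grp_surjective ⟨0, hm⟩
      exact j.pos
    -- Single rows are singleton groups, so existence holds although the inner exponent `p` is below
    -- `2`.
    obtain ⟨lamHat, w, h⟩ := (G.rowwise p hp).exists_isBlockLewisOverestimate_of_card_eq_one hp
      (fun j => by rw [G.rowwise_block hp, Finset.card_singleton]) hn hk
    exact ⟨lamHat, w, h, h.coveringBound_rowwise hp hreg⟩
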